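/- **Setting.** A graph is a finite directed graph $G=(V,E)$, $|V|=n\ge 1$, with real edge weights $w$, in which a set of edges is designated as *negative*: every edge of weight $<0$ is designated, and designated edges have weight $\le 0$. $G$ is *well-behaved* if for every negative edge $(r,\bar r)$ the vertex $r$ has out-degree $1$ and no incoming negative edge, $\bar r$ has in-degree $1$ and no outgoing negative edge, and $(\bar r,r)$ is an edge of weight $-w(r,\bar r)$. The tail $r$ of a negative edge is a *negative vertex*; $N$ is the set of negative vertices and $\eta=|N|$. The *$h$-hop distance* $d^h(u,v)$ is the minimum weight of a walk from $u$ to $v$ that traverses negative edges at most $h$ times ($+\infty$ if there is none). The *$h$-hop betweenness* of $(u,v)\in V\times V$ is the number of $r\in N$ with $d^h(u,r)+d^h(r,v)<0$. For real numbers $\Delta_r$ ($r\in N$) put $$V^{\mathrm{in}}_r=\{v\in V: d^h(v,r)<\Delta_r\},\qquad V^{\mathrm{out}}_r=\{v\in V: d^h(r,v)<-\Delta_r\}.$$ Algorithms are randomized programs on a real RAM: unit-cost arithmetic, comparisons and indirect addressing on words of $O(\log(n+h))$ bits; unit-cost copying, addition, subtraction and comparison of exact reals; unit-cost tosses of independent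 fair coins. The graph is given by its adjacency matrix. **Lemma.** There is an absolute constant $C$ such that for every $c\in\mathbb N$ there is a randomized algorithm with the following properties. On input a well-behaved graph $G$ with $n$ vertices and $\eta$ negative vertices and an integer $h\ge 1$, it outputs a real number $\Delta_r$ for every $r\in N$, and it always halts within $\tilde O(hn^2)$ steps, that is, within $K\,h\,n^2(\lfloor\log_2 n\rfloor+1)^k$ steps with $K,k$ depending only on $c$. For every real $b\ge 1$ such that every pair $(u,v)\in V\times V$ has $h$-hop betweenness at most $\eta/b$ in $G$ (as is the case, with high probability, after betweenness reduction with parameters $b$ and $h$), with probability at least $1-n^{-c}$ both $$\sum_{r\in N}\bigl(|V^{\mathrm{in}}_r|+|V^{\mathrm{out}}_r|\bigr)^2\le C\,\frac{\eta n^2}{b}\qquad\text{and}\qquad \sum_{r\in N}\bigl(|V^{\mathrm{in}}_r|+|V^{\mathrm{out}}_r|\bigr)\le C\,\frac{\eta n}{\sqrt b}$$ hold. -/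

import Mathlib

/-! ### Weighted directed graphs with designated negative edges -/

/-- A directed graph with vertex set `Fin n`, real edge weights and a designated set of
"negative" edges. Every edge of negative weight is designated; a designated edge has weight
at most zero (an edge of weight exactly zero may be designated or not). Values of `weight`
off the edge set are irrelevant. -/
structure NegGraph (n : ℕ) where
  Adj : Fin n → Fin n → Prop
  weight : Fin n → Fin n → ℝ
  Neg : Fin n → Fin n → Prop
  adj_of_neg : ∀ u v, Neg u v → Adj u v
  weight_nonpos_of_neg : ∀ u v, Neg u v → weight u v ≤ 0
  neg_of_weight_neg : ∀ u v, Adj u v → weight u v < 0 → Neg u v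

namespace NegGraph

variable {n : ℕ}

/-- For every negative edge `(r, r')`: `r` has out-degree one and no incoming negative edge,
`r'` has in-degree one and no outgoing negative edge, and `(r', r)` is an edge of the opposite
weight. -/
def WellBehaved (G : NegGraph n) : Prop :=
  ∀ r r', G.Neg r r' →
    (∀ v, G.Adj r v → v = r') ∧ (∀ u, ¬ G.Neg u r) ∧
    (∀ u, G.Adj u r' → u = r) ∧ (∀ v, ¬ G.Neg r' v) ∧
    G.Adj r' r ∧ G.weight r' r = - G.weight r r'

/-- `G.Walk u v k x`: there is a directed walk from `u` to `v` with exactly `k` hops (traversals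
of negative edges) and total weight `x`. -/
inductive Walk (G : NegGraph n) : Fin n → Fin n → ℕ → ℝ → Prop
  | nil (u : Fin n) : Walk G u u 0 0
  | cons {u v z : Fin n} {k : ℕ} {x : ℝ} (e : G.Adj u v) (hn : ¬ G.Neg u v)
      (p : Walk G v z k x) : Walk G u z k (G.weight u v + x)
  | hop {u v z : Fin n} {k : ℕ} {x : ℝ} (e : G.Neg u v)
      (p : Walk G v z k x) : Walk G u z (k + 1) (G.weight u v + x)

/-- The `h`-hop distance: the least weight of a walk with at most `h` hops, and `⊤` if there is
no such walk. -/
noncomputable def hopDist (G : NegGraph n) (h : ℕ) (u v : Fin n) : EReal :=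
  ⨅ (x : ℝ) (_ : ∃ k ≤ h, G.Walk u v k x), (x : EReal)

open Classical in
/-- The set of negative vertices: the tails of the negative edges. -/
noncomputable def negVerts (G : NegGraph n) : Finset (Fin n) :=
  Finset.univ.filter fun r => ∃ v, G.Neg r v

open Classical in
/-- The `h`-hop betweenness of `(u, v)`: the number of negative vertices `r` with
`d^h(u, r) + d^h(r, v) < 0`. -/
noncomputable def betweenness (G : NegGraph n) (h : ℕ) (u v : Fin n) : ℕ :=
  (G.negVerts.filter fun r => G.hopDist h u r + G.hopDist h r v < 0).card

open Classical in
/-- The set of vertices `v` with `d^h(v, r) < δ`. -/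
noncomputable def inBall (G : NegGraph n) (h : ℕ) (r : Fin n) (δ : ℝ) : Finset (Fin n) :=
  Finset.univ.filter fun v => G.hopDist h v r < (δ : EReal)

open Classical in
/-- The set of vertices `v` with `d^h(r, v) < δ`. -/
noncomputable def outBall (G : NegGraph n) (h : ℕ) (r : Fin n) (δ : ℝ) : Finset (Fin n) :=
  Finset.univ.filter fun v => G.hopDist h r v < (δ : EReal)

/-- `|V^in_r| + |V^out_r|`, where `V^in_r = {v | d^h(v, r) < Δ_r}` and
`V^out_r = {v | d^h(r, v) < -Δ_r}`. -/
noncomputable def ballSize (G : NegGraph n) (h : ℕ) (Δ : Fin n → ℝ) (r : Fin n) : ℕ :=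
  (G.inBall h r (Δ r)).card + (G.outBall h r (- Δ r)).card

end NegGraph

/-! ### Randomized real RAM programs

A machine with `w`-bit words and exact reals. Word arithmetic is reduced modulo `2 ^ w`; reals can
only be copied, added, subtracted and compared. Scalar variables and arrays of either kind are
named by constants of the program, array cells are addressed by words. Every operation, memory
access, comparison, branch, assignment and coin toss is charged. -/

namespace RealRAM

/-- Word expressions; `get a i` reads cell `i` of word array `a`, `sub` is truncated at zero, and
the quotient by zero is zero. -/
inductive WExp
  | lit (k : ℕ)
  | var (x : ℕ)
  | get (a : ℕ) (i : WExp)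
  | add (e f : WExp)
  | sub (e f : WExp)
  | mul (e f : WExp)
  | div (e f : WExp)
  | mod (e f : WExp)

/-- Real expressions; `get a i` reads cell `i` of real array `a`. -/
inductive RExp
  | zero
  | one
  | var (x : ℕ)
  | get (a : ℕ) (i : WExp)
  | add (e f : RExp)
  | sub (e f : RExp)

/-- Tests. -/
inductive BExp
  | weq (e f : WExp)
  | wlt (e f : WExp)
  | rlt (e f : RExp)
  | not (p : BExp)
  | and (p q : BExp)

/-- Programs. `flip x` stores a fair random bit in the word variable `x`. -/
inductive Prog
  | skip
  | setW (x : ℕ) (e : WExp)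
  | setR (x : ℕ) (e : RExp)
  | putW (a : ℕ) (i e : WExp)
  | putR (a : ℕ) (i : WExp) (e : RExp)
  | flip (x : ℕ)
  | seq (p q : Prog)
  | ite (t : BExp) (p q : Prog)
  | loop (t : BExp) (p : Prog)

/-- Machine states: word and real variables, word and real arrays, and the number of coins
tossed so far. -/
structure State where
  wvar : ℕ → ℕ
  rvar : ℕ → ℝ
  warr : ℕ → ℕ → ℕ
  rarr : ℕ → ℕ → ℝ
  coins : ℕ

/-- Value of a word expression on a machine with `w`-bit words. -/
def WExp.eval (w : ℕ) (s : State) : WExp → ℕ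
  | lit k => k % 2 ^ w
  | var x => s.wvar x
  | get a i => s.warr a (i.eval w s)
  | add e f => (e.eval w s + f.eval w s) % 2 ^ w
  | sub e f => (e.eval w s - f.eval w s) % 2 ^ w
  | mul e f => (e.eval w s * f.eval w s) % 2 ^ w
  | div e f => (e.eval w s / f.eval w s) % 2 ^ w
  | mod e f => (e.eval w s % f.eval w s) % 2 ^ w

/-- Number of operations in a word expression. -/
def WExp.cost : WExp → ℕ
  | lit _ => 1
  | var _ => 1
  | get _ i => i.cost + 1
  | add e f => e.cost + f.cost + 1
  | sub e f => e.cost + f.cost + 1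
  | mul e f => e.cost + f.cost + 1
  | div e f => e.cost + f.cost + 1
  | mod e f => e.cost + f.cost + 1

/-- Value of a real expression. -/
noncomputable def RExp.eval (w : ℕ) (s : State) : RExp → ℝ
  | zero => 0
  | one => 1
  | var x => s.rvar x
  | get a i => s.rarr a (i.eval w s)
  | add e f => e.eval w s + f.eval w s
  | sub e f => e.eval w s - f.eval w s

/-- Number of operations in a real expression. -/
def RExp.cost : RExp → ℕ
  | zero => 1
  | one => 1
  | var _ => 1
  | get _ i => i.cost + 1
  | add e f => e.cost + f.cost + 1
  | sub e f => e.cost + f.cost + 1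

/-- Truth of a test. -/
def BExp.Holds (w : ℕ) (s : State) : BExp → Prop
  | weq e f => e.eval w s = f.eval w s
  | wlt e f => e.eval w s < f.eval w s
  | rlt e f => e.eval w s < f.eval w s
  | not p => ¬ p.Holds w s
  | and p q => p.Holds w s ∧ q.Holds w s

/-- Number of operations in a test. -/
def BExp.cost : BExp → ℕ
  | weq e f => e.cost + f.cost + 1
  | wlt e f => e.cost + f.cost + 1
  | rlt e f => e.cost + f.cost + 1
  | not p => p.cost + 1
  | and p q => p.cost + q.cost + 1

/-- `Exec w ω p s s' t`: on a machine with `w`-bit words and random bits `ω 0, ω 1, …`, program `p`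
started in state `s` halts in state `s'` after exactly `t` steps. -/
inductive Exec (w : ℕ) (ω : ℕ → Bool) : Prog → State → State → ℕ → Prop
  | skip (s : State) : Exec w ω .skip s s 1
  | setW (x : ℕ) (e : WExp) (s : State) :
      Exec w ω (.setW x e) s
        { s with wvar := Function.update s.wvar x (e.eval w s) } (e.cost + 1)
  | setR (x : ℕ) (e : RExp) (s : State) :
      Exec w ω (.setR x e) s
        { s with rvar := Function.update s.rvar x (e.eval w s) } (e.cost + 1)
  | putW (a : ℕ) (i e : WExp) (s : State) :
      Exec w ω (.putW a i e) s
        { s with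
          warr := Function.update s.warr a
            (Function.update (s.warr a) (i.eval w s) (e.eval w s)) } (i.cost + e.cost + 1)
  | putR (a : ℕ) (i : WExp) (e : RExp) (s : State) :
      Exec w ω (.putR a i e) s
        { s with
          rarr := Function.update s.rarr a
            (Function.update (s.rarr a) (i.eval w s) (e.eval w s)) } (i.cost + e.cost + 1)
  | flip (x : ℕ) (s : State) :
      Exec w ω (.flip x) s
        { s with wvar := Function.update s.wvar x (if ω s.coins then 1 else 0),
                 coins := s.coins + 1 } 1
  | seq {p q : Prog} {s s₁ s₂ : State} {t₁ t₂ : ℕ} (hp : Exec w ω p s s₁ t₁)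
      (hq : Exec w ω q s₁ s₂ t₂) : Exec w ω (.seq p q) s s₂ (t₁ + t₂)
  | iteTrue {c : BExp} {p q : Prog} {s s' : State} {t : ℕ} (hc : c.Holds w s)
      (hp : Exec w ω p s s' t) : Exec w ω (.ite c p q) s s' (c.cost + t + 1)
  | iteFalse {c : BExp} {p q : Prog} {s s' : State} {t : ℕ} (hc : ¬ c.Holds w s)
      (hq : Exec w ω q s s' t) : Exec w ω (.ite c p q) s s' (c.cost + t + 1)
  | loopDone {c : BExp} {p : Prog} {s : State} (hc : ¬ c.Holds w s) :
      Exec w ω (.loop c p) s s (c.cost + 1)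
  | loopStep {c : BExp} {p : Prog} {s s₁ s₂ : State} {t₁ t₂ : ℕ} (hc : c.Holds w s)
      (hp : Exec w ω p s s₁ t₁) (hl : Exec w ω (.loop c p) s₁ s₂ t₂) :
      Exec w ω (.loop c p) s s₂ (c.cost + t₁ + t₂ + 1)

/-- Given the random bits, the final state and the running time are determined. -/
theorem Exec.deterministic {w : ℕ} {ω : ℕ → Bool} {p : Prog} {s s₁ s₂ : State} {t₁ t₂ : ℕ}
    (h₁ : Exec w ω p s s₁ t₁) (h₂ : Exec w ω p s s₂ t₂) : s₁ = s₂ ∧ t₁ = t₂ := by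
  induction h₁ generalizing s₂ t₂ with
  | skip | setW | setR | putW | putR | flip => cases h₂; exact ⟨rfl, rfl⟩
  | seq _ _ ih₁ ih₂ =>
    cases h₂ with
    | seq a b =>
      obtain ⟨rfl, rfl⟩ := ih₁ a
      obtain ⟨rfl, rfl⟩ := ih₂ b
      exact ⟨rfl, rfl⟩
  | iteTrue hc _ ih =>
    cases h₂ with
    | iteTrue _ a => obtain ⟨rfl, rfl⟩ := ih a; exact ⟨rfl, rfl⟩
    | iteFalse hn _ => exact absurd hc hn
  | iteFalse hc _ ih =>
    cases h₂ with
    | iteTrue hn _ => exact absurd hn hc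
    | iteFalse _ a => obtain ⟨rfl, rfl⟩ := ih a; exact ⟨rfl, rfl⟩
  | loopDone hc =>
    cases h₂ with
    | loopDone _ => exact ⟨rfl, rfl⟩
    | loopStep hn _ _ => exact absurd hn hc
  | loopStep hc _ _ ih₁ ih₂ =>
    cases h₂ with
    | loopDone hn => exact absurd hc hn
    | loopStep _ a b =>
      obtain ⟨rfl, rfl⟩ := ih₁ a
      obtain ⟨rfl, rfl⟩ := ih₂ b
      exact ⟨rfl, rfl⟩

open Classical in
/-- The input: word variables `0` and `1` hold `n` and `h`; cell `u * n + v` of word array `0` is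
`2`, `1` or `0` according to whether `(u, v)` is a negative edge, another edge, or no edge; cell
`u * n + v` of real array `0` is the weight of the edge `(u, v)`. Everything else is zero. -/
noncomputable def input {n : ℕ} (G : NegGraph n) (h : ℕ) : State where
  wvar x := if x = 0 then n else if x = 1 then h else 0
  rvar _ := 0
  warr a i :=
    if ∃ u v : Fin n, a = 0 ∧ i = u * n + v ∧ G.Neg u v then 2
    else if ∃ u v : Fin n, a = 0 ∧ i = u * n + v ∧ G.Adj u v then 1
    else 0
  rarr a i :=
    ∑ u : Fin n, ∑ v : Fin n, if a = 0 ∧ i = u * n + v ∧ G.Adj u v then G.weight u v else 0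
  coins := 0

/-- The law of an infinite sequence of independent fair random bits. -/
noncomputable def coinMeasure : MeasureTheory.Measure (ℕ → Bool) :=
  MeasureTheory.Measure.infinitePi fun _ => (PMF.uniformOfFintype Bool).toMeasure

end RealRAM

/-! Estimate the sizes of the balls around each `r` by sampling at geometrically decreasing rates.
At level `j` a random set `S` keeps every vertex with probability `2 ^ (-j)`, and hop-limited
Dijkstra searches in the graph and in its reversal give `d^h(S, r)` and `d^h(r, S)` for all `r` at
once. With `m` independent samples per level, let `a` and `c` be the medians of these two distances.
Except with tiny probability, `{v | d^h(v, r) ≤ a}` has more than `2 ^ j / 64` elements and `{v |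
d^h(v, r) < a}` fewer than `64 * 2 ^ j`; likewise for `c` and the distances from `r`.

As long as `a + c < 0` (`Low`), every pair in the product of the two closed balls has `r` between
it, so `r` lies between at least `4 ^ j / 2 ^ 12` pairs. At the first level where this fails
(`High`), a real `Δ_r` with `Δ_r ≤ a` and `-Δ_r ≤ c` exists; both open balls then have `O(2 ^ j)`
elements, while level `j - 1` was still low. Hence `(|V^in_r| + |V^out_r|) ^ 2` is at most a
constant times the number of pairs that `r` lies between (`ballSize_sq_le`). Summing over `r` and
counting pairs the other way (`sum_betweenPairs`) gives at most `n ^ 2` times the maximal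
betweenness, which is the first bound; Cauchy–Schwarz gives the second (`sum_ballSize_le`). The
parameter `b` enters only in this summation, so neither the algorithm nor the failure event depends
on it.

The medians are random, but the balls they cut out belong to a fixed family of `O(n ^ 2)` sublevel
sets, so a union bound over sets and levels suffices (`badEvent_small`).

The algorithmic half is `program_spec`. A hop-limited search alternates Dijkstra on the edges that
are not negative with one relaxation of all negative edges (`hopDijkstra_spec`); well-behavedness
makes it safe to relax in place. Programs are written in a structured language whose semantics is a
function and whose cost is computed from the syntax (`SP.exec_compile`). -/

namespace RealRAM

/-! ### A structured language for the machine: semantics, frame rules and running time. -/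

/-- Structured programs: straight-line code, tests, and counting loops. The word variables below
`8` are constants, and `count x b p` runs `p` with `x = 0, 1, …` while `x` is less than the
constant `b`. -/
inductive SP
  | skip
  | setW (x : ℕ) (e : WExp)
  | setR (x : ℕ) (e : RExp)
  | putW (a : ℕ) (i e : WExp)
  | putR (a : ℕ) (i : WExp) (e : RExp)
  | flip (x : ℕ)
  | seq (p q : SP)
  | ite (t : BExp) (p q : SP)
  | count (x b : ℕ) (p : SP)

namespace State

/-- Assign a word variable. -/
def setW (s : State) (x k : ℕ) : State := { s with wvar := Function.update s.wvar x k }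

/-- Assign a real variable. -/
def setR (s : State) (x : ℕ) (k : ℝ) : State := { s with rvar := Function.update s.rvar x k }

/-- Assign a cell of a word array. -/
def putW (s : State) (a i k : ℕ) : State :=
  { s with warr := Function.update s.warr a (Function.update (s.warr a) i k) }

/-- Assign a cell of a real array. -/
def putR (s : State) (a i : ℕ) (k : ℝ) : State :=
  { s with rarr := Function.update s.rarr a (Function.update (s.rarr a) i k) }

/-- Toss a coin. -/
def flip (ω : ℕ → Bool) (s : State) (x : ℕ) : State :=
  { s with wvar := Function.update s.wvar x (if ω s.coins then 1 else 0), coins := s.coins + 1 }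

@[simp] theorem setW_wvar (s : State) (x k y : ℕ) :
    (s.setW x k).wvar y = if y = x then k else s.wvar y := by
  simp [setW, Function.update_apply]
@[simp] theorem setW_rvar (s : State) (x k : ℕ) : (s.setW x k).rvar = s.rvar := rfl
@[simp] theorem setW_warr (s : State) (x k : ℕ) : (s.setW x k).warr = s.warr := rfl
@[simp] theorem setW_rarr (s : State) (x k : ℕ) : (s.setW x k).rarr = s.rarr := rfl
@[simp] theorem setW_coins (s : State) (x k : ℕ) : (s.setW x k).coins = s.coins := rfl
@[simp] theorem setR_wvar (s : State) (x : ℕ) (k : ℝ) : (s.setR x k).wvar = s.wvar := rfl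
@[simp] theorem setR_warr (s : State) (x : ℕ) (k : ℝ) : (s.setR x k).warr = s.warr := rfl
@[simp] theorem setR_rarr (s : State) (x : ℕ) (k : ℝ) : (s.setR x k).rarr = s.rarr := rfl
@[simp] theorem setR_coins (s : State) (x : ℕ) (k : ℝ) : (s.setR x k).coins = s.coins := rfl
@[simp] theorem setR_rvar (s : State) (x : ℕ) (k : ℝ) (y : ℕ) :
    (s.setR x k).rvar y = if y = x then k else s.rvar y := by
  simp [setR, Function.update_apply]
@[simp] theorem putW_wvar (s : State) (a i k : ℕ) : (s.putW a i k).wvar = s.wvar := rfl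
@[simp] theorem putW_rvar (s : State) (a i k : ℕ) : (s.putW a i k).rvar = s.rvar := rfl
@[simp] theorem putW_rarr (s : State) (a i k : ℕ) : (s.putW a i k).rarr = s.rarr := rfl
@[simp] theorem putW_coins (s : State) (a i k : ℕ) : (s.putW a i k).coins = s.coins := rfl
@[simp] theorem putW_warr (s : State) (a i k a' i' : ℕ) :
    (s.putW a i k).warr a' i' = if a' = a ∧ i' = i then k else s.warr a' i' := by
  by_cases h : a' = a
  · subst h; simp [putW, Function.update_apply]
  · simp [putW, h]
@[simp] theorem putR_wvar (s : State) (a i : ℕ) (k : ℝ) : (s.putR a i k).wvar = s.wvar := rfl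
@[simp] theorem putR_rvar (s : State) (a i : ℕ) (k : ℝ) : (s.putR a i k).rvar = s.rvar := rfl
@[simp] theorem putR_warr (s : State) (a i : ℕ) (k : ℝ) : (s.putR a i k).warr = s.warr := rfl
@[simp] theorem putR_coins (s : State) (a i : ℕ) (k : ℝ) : (s.putR a i k).coins = s.coins := rfl
@[simp] theorem putR_rarr (s : State) (a i : ℕ) (k : ℝ) (a' i' : ℕ) :
    (s.putR a i k).rarr a' i' = if a' = a ∧ i' = i then k else s.rarr a' i' := by
  by_cases h : a' = a
  · subst h; simp [putR, Function.update_apply]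
  · simp [putR, h]
@[simp] theorem flip_wvar (ω : ℕ → Bool) (s : State) (x y : ℕ) :
    (s.flip ω x).wvar y = if y = x then (if ω s.coins then 1 else 0) else s.wvar y := by
  simp [flip, Function.update_apply]
@[simp] theorem flip_rvar (ω : ℕ → Bool) (s : State) (x : ℕ) : (s.flip ω x).rvar = s.rvar := rfl
@[simp] theorem flip_warr (ω : ℕ → Bool) (s : State) (x : ℕ) : (s.flip ω x).warr = s.warr := rfl
@[simp] theorem flip_rarr (ω : ℕ → Bool) (s : State) (x : ℕ) : (s.flip ω x).rarr = s.rarr := rfl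
@[simp] theorem flip_coins (ω : ℕ → Bool) (s : State) (x : ℕ) :
    (s.flip ω x).coins = s.coins + 1 := rfl

end State

/-- Repeat `f` with counter `x = 0, …, k - 1`. -/
def countRun (f : State → State) (x : ℕ) (s : State) : ℕ → State
  | 0 => s.setW x 0
  | k + 1 => (f (countRun f x s k)).setW x (k + 1)

namespace SP

/-- The final state of a structured program. -/
noncomputable def run (w : ℕ) (ω : ℕ → Bool) : SP → State → State
  | skip, s => s
  | setW x e, s => s.setW x (e.eval w s)
  | setR x e, s => s.setR x (e.eval w s)
  | putW a i e, s => s.putW a (i.eval w s) (e.eval w s)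
  | putR a i e, s => s.putR a (i.eval w s) (e.eval w s)
  | flip x, s => s.flip ω x
  | seq p q, s => run w ω q (run w ω p s)
  | ite t p q, s => open Classical in if t.Holds w s then run w ω p s else run w ω q s
  | count x b p, s => countRun (run w ω p) x s (s.wvar b)

/-- Translation to machine programs. -/
def compile : SP → Prog
  | skip => .skip
  | setW x e => .setW x e
  | setR x e => .setR x e
  | putW a i e => .putW a i e
  | putR a i e => .putR a i e
  | flip x => .flip x
  | seq p q => .seq p.compile q.compile
  | ite t p q => .ite t p.compile q.compile
  | count x b p => .seq (.setW x (.lit 0))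
      (.loop (.wlt (.var x) (.var b)) (.seq p.compile (.setW x (.add (.var x) (.lit 1)))))

/-- A bound on the running time when the constants have the values `env`. -/
def cost (env : ℕ → ℕ) : SP → ℕ
  | skip => 1
  | setW _ e => e.cost + 1
  | setR _ e => e.cost + 1
  | putW _ i e => i.cost + e.cost + 1
  | putR _ i e => i.cost + e.cost + 1
  | flip _ => 1
  | seq p q => p.cost env + q.cost env
  | ite t p q => t.cost + (p.cost env + q.cost env) + 1
  | count _ b p => env b * (p.cost env + 8) + 6

/-- Whether a word variable may be assigned. -/
def writesW : SP → ℕ → Bool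
  | setW x _, y => y == x
  | flip x, y => y == x
  | seq p q, y => p.writesW y || q.writesW y
  | ite _ p q, y => p.writesW y || q.writesW y
  | count x _ p, y => y == x || p.writesW y
  | _, _ => false

/-- Whether a word array may be changed. -/
def writesWA : SP → ℕ → Bool
  | putW a _ _, y => y == a
  | seq p q, y => p.writesWA y || q.writesWA y
  | ite _ p q, y => p.writesWA y || q.writesWA y
  | count _ _ p, y => p.writesWA y
  | _, _ => false

/-- Whether a real array may be changed. -/
def writesRA : SP → ℕ → Bool
  | putR a _ _, y => y == a
  | seq p q, y => p.writesRA y || q.writesRA y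
  | ite _ p q, y => p.writesRA y || q.writesRA y
  | count _ _ p, y => p.writesRA y
  | _, _ => false

/-- Whether coins may be tossed. -/
def tosses : SP → Bool
  | flip _ => true
  | seq p q => p.tosses || q.tosses
  | ite _ p q => p.tosses || q.tosses
  | count _ _ p => p.tosses
  | _ => false

/-- Constants are not assigned, and loop bodies do not assign the counter. -/
def wf : SP → Bool
  | setW x _ => Nat.ble 8 x
  | flip x => Nat.ble 8 x
  | seq p q => p.wf && q.wf
  | ite _ p q => p.wf && q.wf
  | count x b p => Nat.ble 8 x && Nat.ble b 7 && !p.writesW x && p.wf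
  | _ => true

theorem countRun_ind {f : State → State} {x : ℕ} {s : State} (P : State → Prop)
    (h0 : P (s.setW x 0)) (hs : ∀ k s, P s → P ((f s).setW x (k + 1))) (N : ℕ) :
    P (countRun f x s N) := by
  induction N with
  | zero => exact h0
  | succ k ih => exact hs k _ ih

variable {w : ℕ} {ω : ℕ → Bool}

/-- Frame rule. The side condition is a Boolean computed from the syntax, so for concrete programs
it is proved by `rfl`. The next three lemmas do the same for arrays and coins. -/
theorem run_wvar {p : SP} {y : ℕ} (h : p.writesW y = false) (s : State) :
    (p.run w ω s).wvar y = s.wvar y := by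
  induction p generalizing s with
  | skip | setR | putW | putR => simp [run]
  | setW x e => simp only [writesW, beq_eq_false_iff_ne] at h; simp [run, h]
  | flip x => simp only [writesW, beq_eq_false_iff_ne] at h; simp [run, h]
  | seq p q ihp ihq =>
    simp only [writesW, Bool.or_eq_false_iff] at h
    simp [run, ihp h.1, ihq h.2]
  | ite t p q ihp ihq =>
    simp only [writesW, Bool.or_eq_false_iff] at h
    simp only [run]; split <;> simp [ihp h.1, ihq h.2]
  | count x b p ih =>
    simp only [writesW, Bool.or_eq_false_iff, beq_eq_false_iff_ne] at h
    simp only [run]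
    exact countRun_ind (fun s' => s'.wvar y = s.wvar y) (by simp [h.1])
      (fun k s' hs' => by simp [h.1, ih h.2, hs']) _

theorem run_warr {p : SP} {y : ℕ} (h : p.writesWA y = false) (s : State) :
    (p.run w ω s).warr y = s.warr y := by
  induction p generalizing s with
  | skip | setR | setW | flip | putR => simp [run]
  | putW x e => 
    simp only [writesWA, beq_eq_false_iff_ne] at h; ext i; simp [run, h]
  | seq p q ihp ihq =>
    simp only [writesWA, Bool.or_eq_false_iff] at h
    simp [run, ihp h.1, ihq h.2]
  | ite t p q ihp ihq =>
    simp only [writesWA, Bool.or_eq_false_iff] at h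
    simp only [run]; split <;> simp [ihp h.1, ihq h.2]
  | count x b p ih =>
    simp only [run]
    exact countRun_ind (fun s' => s'.warr y = s.warr y) (by simp)
      (fun k s' hs' => by simp [ih h, hs']) _

theorem run_rarr {p : SP} {y : ℕ} (h : p.writesRA y = false) (s : State) :
    (p.run w ω s).rarr y = s.rarr y := by
  induction p generalizing s with
  | skip | setR | setW | flip | putW => simp [run]
  | putR x e => 
    simp only [writesRA, beq_eq_false_iff_ne] at h; ext i; simp [run, h]
  | seq p q ihp ihq =>
    simp only [writesRA, Bool.or_eq_false_iff] at h
    simp [run, ihp h.1, ihq h.2]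
  | ite t p q ihp ihq =>
    simp only [writesRA, Bool.or_eq_false_iff] at h
    simp only [run]; split <;> simp [ihp h.1, ihq h.2]
  | count x b p ih =>
    simp only [run]
    exact countRun_ind (fun s' => s'.rarr y = s.rarr y) (by simp)
      (fun k s' hs' => by simp [ih h, hs']) _

theorem run_coins {p : SP} (h : p.tosses = false) (s : State) :
    (p.run w ω s).coins = s.coins := by
  induction p generalizing s with
  | skip | setR | setW | putR | putW => simp [run]
  | flip => simp [tosses] at h
  | seq p q ihp ihq =>
    simp only [tosses, Bool.or_eq_false_iff] at h
    simp [run, ihp h.1, ihq h.2]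
  | ite t p q ihp ihq =>
    simp only [tosses, Bool.or_eq_false_iff] at h
    simp only [run]; split <;> simp [ihp h.1, ihq h.2]
  | count x b p ih =>
    simp only [run]
    exact countRun_ind (fun s' => s'.coins = s.coins) (by simp)
      (fun k s' hs' => by simp [ih h, hs']) _

theorem writesW_of_wf {p : SP} (h : p.wf = true) {y : ℕ} (hy : y < 8) : p.writesW y = false := by
  induction p with
  | skip | setR | putW | putR => simp [writesW]
  | setW x e => simp [wf] at h; simp [writesW]; omega
  | flip x => simp [wf] at h; simp [writesW]; omega
  | seq p q ihp ihq => simp [wf] at h; simp [writesW, ihp h.1, ihq h.2]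
  | ite t p q ihp ihq => simp [wf] at h; simp [writesW, ihp h.1, ihq h.2]
  | count x b p ih =>
    simp [wf] at h; simp [writesW, ih h.2]; omega

/-- A loop preserves an invariant indexed by the counter. -/
theorem run_count (I : ℕ → State → Prop) {x b N : ℕ} {p : SP} {s : State}
    (hN : s.wvar b = N) (h0 : I 0 (s.setW x 0))
    (hs : ∀ k < N, ∀ s', s'.wvar x = k → I k s' → I (k + 1) ((p.run w ω s').setW x (k + 1))) :
    I N ((count x b p).run w ω s) := by
  simp only [run, hN]
  suffices h : ∀ k ≤ N, I k (countRun (run w ω p) x s k) ∧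
      (countRun (run w ω p) x s k).wvar x = k from (h N le_rfl).1
  intro k
  induction k with
  | zero => intro _; exact ⟨h0, by simp [countRun]⟩
  | succ k ih =>
    intro hk
    obtain ⟨h1, h2⟩ := ih (by omega)
    exact ⟨hs k (by omega) _ h2 h1, by simp [countRun]⟩

/-- Well-formed structured programs compute what `run` says, within the time `cost`. -/
theorem exec_compile (hw : 1 ≤ w) {env : ℕ → ℕ} (henv : ∀ b < 8, env b < 2 ^ w) {p : SP}
    (hp : p.wf = true) (s : State) (hs : ∀ b < 8, s.wvar b = env b) :
    ∃ t ≤ p.cost env, Exec w ω p.compile s (p.run w ω s) t := by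
  induction p generalizing s with
  | skip => exact ⟨_, le_rfl, .skip s⟩
  | setW x e => exact ⟨_, le_rfl, .setW x e s⟩
  | setR x e => exact ⟨_, le_rfl, .setR x e s⟩
  | putW a i e => exact ⟨_, le_rfl, .putW a i e s⟩
  | putR a i e => exact ⟨_, le_rfl, .putR a i e s⟩
  | flip x => exact ⟨_, le_rfl, .flip x s⟩
  | seq p q ihp ihq =>
    simp only [wf, Bool.and_eq_true] at hp
    obtain ⟨t, ht, h⟩ := ihp hp.1 s hs
    obtain ⟨t', ht', h'⟩ := ihq hp.2 (p.run w ω s)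
      (fun b hb => by rw [run_wvar (writesW_of_wf hp.1 hb), hs b hb])
    exact ⟨t + t', by simp only [cost]; omega, .seq h h'⟩
  | ite c p q ihp ihq =>
    simp only [wf, Bool.and_eq_true] at hp
    by_cases hc : c.Holds w s
    · obtain ⟨t, ht, h⟩ := ihp hp.1 s hs
      refine ⟨_, ?_, by simpa only [run, if_pos hc] using .iteTrue (q := q.compile) hc h⟩
      simp only [cost]; omega
    · obtain ⟨t, ht, h⟩ := ihq hp.2 s hs
      refine ⟨_, ?_, by simpa only [run, if_neg hc] using .iteFalse (p := p.compile) hc h⟩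
      simp only [cost]; omega
  | count x b p ih =>
    have hp' := hp
    simp only [wf, Bool.and_eq_true, Bool.not_eq_true', Nat.ble_eq] at hp
    obtain ⟨⟨⟨hx, hb⟩, hxp⟩, hp⟩ := hp
    have hN : ∀ k, (∀ b < 8, (countRun (run w ω p) x s k).wvar b = env b) ∧
        (countRun (run w ω p) x s k).wvar x = k := by
      intro k
      induction k with
      | zero =>
        refine ⟨fun b hb => ?_, by simp [countRun]⟩
        simp only [countRun, State.setW_wvar]
        rw [if_neg (by omega), hs b hb]
      | succ k ihk =>
        refine ⟨fun b hb => ?_, by simp [countRun]⟩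
        simp only [countRun, State.setW_wvar]
        rw [if_neg (by omega), run_wvar (writesW_of_wf hp hb), ihk.1 b hb]
    have hpow : 1 < 2 ^ w := Nat.one_lt_two_pow (by omega)
    -- Induction on the number `d` of remaining iterations. An iteration costs 8 beyond its body: 3
    -- for the test, 4 for the increment, 1 for the branch. The last failing test costs 4.
    have key : ∀ d k, k + d = env b → ∃ t ≤ d * (p.cost env + 8) + 4,
        Exec w ω (.loop (.wlt (.var x) (.var b))
          (.seq p.compile (.setW x (.add (.var x) (.lit 1)))))
          (countRun (run w ω p) x s k) (countRun (run w ω p) x s (env b)) t := by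
      intro d
      induction d with
      | zero =>
        intro k hk
        obtain rfl : k = env b := by omega
        refine ⟨_, ?_, .loopDone ?_⟩
        · simp [BExp.cost, WExp.cost]
        · simp [BExp.Holds, WExp.eval, (hN _).1 b (by omega), (hN _).2]
      | succ d ihd =>
        intro k hk
        obtain ⟨t, ht, h⟩ := ih hp _ (hN k).1
        obtain ⟨t', ht', h'⟩ := ihd (k + 1) (by omega)
        have hb' := henv b (by omega)
        refine ⟨_, ?_, .loopStep (t₂ := t') ?_ (.seq h (.setW x _ _)) ?_⟩
        rotate_left 2
        · convert h' using 1
          simp only [countRun, State.setW, WExp.eval]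
          -- The increment does not wrap around: the new counter is at most `env b`, which is less
          -- than `2 ^ w`.
          rw [run_wvar hxp, (hN k).2, Nat.mod_eq_of_lt hpow, Nat.mod_eq_of_lt (by omega)]
        · simp only [BExp.cost, WExp.cost]
          rw [Nat.add_mul]; omega
        · simp only [BExp.Holds, WExp.eval, (hN _).1 b (by omega), (hN _).2]; omega
    obtain ⟨t, ht, h⟩ := key (env b) 0 (by omega)
    refine ⟨_, ?_, .seq (t₂ := t) (.setW x (.lit 0) s) ?_⟩
    rotate_left 1
    · convert h using 1
      · simp [countRun, State.setW, WExp.eval]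
      · simp only [run]; rw [hs b (by omega)]
    · simp only [cost, WExp.cost]; omega

end SP

end RealRAM

/-! ### Hop distances from a set of vertices and their characterisation by relaxation. -/

namespace NegGraph

variable {n : ℕ} {G : NegGraph n}

/-- The graph with all edges reversed. -/
def rev (G : NegGraph n) : NegGraph n where
  Adj u v := G.Adj v u
  weight u v := G.weight v u
  Neg u v := G.Neg v u
  adj_of_neg u v := G.adj_of_neg v u
  weight_nonpos_of_neg u v := G.weight_nonpos_of_neg v u
  neg_of_weight_neg u v := G.neg_of_weight_neg v u

theorem Walk.snoc {u v z : Fin n} {k : ℕ} {x : ℝ} (p : G.Walk u v k x) (e : G.Adj v z)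
    (hn : ¬ G.Neg v z) : G.Walk u z k (x + G.weight v z) := by
  induction p with
  | nil => simpa using Walk.cons e hn (.nil _)
  | cons e' hn' _ ih => rw [add_assoc]; exact .cons e' hn' (ih e hn)
  | hop e' _ ih => rw [add_assoc]; exact .hop e' (ih e hn)

theorem Walk.snoc_hop {u v z : Fin n} {k : ℕ} {x : ℝ} (p : G.Walk u v k x) (e : G.Neg v z) :
    G.Walk u z (k + 1) (x + G.weight v z) := by
  induction p with
  | nil => simpa using Walk.hop e (.nil _)
  | cons e' hn' _ ih => rw [add_assoc]; exact .cons e' hn' (ih e)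
  | hop e' _ ih => rw [add_assoc (G.weight _ _)]; exact .hop e' (ih e)

theorem Walk.rev {u v : Fin n} {k : ℕ} {x : ℝ} (p : G.Walk u v k x) : G.rev.Walk v u k x := by
  induction p with
  | nil => exact .nil _
  | @cons u v z k x e hn _ ih =>
    rw [add_comm]; exact ih.snoc (G := G.rev) (z := u) e hn
  | @hop u v z k x e _ ih =>
    rw [add_comm (G.weight u v)]; exact ih.snoc_hop (G := G.rev) (z := u) e

theorem walk_rev_iff {u v : Fin n} {k : ℕ} {x : ℝ} : G.rev.Walk v u k x ↔ G.Walk u v k x :=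
  ⟨fun h => h.rev, fun h => h.rev⟩

theorem hopDist_rev (h : ℕ) (u v : Fin n) : G.rev.hopDist h u v = G.hopDist h v u := by
  simp only [hopDist, walk_rev_iff]

theorem hopDist_le {h : ℕ} {u v : Fin n} {k : ℕ} {x : ℝ} (p : G.Walk u v k x) (hk : k ≤ h) :
    G.hopDist h u v ≤ x :=
  iInf₂_le x ⟨k, hk, p⟩

theorem le_hopDist {h : ℕ} {u v : Fin n} {d : EReal}
    (H : ∀ k ≤ h, ∀ x, G.Walk u v k x → d ≤ (x : EReal)) : d ≤ G.hopDist h u v :=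
  le_iInf₂ fun x ⟨k, hk, p⟩ => H k hk x p

/-- Two consecutive edges are never both negative. -/
def NoTwoHops (G : NegGraph n) : Prop := ∀ u v z, G.Neg u v → ¬ G.Neg v z

theorem WellBehaved.noTwoHops (h : G.WellBehaved) : G.NoTwoHops :=
  fun u v z huv => (h u v huv).2.2.2.1 z

theorem WellBehaved.noTwoHops_rev (h : G.WellBehaved) : G.rev.NoTwoHops :=
  fun u v z (huv : G.Neg v u) => (h v u huv).2.1 z

/-- The `h`-hop distance from a set of vertices. -/
noncomputable def setDist (G : NegGraph n) (S : Finset (Fin n)) (h : ℕ) (v : Fin n) : EReal :=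
  S.inf fun s => G.hopDist h s v

variable {S : Finset (Fin n)}

theorem setDist_le {i : ℕ} {s v : Fin n} {k : ℕ} {x : ℝ} (hs : s ∈ S) (p : G.Walk s v k x)
    (hk : k ≤ i) : G.setDist S i v ≤ x :=
  (Finset.inf_le hs).trans (hopDist_le p hk)

theorem le_setDist {i : ℕ} {v : Fin n} {d : EReal}
    (H : ∀ s ∈ S, ∀ k ≤ i, ∀ x, G.Walk s v k x → d ≤ (x : EReal)) : d ≤ G.setDist S i v :=
  Finset.le_inf fun s hs => le_hopDist (H s hs)

theorem setDist_succ_le (i : ℕ) (v : Fin n) : G.setDist S (i + 1) v ≤ G.setDist S i v :=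
  le_setDist fun _ hs _ hk _ p => setDist_le hs p (by omega)

theorem setDist_edge_le {i : ℕ} {u v : Fin n} (e : G.Adj u v) (hn : ¬ G.Neg u v) :
    G.setDist S i v ≤ G.setDist S i u + G.weight u v := by
  -- With the finite weight moved to the left, the claim is a lower bound on an infimum and can be
  -- checked walk by walk.
  rw [← EReal.sub_le_iff_le_add (by simp) (by simp)]
  refine le_setDist fun s hs k hk x p => EReal.sub_le_of_le_add ?_
  rw [← EReal.coe_add]
  exact setDist_le hs (p.snoc e hn) hk

theorem setDist_hop_le {i : ℕ} {u v : Fin n} (e : G.Neg u v) :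
    G.setDist S (i + 1) v ≤ G.setDist S i u + G.weight u v := by
  rw [← EReal.sub_le_iff_le_add (by simp) (by simp)]
  refine le_setDist fun s hs k hk x p => EReal.sub_le_of_le_add ?_
  rw [← EReal.coe_add]
  exact setDist_le hs (p.snoc_hop e) (by omega)

theorem setDist_le_zero {i : ℕ} {v : Fin n} (hv : v ∈ S) : G.setDist S i v ≤ 0 :=
  setDist_le hv (.nil v) (Nat.zero_le i)

/-- `D` cannot be decreased along edges that are not negative. -/
def Closed (G : NegGraph n) (D : Fin n → EReal) : Prop :=
  ∀ u v, G.Adj u v → ¬ G.Neg u v → D v ≤ D u + G.weight u v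

/-- An upper bound for `D` propagates along every hop-free walk by closedness. So any closed `D`
between the 0-hop distance and the initial values is that distance; this is how Dijkstra's output is
identified. -/
theorem eq_setDist_zero {D : Fin n → EReal} (hD : G.Closed D) (h0 : ∀ v ∈ S, D v ≤ 0)
    (hl : ∀ v, G.setDist S 0 v ≤ D v) : D = G.setDist S 0 := by
  refine funext fun v => le_antisymm (le_setDist fun s hs k hk x p => ?_) (hl v)
  -- `Walk` is built from its first edge, but the induction must peel off the last one and keep the
  -- source fixed; hence the reversal.
  have q := p.rev
  clear p
  induction q with
  | nil => exact h0 _ hs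
  | @cons a b z k x e hn _ ih =>
    refine (hD b a e hn).trans ((add_le_add_left (ih hs hk) _).trans ?_)
    rw [← EReal.coe_add, add_comm]; exact le_rfl
  | hop => omega

/-- Cut a walk after its last hop. The part before that hop has at most `i` hops, so `h1` bounds `D`
at the head of the hop; closedness carries the bound along the remaining edges. -/
theorem eq_setDist_succ {i : ℕ} {D : Fin n → EReal} (hD : G.Closed D)
    (h0 : ∀ v, D v ≤ G.setDist S i v)
    (h1 : ∀ u v, G.Neg u v → D v ≤ G.setDist S i u + G.weight u v)
    (hl : ∀ v, G.setDist S (i + 1) v ≤ D v) : D = G.setDist S (i + 1) := by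
  refine funext fun v => le_antisymm (le_setDist fun s hs k hk x p => ?_) (hl v)
  have q := p.rev
  clear p
  induction q with
  | nil => exact (h0 _).trans (setDist_le_zero hs)
  | @cons a b z k x e hn _ ih =>
    refine (hD b a e hn).trans ((add_le_add_left (ih hs hk) _).trans ?_)
    rw [← EReal.coe_add, add_comm]; exact le_rfl
  | @hop a b z k x e q _ =>
    refine (h1 b a e).trans ((add_le_add_left (setDist_le hs (walk_rev_iff.1 q)
      (by omega)) _).trans ?_)
    rw [← EReal.coe_add, add_comm]; exact le_rfl

theorem weight_nonneg {u v : Fin n} (e : G.Adj u v) (hn : ¬ G.Neg u v) : 0 ≤ G.weight u v :=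
  not_lt.1 fun h => hn (G.neg_of_weight_neg u v e h)

end NegGraph

/-! ### Hop-limited Dijkstra on the machine. -/

namespace RealRAM

open NegGraph

variable {n : ℕ} {w : ℕ} {ω : ℕ → Bool}

/-- The extended real stored at position `v`: arrays `a` hold a value and a flag that tells
whether the value is finite. -/
noncomputable def State.val (s : State) (a : ℕ) (v : ℕ) : EReal :=
  if s.warr a v = 1 then (s.rarr a v : EReal) else ⊤

theorem State.val_congr {s s' : State} {a : ℕ} (h : s'.warr a = s.warr a)
    (h' : s'.rarr a = s.rarr a) (v : ℕ) : s'.val a v = s.val a v := by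
  simp [State.val, h, h']

theorem SP.run_val {p : SP} {a : ℕ} (h : p.writesWA a = false) (h' : p.writesRA a = false)
    (s : State) (v : ℕ) : (p.run w ω s).val a v = s.val a v :=
  State.val_congr (SP.run_warr h s) (SP.run_rarr h' s) v

@[simp] theorem State.setW_val (s : State) (x k a v : ℕ) : (s.setW x k).val a v = s.val a v := rfl

/-- The position of the entry `(u, v)` of the (possibly transposed) adjacency matrix. -/
def entry (w : ℕ) (s : State) (u v : ℕ) : ℕ :=
  ((u * s.wvar 8) % 2 ^ w + (v * s.wvar 9) % 2 ^ w) % 2 ^ w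

/-- The state holds the graph `G` in the arrays `0`, accessed through `entry`. -/
structure Enc (w : ℕ) (G : NegGraph n) (s : State) : Prop where
  n_eq : s.wvar 0 = n
  two_lt : 2 < 2 ^ w
  n_lt : n < 2 ^ w
  neg : ∀ u v : Fin n, s.warr 0 (entry w s u v) = 2 ↔ G.Neg u v
  adj : ∀ u v : Fin n, s.warr 0 (entry w s u v) = 1 ↔ G.Adj u v ∧ ¬ G.Neg u v
  weight : ∀ u v : Fin n, G.Adj u v → s.rarr 0 (entry w s u v) = G.weight u v

theorem Enc.congr {G : NegGraph n} {s s' : State} (h : Enc w G s) (h0 : s'.wvar 0 = s.wvar 0)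
    (h8 : s'.wvar 8 = s.wvar 8) (h9 : s'.wvar 9 = s.wvar 9) (ha : s'.warr 0 = s.warr 0)
    (hr : s'.rarr 0 = s.rarr 0) : Enc w G s' := by
  have he : ∀ u v, entry w s' u v = entry w s u v := fun u v => by simp [entry, h8, h9]
  obtain ⟨a, b, c, d, e, f⟩ := h
  exact ⟨h0.trans a, b, c, by simpa only [he, ha] using d, by simpa only [he, ha] using e,
    by simpa only [he, hr] using f⟩

theorem Enc.run {G : NegGraph n} {s : State} (h : Enc w G s) {p : SP}
    (h0 : p.writesW 0 = false) (h8 : p.writesW 8 = false) (h9 : p.writesW 9 = false)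
    (ha : p.writesWA 0 = false) (hr : p.writesRA 0 = false) : Enc w G (p.run w ω s) :=
  h.congr (SP.run_wvar h0 s) (SP.run_wvar h8 s) (SP.run_wvar h9 s) (SP.run_warr ha s)
    (SP.run_rarr hr s)

theorem Enc.setW {G : NegGraph n} {s : State} (h : Enc w G s) {x k : ℕ} (hx : 10 ≤ x) :
    Enc w G (s.setW x k) :=
  h.congr (by simp; omega) (by simp; omega) (by simp; omega) rfl rfl

/-- The expression for `entry`. -/
def entryExp (U V : ℕ) : WExp := .add (.mul (.var U) (.var 8)) (.mul (.var V) (.var 9))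

/-- Relax the edge between the vertices in the variables `U` and `V` if its code is `c`. -/
def relax (U V c : ℕ) : SP :=
  .ite (.and (.weq (.get 0 (entryExp U V)) (.lit c)) (.and (.weq (.get 2 (.var U)) (.lit 1))
      (.not (.and (.weq (.get 2 (.var V)) (.lit 1))
        (.not (.rlt (.add (.get 2 (.var U)) (.get 0 (entryExp U V))) (.get 2 (.var V))))))))
    (.seq (.putR 2 (.var V) (.add (.get 2 (.var U)) (.get 0 (entryExp U V))))
      (.putW 2 (.var V) (.lit 1)))
    .skip

/-- The flag tests in `relax` amount to arithmetic in `EReal`: an infinite value at the tail changes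
nothing, and an infinite value at the head is always replaced by a finite one. -/
theorem relax_val {U V c : ℕ} {s : State} {u v : ℕ} (hc : c < 2 ^ w) (h1 : 1 < 2 ^ w)
    (hU : s.wvar U = u) (hV : s.wvar V = v) (y : ℕ) :
    ((relax U V c).run w ω s).val 2 y =
      if y = v ∧ s.warr 0 (entry w s u v) = c then
        min (s.val 2 y) (s.val 2 u + (s.rarr 0 (entry w s u v) : ℝ)) else s.val 2 y := by
  have he : (entryExp U V).eval w s = entry w s u v := by
    simp [entryExp, entry, WExp.eval, hU, hV]
  simp only [relax, SP.run, BExp.Holds, RExp.eval, WExp.eval, he, hU, hV, Nat.mod_eq_of_lt hc,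
    Nat.mod_eq_of_lt h1]
  by_cases hcode : s.warr 0 (entry w s u v) = c
  swap
  · simp [hcode]
  by_cases hy : y = v
  swap
  · simp only [hy, false_and, if_false]
    split
    · simp [State.val, hV, hy]
    · rfl
  subst hy
  simp only [hcode, true_and]
  by_cases hu : s.warr 2 u = 1
  swap
  · simp [State.val, hu]
  by_cases hv : s.warr 2 y = 1
  · simp only [hu, hv, true_and, not_not]
    split
    · rename_i h
      simp only [State.val, hu, State.putW_warr, State.putW_rarr, State.putR_rarr,
        State.putR_wvar, hV]
      simp only [and_self, if_true, hv]
      rw [min_eq_right (by exact_mod_cast h.le), EReal.coe_add]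
    · rename_i h
      simp only [State.val, hu, hv, if_true]
      rw [min_eq_left (by exact_mod_cast not_lt.1 h)]
  · simp only [hu, hv, true_and, false_and, not_false_eq_true, if_true]
    simp [State.val, hu, hv, hV]

/-- One pass over all negative edges. -/
def hopPass : SP := .count 10 0 (.count 11 0 (relax 10 11 2))

/-- The least value among the vertices that are not done. -/
def findMin : SP :=
  .seq (.setW 14 (.lit 0)) (.count 13 0
    (.ite (.and (.and (.weq (.get 2 (.var 13)) (.lit 1)) (.weq (.get 3 (.var 13)) (.lit 0)))
        (.not (.and (.weq (.var 14) (.lit 1)) (.not (.rlt (.get 2 (.var 13)) (.get 2 (.var 15)))))))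
      (.seq (.setW 14 (.lit 1)) (.setW 15 (.var 13))) .skip))

/-- Relax all edges that are not negative out of the vertex in variable `15`. -/
def relaxFrom : SP := .count 16 0 (relax 15 16 1)

/-- One round of Dijkstra's algorithm. -/
def dijkstraStep : SP :=
  .seq findMin (.ite (.weq (.var 14) (.lit 1)) (.seq (.putW 3 (.var 15) (.lit 1)) relaxFrom) .skip)

/-- Dijkstra's algorithm on the edges that are not negative. -/
def dijkstra : SP :=
  .seq (.count 13 0 (.putW 3 (.var 13) (.lit 0))) (.count 12 0 dijkstraStep)

/-- The pass overwrites values in place, yet adds only one hop: the tail of a negative edge is never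
the head of another one, so its value is still the initial one whenever the edge is relaxed. `P` is
an arbitrary lower bound that the pass must respect; it is later the distance with one more hop. -/
theorem hopPass_spec {G : NegGraph n} (hG : G.NoTwoHops) {s : State} (hs : Enc w G s)
    {P : Fin n → EReal} (hP : ∀ v : Fin n, P v ≤ s.val 2 v)
    (hP' : ∀ u v : Fin n, G.Neg u v → P v ≤ s.val 2 u + G.weight u v) :
    (∀ v : Fin n, P v ≤ (hopPass.run w ω s).val 2 v) ∧
    (∀ v : Fin n, (hopPass.run w ω s).val 2 v ≤ s.val 2 v) ∧
    ∀ u v : Fin n, G.Neg u v → (hopPass.run w ω s).val 2 v ≤ s.val 2 u + G.weight u v := by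
  let J : ℕ → ℕ → State → Prop := fun k l s' => Enc w G s' ∧
    (∀ v : Fin n, P v ≤ s'.val 2 v) ∧ (∀ v : Fin n, s'.val 2 v ≤ s.val 2 v) ∧
    (∀ v : Fin n, (∀ u, ¬ G.Neg u v) → s'.val 2 v = s.val 2 v) ∧
    ∀ u v : Fin n, ((u : ℕ) < k ∨ (u : ℕ) = k ∧ (v : ℕ) < l) → G.Neg u v →
      s'.val 2 v ≤ s.val 2 u + G.weight u v
  have key : J n 0 (hopPass.run w ω s) := by
    refine SP.run_count (fun k => J k 0) hs.n_eq ?_ ?_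
    · refine ⟨hs.setW (by norm_num), hP, fun v => le_rfl, fun v _ => rfl, fun u v h => ?_⟩
      omega
    · intro k hk s1 hk1 h1
      have h2 : (J k n) ((SP.count 11 0 (relax 10 11 2)).run w ω s1) ∧
          ((SP.count 11 0 (relax 10 11 2)).run w ω s1).wvar 10 = k := by
        refine ⟨?_, by rw [SP.run_wvar rfl, hk1]⟩
        refine (SP.run_count (fun l s' => J k l s' ∧ s'.wvar 10 = k) h1.1.n_eq
          ⟨⟨h1.1.setW (by norm_num), h1.2⟩, by simpa using hk1⟩ ?_).1
        rintro l hl s2 hl2 ⟨⟨hE, hA, hB, hC, hD⟩, hk2⟩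
        have hrel := relax_val (ω := ω) hE.two_lt (by have := hE.two_lt; omega) hk2 hl2
        refine ⟨⟨(hE.run rfl rfl rfl rfl rfl).setW (by norm_num), ?_⟩, ?_⟩
        swap
        · rw [State.setW_wvar, if_neg (by norm_num), SP.run_wvar rfl, hk2]
        have hn := hE.neg ⟨k, hk⟩ ⟨l, hl⟩
        have hwt := hE.weight ⟨k, hk⟩ ⟨l, hl⟩
        simp only at hn hwt
        simp only [State.setW_val, hrel]
        by_cases hneg : G.Neg ⟨k, hk⟩ ⟨l, hl⟩
        · have hcode := hn.2 hneg
          have hwt := hwt (G.adj_of_neg _ _ hneg)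
          have hsk : s2.val 2 k = s.val 2 k :=
            hC ⟨k, hk⟩ fun u hu => hG _ _ _ hu hneg
          simp only [hcode, hwt, and_true, hsk]
          refine ⟨fun v => ?_, fun v => ?_, fun v hv => ?_, fun u v huv hneg' => ?_⟩
          · split
            · rename_i h
              obtain rfl : v = ⟨l, hl⟩ := Fin.ext h
              exact le_min (hA _) (hP' _ _ hneg)
            · exact hA v
          · split
            · exact (min_le_left _ _).trans (hB v)
            · exact hB v
          · rw [if_neg, hC v hv]
            intro h
            obtain rfl : v = ⟨l, hl⟩ := Fin.ext h
            exact hv _ hneg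
          · by_cases h : (u : ℕ) = k ∧ (v : ℕ) = l
            · obtain rfl : u = ⟨k, hk⟩ := Fin.ext h.1
              obtain rfl : v = ⟨l, hl⟩ := Fin.ext h.2
              rw [if_pos rfl]
              exact min_le_right _ _
            · have := hD u v (by omega) hneg'
              split
              · exact (min_le_left _ _).trans this
              · exact this
        · have hcode : ¬ s2.warr 0 (entry w s2 k l) = 2 := fun h => hneg (hn.1 h)
          simp only [hcode, and_false, if_false]
          refine ⟨hA, hB, hC, fun u v huv hneg' => ?_⟩
          by_cases h : (u : ℕ) = k ∧ (v : ℕ) = l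
          · obtain rfl : u = ⟨k, hk⟩ := Fin.ext h.1
            obtain rfl : v = ⟨l, hl⟩ := Fin.ext h.2
            exact absurd hneg' hneg
          · exact hD u v (by omega) hneg'
      obtain ⟨⟨hE, hA, hB, hC, hD⟩, -⟩ := h2
      exact ⟨hE.setW (by norm_num), hA, hB, hC, fun u v huv => hD u v (by omega)⟩
  exact ⟨key.2.1, key.2.2.1, fun u v => key.2.2.2.2 u v (Or.inl u.2)⟩

theorem findMin_spec {s : State} (hn : s.wvar 0 = n) (h1 : 1 < 2 ^ w) :
    ((findMin.run w ω s).wvar 14 = 0 ∧ ∀ x : Fin n, s.val 2 x = ⊤ ∨ s.warr 3 x ≠ 0) ∨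
    ((findMin.run w ω s).wvar 14 = 1 ∧ ∃ b : Fin n, (findMin.run w ω s).wvar 15 = b ∧
      s.warr 3 b = 0 ∧ s.val 2 b ≠ ⊤ ∧ ∀ x : Fin n, s.warr 3 x = 0 → s.val 2 b ≤ s.val 2 x) := by
  let J : ℕ → State → Prop := fun k s' =>
    (s'.warr 2 = s.warr 2 ∧ s'.warr 3 = s.warr 3 ∧ s'.rarr 2 = s.rarr 2) ∧
    ((s'.wvar 14 = 0 ∧ ∀ x : Fin n, (x : ℕ) < k → s.val 2 x = ⊤ ∨ s.warr 3 x ≠ 0) ∨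
    (s'.wvar 14 = 1 ∧ ∃ b : Fin n, s'.wvar 15 = b ∧ s.warr 3 b = 0 ∧ s.warr 2 b = 1 ∧
      ∀ x : Fin n, (x : ℕ) < k → s.warr 3 x = 0 → s.val 2 b ≤ s.val 2 x))
  have key : J n (findMin.run w ω s) := by
    rw [findMin, SP.run]
    refine SP.run_count J (by simpa [SP.run] using hn) ?_ ?_
    · refine ⟨by simp [SP.run], Or.inl ⟨by simp [SP.run, WExp.eval], fun x hx => ?_⟩⟩
      omega
    · rintro k hk s' hks ⟨⟨ha2, ha3, hr2⟩, h⟩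
      have hval : ∀ x : Fin n, s.warr 2 x ≠ 1 → s.val 2 x = ⊤ := fun x hx => by
        simp [State.val, hx]
      have hval' : ∀ x : Fin n, s.warr 2 x = 1 → s.val 2 x = s.rarr 2 x := fun x hx => by
        simp [State.val, hx]
      simp only [SP.run, BExp.Holds, WExp.eval, RExp.eval, hks, ha2, ha3, hr2,
        Nat.mod_eq_of_lt h1, Nat.zero_mod]
      split
      · rename_i hc
        refine ⟨by simp [ha2, ha3, hr2], Or.inr ⟨by simp, ⟨k, hk⟩, by simp [hks], hc.1.2, hc.1.1,
          fun x hx hx3 => ?_⟩⟩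
        rcases (Nat.lt_succ_iff_lt_or_eq.1 hx) with hx | hx
        swap
        · obtain rfl : x = ⟨k, hk⟩ := Fin.ext hx
          exact le_rfl
        rcases h with ⟨h14, h⟩ | ⟨h14, b, hb, hb3, hb2, h⟩
        · rcases h x hx with h | h
          · simp [h]
          · exact absurd hx3 h
        · have hlt : s.rarr 2 k < s.rarr 2 b := by
            have := hc.2
            rw [hb] at this
            by_contra hlt
            exact this ⟨h14, hlt⟩
          refine le_trans ?_ (h x hx hx3)
          rw [hval' _ hb2, hval' ⟨k, hk⟩ hc.1.1]
          exact_mod_cast hlt.le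
      · rename_i hc
        refine ⟨by simp [ha2, ha3, hr2], ?_⟩
        rcases h with ⟨h14, h⟩ | ⟨h14, b, hb, hb3, hb2, h⟩
        · refine Or.inl ⟨by simp [h14], fun x hx => ?_⟩
          rcases (Nat.lt_succ_iff_lt_or_eq.1 hx) with hx | hx
          · exact h x hx
          · obtain rfl : x = ⟨k, hk⟩ := Fin.ext hx
            by_contra hcon
            push Not at hcon
            refine hc ⟨⟨?_, hcon.2⟩, by simp [h14]⟩
            by_contra h2
            exact hcon.1 (hval _ h2)
        · refine Or.inr ⟨by simp [h14], b, by simp [hb], hb3, hb2, fun x hx hx3 => ?_⟩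
          rcases (Nat.lt_succ_iff_lt_or_eq.1 hx) with hx | hx
          · exact h x hx hx3
          · obtain rfl : x = ⟨k, hk⟩ := Fin.ext hx
            by_cases h2 : s.warr 2 k = 1
            · have hlt : ¬ s.rarr 2 k < s.rarr 2 b := fun hlt =>
                hc ⟨⟨h2, hx3⟩, fun hh => hh.2 (by rw [hb]; exact hlt)⟩
              rw [hval' _ hb2, hval' ⟨k, hk⟩ h2]
              exact_mod_cast not_lt.1 hlt
            · rw [hval ⟨k, hk⟩ h2]; exact le_top
  rcases key.2 with ⟨h14, h⟩ | ⟨h14, b, hb, hb3, hb2, h⟩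
  · exact Or.inl ⟨h14, fun x => h x x.2⟩
  · exact Or.inr ⟨h14, b, hb, hb3, by simp [State.val, hb2], fun x => h x x.2⟩

theorem relaxFrom_spec {G : NegGraph n} {s : State} (hs : Enc w G s) {b : Fin n}
    (hb : s.wvar 15 = b) (y : Fin n) :
    (G.Adj b y ∧ ¬ G.Neg b y → (relaxFrom.run w ω s).val 2 y =
      min (s.val 2 y) (s.val 2 b + G.weight b y)) ∧
    (¬ (G.Adj b y ∧ ¬ G.Neg b y) → (relaxFrom.run w ω s).val 2 y = s.val 2 y) := by
  let f : ℕ → Fin n → EReal := fun k y => open Classical in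
    if (y : ℕ) < k ∧ G.Adj b y ∧ ¬ G.Neg b y then min (s.val 2 y) (s.val 2 b + G.weight b y)
    else s.val 2 y
  -- A loop at `b` that is not negative has weight at least zero, so relaxing it leaves the value at
  -- `b` unchanged during the whole sweep.
  have hfb : ∀ k, f k b = s.val 2 b := by
    intro k
    simp only [f]
    split
    · rename_i h
      exact min_eq_left (le_add_of_nonneg_right (by exact_mod_cast weight_nonneg h.2.1 h.2.2))
    · rfl
  have key : ∀ y : Fin n, (relaxFrom.run w ω s).val 2 y = f n y := by
    refine (SP.run_count (fun k s' => (Enc w G s' ∧ s'.wvar 15 = b) ∧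
      ∀ y : Fin n, s'.val 2 y = f k y) hs.n_eq
      ⟨⟨hs.setW (by norm_num), by simpa using hb⟩, by simp [f]⟩ ?_).2
    rintro k hk s' hks ⟨⟨hE, hb'⟩, hf⟩
    refine ⟨⟨(hE.run rfl rfl rfl rfl rfl).setW (by norm_num), ?_⟩, fun y => ?_⟩
    · rw [State.setW_wvar, if_neg (by norm_num), SP.run_wvar rfl, hb']
    · have h1 : 1 < 2 ^ w := by have := hE.two_lt; omega
      rw [State.setW_val, relax_val h1 h1 hb' hks, hf, hf, hfb]
      by_cases hy : (y : ℕ) = k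
      · obtain rfl : y = ⟨k, hk⟩ := Fin.ext hy
        have ha := hE.adj b ⟨k, hk⟩
        have hwt := hE.weight b ⟨k, hk⟩
        simp only at ha hwt
        simp only [f, lt_irrefl, false_and, if_false]
        by_cases h : G.Adj b ⟨k, hk⟩ ∧ ¬ G.Neg b ⟨k, hk⟩
        · rw [if_pos ⟨trivial, ha.2 h⟩, if_pos ⟨Nat.lt_succ_self k, h⟩, hwt h.1]
        · rw [if_neg (fun h' => h (ha.1 h'.2)), if_neg (fun h' => h h'.2)]
      · have : (y : ℕ) < k + 1 ↔ (y : ℕ) < k := by omega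
        rw [if_neg (fun h => hy h.1)]
        simp only [f]
        by_cases h : (y : ℕ) < k ∧ G.Adj b y ∧ ¬ G.Neg b y
        · rw [if_pos h, if_pos ⟨this.2 h.1, h.2⟩]
        · rw [if_neg h, if_neg fun h' => h ⟨this.1 h'.1, h'.2⟩]
  constructor <;> intro h <;> rw [key] <;> simp [f, h]

/-- Dijkstra from arbitrary initial values. Finished vertices have all their edges relaxed and carry
values no larger than unfinished ones. As weights are nonnegative, finished values never change
again. Any closed `P` below the initial values stays below, which together with closedness of the
result determines it. -/
theorem dijkstra_spec {G : NegGraph n} {s : State} (hs : Enc w G s)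
    {P : Fin n → EReal} (hP : ∀ v : Fin n, P v ≤ s.val 2 v) (hPG : G.Closed P) :
    (∀ v : Fin n, P v ≤ (dijkstra.run w ω s).val 2 v) ∧
    (∀ v : Fin n, (dijkstra.run w ω s).val 2 v ≤ s.val 2 v) ∧
    G.Closed fun v => (dijkstra.run w ω s).val 2 v := by
  classical
  have h1 : 1 < 2 ^ w := by have := hs.two_lt; omega
  set s1 := (SP.count 13 0 (.putW 3 (.var 13) (.lit 0))).run w ω s with hs1
  have hE1 : Enc w G s1 := hs.run rfl rfl rfl rfl rfl
  have hv1 : ∀ v, s1.val 2 v = s.val 2 v := SP.run_val rfl rfl s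
  have hd1 : ∀ x < n, s1.warr 3 x = 0 := by
    refine SP.run_count (fun k s' => ∀ x < k, s'.warr 3 x = 0) hs.n_eq (by simp) ?_
    intro k hk s' hks h x hx
    simp only [SP.run, WExp.eval, hks, State.setW_warr, State.putW_warr, true_and]
    split
    · simp
    · rename_i hxk; exact h x (by omega)
  let J : ℕ → State → Prop := fun k s' => Enc w G s' ∧
    (∀ v : Fin n, P v ≤ s'.val 2 v) ∧ (∀ v : Fin n, s'.val 2 v ≤ s.val 2 v) ∧
    (∀ x y : Fin n, s'.warr 3 x ≠ 0 → G.Adj x y → ¬ G.Neg x y →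
      s'.val 2 y ≤ s'.val 2 x + G.weight x y) ∧
    (∀ x y : Fin n, s'.warr 3 x ≠ 0 → s'.warr 3 y = 0 → s'.val 2 x ≤ s'.val 2 y) ∧
    -- Either every round so far has finished a new vertex, or only infinite values remain
    -- unfinished. After `n` rounds both alternatives say that every vertex with a finite value is
    -- finished.
    (k ≤ (Finset.univ.filter fun x : Fin n => s'.warr 3 x ≠ 0).card ∨
      ∀ x : Fin n, s'.val 2 x = ⊤ ∨ s'.warr 3 x ≠ 0)
  have key : J n (dijkstra.run w ω s) := by
    rw [dijkstra, SP.run, ← hs1]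
    refine SP.run_count J hE1.n_eq ?_ ?_
    · refine ⟨hE1.setW (by norm_num), by simpa [hv1] using hP, by simp [hv1], ?_, ?_, by simp⟩
      · intro x y hx; exact absurd (hd1 x x.2) hx
      · intro x y hx; exact absurd (hd1 x x.2) hx
    · rintro k hk s2 hk2 ⟨hE, hA, hB, hC, hD, hF⟩
      have hE3 : Enc w G (findMin.run w ω s2) := hE.run rfl rfl rfl rfl rfl
      have hv3 : ∀ v, (findMin.run w ω s2).val 2 v = s2.val 2 v := SP.run_val rfl rfl s2
      have hd3 : (findMin.run w ω s2).warr 3 = s2.warr 3 := SP.run_warr rfl s2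
      rw [dijkstraStep, SP.run]
      have hmin := findMin_spec (ω := ω) hE.n_eq h1
      set s3 := findMin.run w ω s2
      rcases hmin with ⟨h14, hall⟩ | ⟨h14, b, hb, hb3, hbt, hmin⟩
      · simp only [SP.run, BExp.Holds, WExp.eval, h14, Nat.mod_eq_of_lt h1]
        refine ⟨hE3.setW (by norm_num), ?_⟩
        simp only [State.setW_val, State.setW_warr, hv3, hd3, zero_ne_one, if_false]
        exact ⟨hA, hB, hC, hD, Or.inr hall⟩
      · simp only [SP.run, BExp.Holds, WExp.eval, h14, Nat.mod_eq_of_lt h1, hb, if_true]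
        set s4 := s3.putW 3 b 1
        have hE4 : Enc w G s4 := hE3.congr rfl rfl rfl (by ext; simp [s4]) rfl
        have hv4 : ∀ v, s4.val 2 v = s2.val 2 v := fun v => by
          rw [← hv3]; exact State.val_congr (by ext; simp [s4]) rfl v
        have hrf := relaxFrom_spec (ω := ω) hE4 (b := b) hb
        have hd5 : ∀ x : Fin n, (relaxFrom.run w ω s4).warr 3 x ≠ 0 ↔
            x = b ∨ s2.warr 3 x ≠ 0 := by
          intro x
          rw [SP.run_warr rfl]
          simp only [s4, State.putW_warr, true_and, hd3, Fin.val_inj]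
          split <;> simp_all
        simp only [hv4] at hrf
        have hE5 : Enc w G (relaxFrom.run w ω s4) := hE4.run rfl rfl rfl rfl rfl
        set s5 := relaxFrom.run w ω s4
        have hle : ∀ y : Fin n, s5.val 2 y ≤ s2.val 2 y := fun y => by
          by_cases h : G.Adj b y ∧ ¬ G.Neg b y
          · rw [(hrf y).1 h]; exact min_le_left _ _
          · rw [(hrf y).2 h]
        have hge : ∀ y : Fin n, min (s2.val 2 y) (s2.val 2 b) ≤ s5.val 2 y := fun y => by
          by_cases h : G.Adj b y ∧ ¬ G.Neg b y
          · rw [(hrf y).1 h]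
            refine min_le_min le_rfl (le_add_of_nonneg_right ?_)
            exact_mod_cast weight_nonneg h.1 h.2
          · rw [(hrf y).2 h]; exact min_le_left _ _
        -- A finished vertex has value at most that of `b`, and relaxation from `b` never goes below
        -- the value of `b`.
        have hdone : ∀ y : Fin n, (y = b ∨ s2.warr 3 y ≠ 0) → s5.val 2 y = s2.val 2 y := by
          intro y hy
          refine le_antisymm (hle y) (le_trans (le_min le_rfl ?_) (hge y))
          rcases hy with rfl | hy
          · exact le_rfl
          · exact hD y b hy hb3
        refine ⟨hE5.setW (by norm_num), ?_⟩
        simp only [State.setW_val, State.setW_warr]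
        refine ⟨fun y => ?_, fun y => (hle y).trans (hB y), fun x y hx e hn => ?_,
          fun x y hx hy => ?_, ?_⟩
        · by_cases h : G.Adj b y ∧ ¬ G.Neg b y
          · rw [(hrf y).1 h]
            exact le_min (hA y) ((hPG b y h.1 h.2).trans (add_le_add_left (hA b) _))
          · rw [(hrf y).2 h]; exact hA y
        · rw [hd5] at hx
          rw [hdone x hx]
          rcases hx with rfl | hx
          · rw [(hrf y).1 ⟨e, hn⟩]; exact min_le_right _ _
          · exact (hle y).trans (hC x y hx e hn)
        · have hy' : ¬ (y = b ∨ s2.warr 3 y ≠ 0) := fun h => ((hd5 y).2 h) hy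
          rw [hd5] at hx
          push Not at hy'
          rw [hdone x hx]
          refine le_trans ?_ (hge y)
          rw [min_eq_right (hmin y hy'.2)]
          rcases hx with rfl | hx
          · exact le_rfl
          · exact hD x b hx hb3
        · left
          have hk' : k ≤ (Finset.univ.filter fun x : Fin n => s2.warr 3 x ≠ 0).card := by
            rcases hF with h | h
            · exact h
            · rcases h b with h | h
              · exact absurd h hbt
              · exact absurd hb3 h
          have hsub : insert b (Finset.univ.filter fun x : Fin n => s2.warr 3 x ≠ 0) =
              Finset.univ.filter fun x : Fin n => s5.warr 3 x ≠ 0 := by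
            ext x; simp [hd5]
          change k + 1 ≤ (Finset.univ.filter fun x : Fin n => s5.warr 3 x ≠ 0).card
          rw [← hsub, Finset.card_insert_of_notMem (by simp [hb3])]
          omega
  obtain ⟨-, hA, hB, hC, -, hF⟩ := key
  refine ⟨hA, hB, fun x y e hn => ?_⟩
  have hall : ∀ x : Fin n, (dijkstra.run w ω s).val 2 x = ⊤ ∨ (dijkstra.run w ω s).warr 3 x ≠ 0 := by
    rcases hF with h | h
    · intro x
      right
      have := Finset.eq_univ_of_card _
        (le_antisymm (Finset.card_le_univ _) ((Fintype.card_fin n).trans_le h))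
      have hx := Finset.mem_univ x
      rw [← this] at hx
      simpa using hx
    · exact h
  rcases hall x with h | h
  · simp only [h, EReal.top_add_coe]; exact le_top
  · exact hC x y h e hn

/-- The `h`-hop distances from the set of vertices flagged in word array `5`. -/
def hopDijkstra : SP :=
  .seq (.count 13 0 (.seq (.putW 2 (.var 13) (.get 5 (.var 13))) (.putR 2 (.var 13) .zero)))
    (.seq dijkstra (.count 17 1 (.seq hopPass dijkstra)))

/-- After `i` rounds the stored values are exactly the `i`-hop distances. The lower bound fed to
each pass and to the search after it is the `(i + 1)`-hop distance, which is closed. -/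
theorem hopDijkstra_spec {G : NegGraph n} (hG : G.NoTwoHops) {s : State} (hs : Enc w G s)
    {S : Finset (Fin n)} (hS : ∀ v : Fin n, s.warr 5 v = 1 ↔ v ∈ S) (v : Fin n) :
    (hopDijkstra.run w ω s).val 2 v = G.setDist S (s.wvar 1) v := by
  set p0 : SP := .count 13 0
    (.seq (.putW 2 (.var 13) (.get 5 (.var 13))) (.putR 2 (.var 13) .zero)) with hp0
  set s1 := p0.run w ω s with hs1
  have hE1 : Enc w G s1 := hs.run rfl rfl rfl rfl rfl
  have hv1 : ∀ v < n, s1.val 2 v = if s.warr 5 v = 1 then 0 else ⊤ := by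
    refine (SP.run_count (fun k s' => s'.warr 5 = s.warr 5 ∧
      ∀ v < k, s'.val 2 v = if s.warr 5 v = 1 then 0 else ⊤) hs.n_eq (by simp) ?_).2
    rintro k hk s' hks ⟨h5, h⟩
    refine ⟨?_, fun x hx => ?_⟩
    · rw [State.setW_warr, SP.run_warr rfl, h5]
    · have h := h x
      simp only [SP.run, WExp.eval, RExp.eval, hks, State.val, State.setW_warr, State.putW_warr,
        State.setW_rarr, State.putR_rarr, State.putR_warr, State.putW_rarr, State.putW_wvar,
        h5, true_and] at h ⊢
      by_cases hxk : x = k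
      · simp [hxk]
      · simp only [hxk, if_false]; exact h (by omega)
  have hclosed : ∀ i, G.Closed (G.setDist S i) := fun i u v e hn => setDist_edge_le e hn
  set s2 := dijkstra.run w ω s1 with hs2
  have hE2 : Enc w G s2 := hE1.run rfl rfl rfl rfl rfl
  have h2 : (fun v : Fin n => s2.val 2 v) = G.setDist S 0 := by
    obtain ⟨hA, hB, hC⟩ := dijkstra_spec (ω := ω) hE1 (P := G.setDist S 0) (fun v => by
      rw [hv1 v v.2]
      split
      · rename_i h; exact setDist_le_zero ((hS v).1 h)
      · exact le_top) (hclosed 0)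
    refine eq_setDist_zero hC (fun v hv => (hB v).trans ?_) hA
    rw [hv1 v v.2, if_pos ((hS v).2 hv)]
  have hw1 : s2.wvar 1 = s.wvar 1 := by
    rw [hs2, SP.run_wvar rfl, hs1, SP.run_wvar rfl]
  have key : Enc w G (hopDijkstra.run w ω s) ∧
      (fun v : Fin n => (hopDijkstra.run w ω s).val 2 v) = G.setDist S (s.wvar 1) := by
    rw [hopDijkstra, SP.run, SP.run, ← hp0, ← hs1, ← hs2]
    refine SP.run_count (fun i s' => Enc w G s' ∧ (fun v : Fin n => s'.val 2 v) = G.setDist S i)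
      hw1 ⟨hE2.setW (by norm_num), h2⟩ ?_
    rintro i hi s3 - ⟨hE3, h3⟩
    have h3' : ∀ v : Fin n, s3.val 2 v = G.setDist S i v := fun v => congrFun h3 v
    refine ⟨(hE3.run rfl rfl rfl rfl rfl).setW (by norm_num), ?_⟩
    simp only [State.setW_val, SP.run]
    obtain ⟨hA, hB, hC⟩ := hopPass_spec (ω := ω) hG hE3 (P := G.setDist S (i + 1))
      (fun v => by rw [h3']; exact setDist_succ_le i v)
      (fun u v e => by rw [h3']; exact setDist_hop_le e)
    have hE4 : Enc w G (hopPass.run w ω s3) := hE3.run rfl rfl rfl rfl rfl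
    obtain ⟨hA', hB', hC'⟩ := dijkstra_spec (ω := ω) hE4 hA (hclosed _)
    refine eq_setDist_succ hC' (fun v => (hB' v).trans ((hB v).trans_eq (h3' v)))
      (fun u v e => (hB' v).trans ((hC u v e).trans_eq (by rw [h3']))) hA'
  exact congrFun key.2 v

end RealRAM

/-! ### Reading the input, sampling, and tables of distances. -/

namespace RealRAM

open NegGraph

variable {n : ℕ} {w : ℕ} {ω : ℕ → Bool}

theorem entry_inj {u v u' v' : Fin n} (h : (u : ℕ) * n + v = u' * n + v') : u = u' ∧ v = v' := by
  have hn : 0 < n := u.pos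
  have h1 : ((u : ℕ) * n + v) / n = u := by
    rw [mul_comm, Nat.mul_add_div hn, Nat.div_eq_of_lt v.2, add_zero]
  have h2 : ((u' : ℕ) * n + v') / n = u' := by
    rw [mul_comm, Nat.mul_add_div hn, Nat.div_eq_of_lt v'.2, add_zero]
  have hu : (u : ℕ) = u' := by rw [← h1, h, h2]
  refine ⟨Fin.ext hu, Fin.ext ?_⟩
  rw [hu] at h
  omega

theorem exists_entry_iff (R : Fin n → Fin n → Prop) (u v : Fin n) :
    (∃ u' v' : Fin n, 0 = 0 ∧ (u : ℕ) * n + v = u' * n + v' ∧ R u' v') ↔ R u v := by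
  constructor
  · rintro ⟨u', v', -, he, hR⟩
    obtain ⟨rfl, rfl⟩ := entry_inj he
    exact hR
  · exact fun hR => ⟨u, v, rfl, rfl, hR⟩

open Classical in
theorem input_warr (G : NegGraph n) (h : ℕ) (u v : Fin n) : (input G h).warr 0 (u * n + v) =
    if G.Neg u v then 2 else if G.Adj u v then 1 else 0 := by
  have h1 := exists_entry_iff G.Neg u v
  have h2 := exists_entry_iff G.Adj u v
  by_cases hn : G.Neg u v
  · exact (if_pos (h1.2 hn)).trans (if_pos hn).symm
  · refine (if_neg (mt h1.1 hn)).trans ((if_neg hn).trans ?_).symm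
    by_cases ha : G.Adj u v
    · exact (if_pos ha).trans (if_pos (h2.2 ha)).symm
    · exact (if_neg ha).trans (if_neg (mt h2.1 ha)).symm

theorem input_warr_eq_two (G : NegGraph n) (h : ℕ) (u v : Fin n) :
    (input G h).warr 0 (u * n + v) = 2 ↔ G.Neg u v := by
  rw [input_warr]
  split
  · simpa
  · split <;> simpa

theorem input_warr_eq_one (G : NegGraph n) (h : ℕ) (u v : Fin n) :
    (input G h).warr 0 (u * n + v) = 1 ↔ G.Adj u v ∧ ¬ G.Neg u v := by
  rw [input_warr]
  split
  · simp_all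
  · split <;> simp_all

theorem input_rarr (G : NegGraph n) (h : ℕ) (u v : Fin n) (e : G.Adj u v) :
    (input G h).rarr 0 (u * n + v) = G.weight u v := by
  classical
  simp only [input]
  rw [Finset.sum_eq_single u, Finset.sum_eq_single v]
  · rw [if_pos ⟨trivial, rfl, e⟩]
  · intro v' _ hv
    rw [if_neg]
    rintro ⟨-, he, -⟩
    exact hv (entry_inj he).2.symm
  · simp
  · intro u' _ hu
    refine Finset.sum_eq_zero fun v' _ => ?_
    rw [if_neg]
    rintro ⟨-, he, -⟩
    exact hu (entry_inj he).1.symm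
  · simp

/-- The state holds the input and the constants `L` and `m`, and the word size is sufficient. -/
structure Inp (w : ℕ) (G : NegGraph n) (h L m : ℕ) (s : State) : Prop where
  n_eq : s.wvar 0 = n
  h_eq : s.wvar 1 = h
  l_eq : s.wvar 2 = L
  m_eq : s.wvar 3 = m
  warr_eq : s.warr 0 = (input G h).warr 0
  rarr_eq : s.rarr 0 = (input G h).rarr 0
  two_lt : 2 < 2 ^ w
  n_lt : n < 2 ^ w
  nn_lt : n * n < 2 ^ w
  mn_lt : m * n < 2 ^ w
  mm_lt : 2 * m < 2 ^ w

variable {G : NegGraph n} {h L m : ℕ} {s : State}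

theorem Inp.congr {s' : State} (hs : Inp w G h L m s)
    (h0 : ∀ x < 8, s'.wvar x = s.wvar x) (ha : s'.warr 0 = s.warr 0)
    (hr : s'.rarr 0 = s.rarr 0) : Inp w G h L m s' := by
  obtain ⟨a, b, c, d, e, f, g, i, j, k, l⟩ := hs
  exact ⟨by rw [h0 0 (by norm_num), a], by rw [h0 1 (by norm_num), b],
    by rw [h0 2 (by norm_num), c], by rw [h0 3 (by norm_num), d], ha.trans e, hr.trans f, g, i, j, k, l⟩

theorem Inp.run (hs : Inp w G h L m s) {p : SP} (hp : p.wf = true)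
    (ha : p.writesWA 0 = false) (hr : p.writesRA 0 = false) : Inp w G h L m (p.run w ω s) :=
  hs.congr (fun _ hx => SP.run_wvar (SP.writesW_of_wf hp hx) s) (SP.run_warr ha s)
    (SP.run_rarr hr s)

theorem Inp.setW (hs : Inp w G h L m s) {x k : ℕ} (hx : 8 ≤ x) : Inp w G h L m (s.setW x k) :=
  hs.congr (fun y hy => by simp; omega) rfl rfl

theorem Inp.one_lt (hs : Inp w G h L m s) : 1 < 2 ^ w := by have := hs.two_lt; omega

theorem mul_add_lt {i v : ℕ} (hi : i < m) (hv : v < n) : i * n + v < m * n := by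
  calc i * n + v < i * n + n := by omega
    _ = (i + 1) * n := by ring
    _ ≤ m * n := Nat.mul_le_mul_right n hi

theorem Inp.enc (hs : Inp w G h L m s) (h8 : s.wvar 8 = n) (h9 : s.wvar 9 = 1) : Enc w G s := by
  have he : ∀ u v : Fin n, entry w s u v = u * n + v := fun u v => by
    have h1 := mul_add_lt u.2 v.2
    have h2 := hs.nn_lt
    have h3 := Nat.le_mul_of_pos_right (u : ℕ) u.pos
    rw [entry, h8, h9, mul_one, Nat.mod_eq_of_lt (a := (u : ℕ) * n) (by omega),
      Nat.mod_eq_of_lt (a := (v : ℕ)) (by omega), Nat.mod_eq_of_lt (by omega)]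
  refine ⟨hs.n_eq, hs.two_lt, hs.n_lt, fun u v => ?_, fun u v => ?_, fun u v e => ?_⟩
  · rw [he, hs.warr_eq, input_warr_eq_two]
  · rw [he, hs.warr_eq, input_warr_eq_one]
  · rw [he, hs.rarr_eq, input_rarr _ _ _ _ e]

theorem Inp.enc_rev (hs : Inp w G h L m s) (h8 : s.wvar 8 = 1) (h9 : s.wvar 9 = n) :
    Enc w G.rev s := by
  have he : ∀ u v : Fin n, entry w s u v = v * n + u := fun u v => by
    have h1 := mul_add_lt v.2 u.2
    have h2 := hs.nn_lt
    rw [entry, h8, h9, mul_one, Nat.mod_eq_of_lt (a := (v : ℕ) * n) (by omega),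
      Nat.mod_eq_of_lt (a := (u : ℕ)) (by omega), add_comm, Nat.mod_eq_of_lt (by omega)]
  refine ⟨hs.n_eq, hs.two_lt, hs.n_lt, fun u v => ?_, fun u v => ?_, fun u v e => ?_⟩
  · rw [he, hs.warr_eq, input_warr_eq_two]; rfl
  · rw [he, hs.warr_eq, input_warr_eq_one]; rfl
  · rw [he, hs.rarr_eq]; exact input_rarr G h v u e

/-- The random set whose element `v` is kept if the first `j` coins of its block are heads. -/
def sampleSet (n : ℕ) (ω : ℕ → Bool) (c L j : ℕ) : Finset (Fin n) :=
  Finset.univ.filter fun v => ∀ q < L, q < j → ω (c + v * L + q) = true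

/-- Sample a set of vertices, keeping each one with probability `2 ^ (-j)`, `j` in variable `18`. -/
def sample : SP :=
  .count 20 0 (.seq (.setW 23 (.lit 1)) (.seq
    (.count 21 2 (.seq (.flip 22)
      (.ite (.and (.wlt (.var 21) (.var 18)) (.weq (.var 22) (.lit 0))) (.setW 23 (.lit 0)) .skip)))
    (.putW 5 (.var 20) (.var 23))))

/-- Each vertex consumes exactly `L` coins whatever the sampling rate, so the coins deciding a given
vertex in a given trial sit at a position known in advance. -/
theorem sample_spec (hs : Inp w G h L m s) :
    (sample.run w ω s).coins = s.coins + n * L ∧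
    ∀ v : Fin n, (sample.run w ω s).warr 5 v = 1 ↔ v ∈ sampleSet n ω s.coins L (s.wvar 18) := by
  have h1 := hs.one_lt
  have key := SP.run_count (w := w) (ω := ω) (fun k s' => (s'.wvar 2 = L ∧ s'.wvar 18 = s.wvar 18) ∧
    s'.coins = s.coins + k * L ∧ ∀ v < k, s'.warr 5 v = 1 ↔
      ∀ q < L, q < s.wvar 18 → ω (s.coins + v * L + q) = true)
    (x := 20) (b := 0) (p := .seq (.setW 23 (.lit 1)) (.seq
    (.count 21 2 (.seq (.flip 22)
      (.ite (.and (.wlt (.var 21) (.var 18)) (.weq (.var 22) (.lit 0))) (.setW 23 (.lit 0)) .skip)))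
    (.putW 5 (.var 20) (.var 23)))) (s := s) hs.n_eq ⟨⟨by simp [hs.l_eq], by simp⟩, by simp, by simp⟩ ?_
  · refine ⟨key.2.1, fun v => ?_⟩
    rw [sample, key.2.2 v v.2]
    simp [sampleSet]
  · rintro k hk s1 hks ⟨⟨h2, h18⟩, hc, hv⟩
    rw [SP.run, SP.run, SP.run]
    simp only [WExp.eval, Nat.mod_eq_of_lt h1]
    have hin := SP.run_count (w := w) (ω := ω) (fun q s' => (s'.wvar 18 = s.wvar 18 ∧
      s'.wvar 20 = k ∧ s'.wvar 2 = L ∧ s'.warr 5 = s1.warr 5) ∧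
      s'.coins = s.coins + k * L + q ∧ (s'.wvar 23 = 1 ↔
        ∀ q' < q, q' < s.wvar 18 → ω (s.coins + k * L + q') = true))
      (x := 21) (b := 2) (p := .seq (.flip 22)
      (.ite (.and (.wlt (.var 21) (.var 18)) (.weq (.var 22) (.lit 0))) (.setW 23 (.lit 0)) .skip))
      (s := s1.setW 23 1) (N := L) (by simp [h2])
      ⟨by simp [h18, hks, h2], by simp [hc], by simp⟩ ?_
    · obtain ⟨⟨i18, i20, i2, i5⟩, ic, iv⟩ := hin
      generalize (SP.count 21 2 _).run w ω (s1.setW 23 1) = s2 at *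
      simp only [SP.run, WExp.eval]
      refine ⟨⟨by simp [i2], by simp [i18]⟩, by simp [ic]; ring, fun v hvk => ?_⟩
      simp only [State.setW_warr, State.putW_warr, true_and, i20, i5]
      split
      · rename_i hvk; rw [hvk, iv]
      · exact hv v (by omega)
    · rintro q hq s2 hqs ⟨⟨i18, i20, i2, i5⟩, ic, iv⟩
      simp only [SP.run, WExp.eval, BExp.Holds, State.flip_wvar]
      have hall : (∀ q' < q + 1, q' < s.wvar 18 → ω (s.coins + k * L + q') = true) ↔
          (∀ q' < q, q' < s.wvar 18 → ω (s.coins + k * L + q') = true) ∧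
          (q < s.wvar 18 → ω (s.coins + k * L + q) = true) := by
        simp only [Nat.lt_succ_iff_lt_or_eq]
        constructor
        · exact fun H => ⟨fun q' h' => H q' (Or.inl h'), H q (Or.inr rfl)⟩
        · rintro ⟨H, H'⟩ q' (h' | rfl)
          · exact H q' h'
          · exact H'
      rw [hall, ← iv]
      by_cases hb : ω (s.coins + k * L + q) = true
      · simp [hqs, i18, i20, i2, i5, ic, hb, ← add_assoc]
      · by_cases hj : q < s.wvar 18
        · simp [hqs, i18, i20, i2, i5, ic, hb, hj, ← add_assoc]
        · simp [hqs, i18, i20, i2, i5, ic, hj, ← add_assoc]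

/-- The expression for the cell `(X, Y)` of a table with rows of length `n`. -/
def cell (X Y : ℕ) : WExp := .add (.mul (.var X) (.var 0)) (.var Y)

theorem cell_eval (hs : Inp w G h L m s) {X Y i v : ℕ} (hX : s.wvar X = i) (hY : s.wvar Y = v)
    (hi : i < m) (hv : v < n) : (cell X Y).eval w s = i * n + v := by
  have h1 := mul_add_lt hi hv
  have h2 := hs.mn_lt
  rw [cell, WExp.eval, WExp.eval, WExp.eval, WExp.eval, WExp.eval, hX, hY, hs.n_eq,
    Nat.mod_eq_of_lt (a := i * n) (by omega), Nat.mod_eq_of_lt (by omega)]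

/-- Copy the computed distances to row `wvar 19` of the table `a`. -/
def copyTo (a : ℕ) : SP :=
  .count 24 0 (.seq (.putW a (cell 19 24) (.get 2 (.var 24)))
    (.putR a (cell 19 24) (.get 2 (.var 24))))

theorem copyTo_spec (hs : Inp w G h L m s) {a i : ℕ} (ha : a ≠ 2) (ha' : a ≠ 0)
    (h19 : s.wvar 19 = i) (hi : i < m) :
    (∀ v < n, ((copyTo a).run w ω s).val a (i * n + v) = s.val 2 v) ∧
    ∀ p < i * n, ((copyTo a).run w ω s).val a p = s.val a p := by
  have key := SP.run_count (w := w) (ω := ω) (fun k s' => (Inp w G h L m s' ∧ s'.wvar 19 = i ∧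
    s'.warr 2 = s.warr 2 ∧ s'.rarr 2 = s.rarr 2) ∧
    (∀ v < k, s'.val a (i * n + v) = s.val 2 v) ∧ ∀ p < i * n, s'.val a p = s.val a p)
    (x := 24) (b := 0) (p := .seq (.putW a (cell 19 24) (.get 2 (.var 24)))
    (.putR a (cell 19 24) (.get 2 (.var 24)))) (s := s) hs.n_eq
    ⟨⟨hs.setW (by norm_num), by simp [h19], by simp⟩, by simp, by simp⟩ ?_
  · exact key.2
  · rintro k hk s1 hks ⟨⟨hI, i19, h2, h2'⟩, hv, hp⟩
    have hI' : Inp w G h L m (s1.putW a (i * n + k) (s.warr 2 k)) :=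
      hI.congr (fun _ _ => rfl) (by ext y; simp [ha'.symm]) rfl
    simp only [SP.run, WExp.eval, RExp.eval, cell_eval hI i19 hks hi hk, hks, h2]
    rw [cell_eval hI' i19 hks hi hk]
    simp only [State.putW_wvar, State.putW_rarr, hks, h2']
    have hI2 : Inp w G h L m
        ((s1.putW a (i * n + k) (s.warr 2 k)).putR a (i * n + k) (s.rarr 2 k)) :=
      hI'.congr (fun _ _ => rfl) rfl (by ext y; simp [ha'.symm])
    refine ⟨⟨hI2.setW (by norm_num),
      by simp [i19], by ext y; simp [ha.symm, h2], by ext y; simp [ha.symm, h2']⟩,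
      fun v hvk => ?_, fun p hp' => ?_⟩
    · have hv := hv v
      simp only [State.val, State.setW_warr, State.putR_warr, State.putW_warr, State.setW_rarr,
        State.putR_rarr, State.putW_rarr, true_and] at hv ⊢
      by_cases hvk' : v = k
      · simp [hvk']
      · have hne : ¬ i * n + v = i * n + k := by omega
        rw [if_neg hne, if_neg hne]
        exact hv (by omega)
    · have hp := hp p hp'
      simp only [State.val, State.setW_warr, State.putR_warr, State.putW_warr, State.setW_rarr,
        State.putR_rarr, State.putW_rarr, true_and] at hp ⊢
      have hne : ¬ p = i * n + k := by omega
      rw [if_neg hne, if_neg hne]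
      exact hp

/-- Sample a set and tabulate the distances from it and to it. -/
def trial : SP :=
  .seq sample (.seq (.setW 8 (.var 0)) (.seq (.setW 9 (.lit 1)) (.seq hopDijkstra
    (.seq (copyTo 7) (.seq (.setW 8 (.lit 1)) (.seq (.setW 9 (.var 0))
      (.seq hopDijkstra (copyTo 4))))))))

/-- The same sample serves both searches. Swapping the strides in the variables `8` and `9` makes
the second one read the transposed matrix, hence search `G.rev`. Rows of earlier trials survive. -/
theorem trial_spec (hG : G.WellBehaved) (hs : Inp w G h L m s) {i : ℕ} (h19 : s.wvar 19 = i)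
    (hi : i < m) :
    (trial.run w ω s).coins = s.coins + n * L ∧
    (∀ v : Fin n, (trial.run w ω s).val 7 (i * n + v) =
      G.setDist (sampleSet n ω s.coins L (s.wvar 18)) h v) ∧
    (∀ v : Fin n, (trial.run w ω s).val 4 (i * n + v) =
      G.rev.setDist (sampleSet n ω s.coins L (s.wvar 18)) h v) ∧
    ∀ p < i * n, (trial.run w ω s).val 7 p = s.val 7 p ∧ (trial.run w ω s).val 4 p = s.val 4 p := by
  have h1 := hs.one_lt
  obtain ⟨hc, hS⟩ := sample_spec (ω := ω) hs
  set S := sampleSet n ω s.coins L (s.wvar 18)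
  simp only [trial, SP.run, WExp.eval, Nat.mod_eq_of_lt h1]
  have hI1 : Inp w G h L m (sample.run w ω s) := hs.run rfl rfl rfl
  have f19 : (sample.run w ω s).wvar 19 = i := by rw [SP.run_wvar rfl, h19]
  have f3 : ∀ p, (sample.run w ω s).val 7 p = s.val 7 p := SP.run_val rfl rfl s
  have f4 : ∀ p, (sample.run w ω s).val 4 p = s.val 4 p := SP.run_val rfl rfl s
  set s1 := sample.run w ω s
  set s2 := (s1.setW 8 (s1.wvar 0)).setW 9 1 with hs2
  have hI2 : Inp w G h L m s2 := (hI1.setW (by norm_num)).setW (by norm_num)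
  have hE2 : Enc w G s2 := hI2.enc (by simp [s2, hI1.n_eq]) (by simp [s2])
  have hd := hopDijkstra_spec (ω := ω) hG.noTwoHops hE2 (S := S) hS
  rw [hI2.h_eq] at hd
  have hI3 : Inp w G h L m (hopDijkstra.run w ω s2) := hI2.run rfl rfl rfl
  have g19 : (hopDijkstra.run w ω s2).wvar 19 = i := by
    rw [SP.run_wvar rfl]; simpa [s2] using f19
  have g3 : ∀ p, (hopDijkstra.run w ω s2).val 7 p = s.val 7 p := fun p =>
    (SP.run_val rfl rfl s2 p).trans (f3 p)
  have g4 : ∀ p, (hopDijkstra.run w ω s2).val 4 p = s.val 4 p := fun p =>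
    (SP.run_val rfl rfl s2 p).trans (f4 p)
  have g5 : (hopDijkstra.run w ω s2).warr 5 = s1.warr 5 := SP.run_warr rfl s2
  have gc : (hopDijkstra.run w ω s2).coins = s.coins + n * L := by
    rw [SP.run_coins rfl]; exact hc
  set s3 := hopDijkstra.run w ω s2
  obtain ⟨hc3, hp3⟩ := copyTo_spec (ω := ω) hI3 (a := 7) (by norm_num) (by norm_num) g19 hi
  have hI4 : Inp w G h L m ((copyTo 7).run w ω s3) := hI3.run rfl rfl rfl
  have k19 : ((copyTo 7).run w ω s3).wvar 19 = i := by rw [SP.run_wvar rfl, g19]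
  have k4 : ∀ p, ((copyTo 7).run w ω s3).val 4 p = s.val 4 p := fun p =>
    (SP.run_val rfl rfl s3 p).trans (g4 p)
  have k5 : ((copyTo 7).run w ω s3).warr 5 = s1.warr 5 := (SP.run_warr rfl s3).trans g5
  have kc : ((copyTo 7).run w ω s3).coins = s.coins + n * L := by
    rw [SP.run_coins rfl]; exact gc
  set s4 := (copyTo 7).run w ω s3
  set s5 := (s4.setW 8 1).setW 9 ((s4.setW 8 1).wvar 0) with hs5
  have hI5 : Inp w G h L m s5 := (hI4.setW (by norm_num)).setW (by norm_num)
  have hE5 : Enc w G.rev s5 := hI5.enc_rev (by simp [s5]) (by simp [s5, hI4.n_eq])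
  have hd' := hopDijkstra_spec (ω := ω) hG.noTwoHops_rev hE5 (S := S) (fun v => by
    rw [← hS v, ← k5]; rfl)
  rw [hI5.h_eq] at hd'
  have hI6 : Inp w G h L m (hopDijkstra.run w ω s5) := hI5.run rfl rfl rfl
  have l19 : (hopDijkstra.run w ω s5).wvar 19 = i := by
    rw [SP.run_wvar rfl]; simpa [s5] using k19
  have l3 : ∀ p, (hopDijkstra.run w ω s5).val 7 p = s4.val 7 p := fun p =>
    SP.run_val rfl rfl s5 p
  have l4 : ∀ p, (hopDijkstra.run w ω s5).val 4 p = s.val 4 p := fun p =>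
    (SP.run_val rfl rfl s5 p).trans (k4 p)
  have lc : (hopDijkstra.run w ω s5).coins = s.coins + n * L := by
    rw [SP.run_coins rfl]; exact kc
  set s6 := hopDijkstra.run w ω s5
  obtain ⟨hc4, hp4⟩ := copyTo_spec (ω := ω) hI6 (a := 4) (by norm_num) (by norm_num) l19 hi
  have m3 : ∀ p, ((copyTo 4).run w ω s6).val 7 p = s4.val 7 p := fun p =>
    (SP.run_val rfl rfl s6 p).trans (l3 p)
  refine ⟨by rw [SP.run_coins rfl]; exact lc, fun v => ?_, fun v => ?_, fun p hp => ⟨?_, ?_⟩⟩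
  · rw [m3, hc3 v v.2, hd]
  · rw [hc4 v v.2, hd']
  · rw [m3, hp3 p hp, g3]
  · rw [hp4 p hp, l4]

/-- All trials of a level. -/
def trials : SP := .count 19 3 trial

theorem trials_spec (hG : G.WellBehaved) (hs : Inp w G h L m s) :
    (trials.run w ω s).coins = s.coins + m * (n * L) ∧
    (∀ i < m, ∀ v : Fin n, (trials.run w ω s).val 7 (i * n + v) =
      G.setDist (sampleSet n ω (s.coins + i * (n * L)) L (s.wvar 18)) h v) ∧
    ∀ i < m, ∀ v : Fin n, (trials.run w ω s).val 4 (i * n + v) =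
      G.rev.setDist (sampleSet n ω (s.coins + i * (n * L)) L (s.wvar 18)) h v := by
  have key := SP.run_count (w := w) (ω := ω) (fun k s' => (Inp w G h L m s' ∧
    s'.wvar 18 = s.wvar 18) ∧ s'.coins = s.coins + k * (n * L) ∧
    (∀ i < k, ∀ v : Fin n, s'.val 7 (i * n + v) =
      G.setDist (sampleSet n ω (s.coins + i * (n * L)) L (s.wvar 18)) h v) ∧
    ∀ i < k, ∀ v : Fin n, s'.val 4 (i * n + v) =
      G.rev.setDist (sampleSet n ω (s.coins + i * (n * L)) L (s.wvar 18)) h v)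
    (x := 19) (b := 3) (p := trial) (s := s) hs.m_eq
    ⟨⟨hs.setW (by norm_num), by simp⟩, by simp, by simp, by simp⟩ ?_
  · exact key.2
  · rintro k hk s1 hks ⟨⟨hI, h18⟩, hc, h3, h4⟩
    obtain ⟨tc, t3, t4, tp⟩ := trial_spec (ω := ω) hG hI hks hk
    rw [h18, hc] at t3 t4
    refine ⟨⟨(hI.run rfl rfl rfl).setW (by norm_num), ?_⟩, ?_, fun i hi v => ?_, fun i hi v => ?_⟩
    · rw [State.setW_wvar, if_neg (by norm_num), SP.run_wvar rfl, h18]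
    · rw [State.setW_coins, tc, hc]; ring
    · rw [State.setW_val]
      rcases Nat.lt_succ_iff_lt_or_eq.1 hi with hi | rfl
      · rw [(tp _ (mul_add_lt hi v.2)).1, h3 i hi]
      · exact t3 v
    · rw [State.setW_val]
      rcases Nat.lt_succ_iff_lt_or_eq.1 hi with hi | rfl
      · rw [(tp _ (mul_add_lt hi v.2)).2, h4 i hi]
      · exact t4 v

end RealRAM

/-! ### Medians and the choice of thresholds. -/

namespace RealRAM

open NegGraph

variable {n : ℕ} {w : ℕ} {ω : ℕ → Bool}

/-- `x` is a median of `f 0, …, f (m - 1)`. -/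
def IsMedian (m : ℕ) (f : ℕ → EReal) (x : EReal) : Prop :=
  2 * ((Finset.range m).filter fun i => f i < x).card ≤ m ∧
    m ≤ 2 * ((Finset.range m).filter fun i => f i ≤ x).card

/-- Take the largest entry with at most half of the entries strictly below it. If fewer than half
were at most this entry, the next larger value would qualify as well. -/
theorem exists_isMedian {m : ℕ} (hm : 0 < m) (f : ℕ → EReal) : ∃ i < m, IsMedian m f (f i) := by
  classical
  set T := (Finset.range m).filter fun i =>
    2 * ((Finset.range m).filter fun i' => f i' < f i).card ≤ m with hT
  have hne : T.Nonempty := by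
    obtain ⟨i, hi, hmin⟩ := Finset.exists_min_image (Finset.range m) f ⟨0, by simpa⟩
    refine ⟨i, Finset.mem_filter.2 ⟨hi, ?_⟩⟩
    rw [Finset.filter_eq_empty_iff.2 fun i' hi' => not_lt.2 (hmin i' hi')]
    simp
  obtain ⟨i, hi, hmax⟩ := Finset.exists_max_image T f hne
  obtain ⟨him, hi2⟩ := Finset.mem_filter.1 hi
  refine ⟨i, Finset.mem_range.1 him, hi2, ?_⟩
  by_contra! hlt
  set U := (Finset.range m).filter fun i' => f i < f i' with hU
  have hne' : U.Nonempty := by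
    rw [Finset.nonempty_iff_ne_empty]
    intro he
    rw [Finset.filter_eq_empty_iff] at he
    rw [Finset.filter_true_of_mem fun i' hi' => not_lt.1 (he hi'), Finset.card_range] at hlt
    omega
  obtain ⟨k, hk, hmin⟩ := Finset.exists_min_image U f hne'
  obtain ⟨hkm, hk2⟩ := Finset.mem_filter.1 hk
  have hsub : ((Finset.range m).filter fun i' => f i' < f k) ⊆
      (Finset.range m).filter fun i' => f i' ≤ f i := by
    intro i' hi'
    obtain ⟨h1, h2⟩ := Finset.mem_filter.1 hi'
    refine Finset.mem_filter.2 ⟨h1, ?_⟩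
    by_contra! h3
    exact absurd (hmin i' (Finset.mem_filter.2 ⟨h1, h3⟩)) (not_le.2 h2)
  have := Finset.card_le_card hsub
  exact absurd (hmax k (Finset.mem_filter.2 ⟨hkm, by omega⟩)) (not_le.2 hk2)

/-- Comparison of two extended reals stored in the arrays `a`. -/
def lessB (a : ℕ) (I J : WExp) : BExp :=
  .and (.weq (.get a I) (.lit 1)) (.not (.and (.weq (.get a J) (.lit 1))
    (.not (.rlt (.get a I) (.get a J)))))

theorem lessB_holds {a : ℕ} {I J : WExp} {s : State} (h1 : 1 < 2 ^ w) :
    (lessB a I J).Holds w s ↔ s.val a (I.eval w s) < s.val a (J.eval w s) := by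
  simp only [lessB, BExp.Holds, WExp.eval, RExp.eval, Nat.mod_eq_of_lt h1, State.val]
  by_cases hI : s.warr a (I.eval w s) = 1 <;> by_cases hJ : s.warr a (J.eval w s) = 1 <;>
    simp [hI, hJ]

/-- The comparison loop of `median`. -/
def countLess (a : ℕ) : SP :=
  .count 27 3 (.seq (.ite (lessB a (cell 27 25) (cell 26 25))
      (.setW 28 (.add (.var 28) (.lit 1))) .skip)
    (.ite (lessB a (cell 26 25) (cell 27 25)) .skip (.setW 29 (.add (.var 29) (.lit 1)))))

/-- Store in the variable `res` the row of a median of column `wvar 25` of the table `a`. -/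
def median (a res : ℕ) : SP :=
  .count 26 3 (.seq (.setW 28 (.lit 0)) (.seq (.setW 29 (.lit 0)) (.seq (countLess a)
    (.ite (.and (.not (.wlt (.var 3) (.add (.var 28) (.var 28))))
        (.not (.wlt (.add (.var 29) (.var 29)) (.var 3))))
      (.setW res (.var 26)) .skip))))

variable {G : NegGraph n} {h L m : ℕ} {s : State}

theorem card_filter_range_succ (p : ℕ → Prop) [DecidablePred p] (k : ℕ) :
    ((Finset.range (k + 1)).filter p).card =
      ((Finset.range k).filter p).card + if p k then 1 else 0 := by
  rw [Finset.range_add_one, Finset.filter_insert]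
  split <;> simp

theorem countLess_spec (hs : Inp w G h L m s) {a r i : ℕ} (hr : r < n) (hi : i < m)
    (h25 : s.wvar 25 = r) (h26 : s.wvar 26 = i) (h28 : s.wvar 28 = 0) (h29 : s.wvar 29 = 0) :
    ((countLess a).run w ω s).wvar 28 = ((Finset.range m).filter fun i' =>
      s.val a (i' * n + r) < s.val a (i * n + r)).card ∧
    ((countLess a).run w ω s).wvar 29 = ((Finset.range m).filter fun i' =>
      s.val a (i' * n + r) ≤ s.val a (i * n + r)).card := by
  have h1 := hs.one_lt
  have hm := hs.mm_lt
  refine (SP.run_count (w := w) (ω := ω) (fun k s' => (Inp w G h L m s' ∧ s'.wvar 25 = r ∧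
    s'.wvar 26 = i ∧ ∀ p, s'.val a p = s.val a p) ∧
    s'.wvar 28 = ((Finset.range k).filter fun i' =>
      s.val a (i' * n + r) < s.val a (i * n + r)).card ∧
    s'.wvar 29 = ((Finset.range k).filter fun i' =>
      s.val a (i' * n + r) ≤ s.val a (i * n + r)).card) hs.m_eq
    ⟨⟨hs.setW (by norm_num), by simp [h25], by simp [h26], by simp⟩, by simp [h28],
      by simp [h29]⟩ ?_).2
  rintro k hk s1 hks ⟨⟨hI, i25, i26, iv⟩, i28, i29⟩
  have c1 : ((Finset.range k).filter fun i' =>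
      s.val a (i' * n + r) < s.val a (i * n + r)).card ≤ k := by
    simpa using Finset.card_filter_le (Finset.range k) _
  have c2 : ((Finset.range k).filter fun i' =>
      s.val a (i' * n + r) ≤ s.val a (i * n + r)).card ≤ k := by
    simpa using Finset.card_filter_le (Finset.range k) _
  rw [card_filter_range_succ, card_filter_range_succ]
  set n1 := ((Finset.range k).filter fun i' =>
      s.val a (i' * n + r) < s.val a (i * n + r)).card
  set n2 := ((Finset.range k).filter fun i' =>
      s.val a (i' * n + r) ≤ s.val a (i * n + r)).card
  rw [SP.run]
  set p1 : SP := .ite (lessB a (cell 27 25) (cell 26 25))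
      (.setW 28 (.add (.var 28) (.lit 1))) .skip
  have hp1 : (p1.run w ω s1).wvar 28 =
      n1 + if s.val a (k * n + r) < s.val a (i * n + r) then 1 else 0 := by
    simp only [p1, SP.run, lessB_holds h1, cell_eval hI hks i25 hk hr, cell_eval hI i26 i25 hi hr,
      iv]
    split
    · simp only [State.setW_wvar, WExp.eval, i28, Nat.mod_eq_of_lt h1, if_true]
      exact Nat.mod_eq_of_lt (by omega)
    · exact i28
  have hI1 : Inp w G h L m (p1.run w ω s1) := hI.run rfl rfl rfl
  have f25 : (p1.run w ω s1).wvar 25 = r := by rw [SP.run_wvar rfl, i25]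
  have f26 : (p1.run w ω s1).wvar 26 = i := by rw [SP.run_wvar rfl, i26]
  have f27 : (p1.run w ω s1).wvar 27 = k := by rw [SP.run_wvar rfl, hks]
  have f29 : (p1.run w ω s1).wvar 29 = n2 := by rw [SP.run_wvar rfl, i29]
  have fv : ∀ p, (p1.run w ω s1).val a p = s.val a p := fun p =>
    (SP.run_val rfl rfl s1 p).trans (iv p)
  generalize p1.run w ω s1 = s2 at *
  set p2 : SP := .ite (lessB a (cell 26 25) (cell 27 25)) .skip (.setW 29 (.add (.var 29) (.lit 1)))
  have hp2 : (p2.run w ω s2).wvar 29 =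
      n2 + if s.val a (k * n + r) ≤ s.val a (i * n + r) then 1 else 0 := by
    simp only [p2, SP.run, lessB_holds h1, cell_eval hI1 f27 f25 hk hr,
      cell_eval hI1 f26 f25 hi hr, fv]
    split
    · rename_i hlt
      rw [if_neg (not_le.2 hlt), f29]; rfl
    · rename_i hlt
      rw [if_pos (not_lt.1 hlt)]
      simp only [State.setW_wvar, WExp.eval, f29, Nat.mod_eq_of_lt h1, if_true]
      exact Nat.mod_eq_of_lt (by omega)
  refine ⟨⟨(hI1.run rfl rfl rfl).setW (by norm_num), ?_, ?_, fun p => ?_⟩, ?_, ?_⟩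
  · rw [State.setW_wvar, if_neg (by norm_num), SP.run_wvar rfl, f25]
  · rw [State.setW_wvar, if_neg (by norm_num), SP.run_wvar rfl, f26]
  · rw [State.setW_val, SP.run_val rfl rfl, fv]
  · rw [State.setW_wvar, if_neg (by norm_num), SP.run_wvar rfl, hp1]
  · rw [State.setW_wvar, if_neg (by norm_num), hp2]

/-- Brute force: every row is compared with all rows, at quadratic cost in `m`, which is only
polylogarithmic in `n`. Whichever median is found last is kept; any would do. The bound on `res`
keeps it clear of the scratch variables. -/
theorem median_spec (hs : Inp w G h L m s) (hm0 : 0 < m) {a r res : ℕ} (hr : r < n)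
    (h25 : s.wvar 25 = r) (hres : 30 ≤ res) :
    ∃ i < m, ((median a res).run w ω s).wvar res = i ∧
      IsMedian m (fun i' => s.val a (i' * n + r)) (s.val a (i * n + r)) := by
  have h1 := hs.one_lt
  have hm := hs.mm_lt
  have key := (SP.run_count (w := w) (ω := ω) (fun k s' => (Inp w G h L m s' ∧ s'.wvar 25 = r ∧
    ∀ p, s'.val a p = s.val a p) ∧
    ((∃ i < m, s'.wvar res = i ∧
      IsMedian m (fun i' => s.val a (i' * n + r)) (s.val a (i * n + r))) ∨
      ∀ i < k, ¬ IsMedian m (fun i' => s.val a (i' * n + r)) (s.val a (i * n + r))))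
    (x := 26) (b := 3) (p := .seq (.setW 28 (.lit 0)) (.seq (.setW 29 (.lit 0)) (.seq (countLess a)
    (.ite (.and (.not (.wlt (.var 3) (.add (.var 28) (.var 28))))
        (.not (.wlt (.add (.var 29) (.var 29)) (.var 3))))
      (.setW res (.var 26)) .skip)))) (s := s) hs.m_eq
    ⟨⟨hs.setW (by norm_num), by simp [h25], by simp⟩, by simp⟩ ?_).2
  · rcases key with h | h
    · exact h
    · obtain ⟨i, hi, hi'⟩ := exists_isMedian hm0 fun i' => s.val a (i' * n + r)
      exact absurd hi' (h i hi)
  rintro k hk s1 hks ⟨⟨hI, i25, iv⟩, hor⟩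
  set s2 := (s1.setW 28 (0 % 2 ^ w)).setW 29 (0 % 2 ^ w) with hs2
  rw [SP.run, SP.run, SP.run, SP.run, SP.run]
  have hI2 : Inp w G h L m s2 := (hI.setW (by norm_num)).setW (by norm_num)
  obtain ⟨hc1, hc2⟩ := countLess_spec (ω := ω) (a := a) hI2 hr hk (by simpa [s2] using i25)
    (by simpa [s2] using hks) (by simp [s2]) (by simp [s2])
  have hI3 : Inp w G h L m ((countLess a).run w ω s2) := hI2.run rfl rfl rfl
  have f25 : ((countLess a).run w ω s2).wvar 25 = r := by
    rw [SP.run_wvar rfl]; simpa [s2] using i25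
  have f26 : ((countLess a).run w ω s2).wvar 26 = k := by
    rw [SP.run_wvar rfl]; simpa [s2] using hks
  have fres : ((countLess a).run w ω s2).wvar res = s1.wvar res := by
    rw [SP.run_wvar (by simp [countLess, SP.writesW]; omega)]
    simp [s2, show res ≠ 29 by omega, show res ≠ 28 by omega]
  have fv : ∀ p, ((countLess a).run w ω s2).val a p = s.val a p := fun p =>
    (SP.run_val rfl rfl s2 p).trans (iv p)
  have gv : ∀ p, s2.val a p = s.val a p := fun p => iv p
  simp only [gv] at hc1 hc2
  have c1 : ((Finset.range m).filter fun i' =>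
      s.val a (i' * n + r) < s.val a (k * n + r)).card ≤ m := by
    simpa using Finset.card_filter_le (Finset.range m) _
  have c2 : ((Finset.range m).filter fun i' =>
      s.val a (i' * n + r) ≤ s.val a (k * n + r)).card ≤ m := by
    simpa using Finset.card_filter_le (Finset.range m) _
  generalize hs3 : SP.run w ω (countLess a) _ = s3
  have hs3' : SP.run w ω (countLess a) s2 = s3 := hs3
  rw [hs3'] at hI3 f25 f26 fres hc1 hc2
  simp only [hs3'] at fv
  simp only [SP.run, BExp.Holds, WExp.eval, hc1, hc2, hI3.m_eq, f26]
  -- The doubled counts do not overflow, since they are at most `2 * m < 2 ^ w`.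
  rw [Nat.mod_eq_of_lt (by omega), Nat.mod_eq_of_lt (by omega)]
  have hiff : (¬ m < ((Finset.range m).filter fun i' =>
      s.val a (i' * n + r) < s.val a (k * n + r)).card + ((Finset.range m).filter fun i' =>
      s.val a (i' * n + r) < s.val a (k * n + r)).card ∧
      ¬ ((Finset.range m).filter fun i' =>
      s.val a (i' * n + r) ≤ s.val a (k * n + r)).card + ((Finset.range m).filter fun i' =>
      s.val a (i' * n + r) ≤ s.val a (k * n + r)).card < m) ↔
      IsMedian m (fun i' => s.val a (i' * n + r)) (s.val a (k * n + r)) := by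
    rw [IsMedian]; omega
  split
  · rename_i hmed
    rw [hiff] at hmed
    refine ⟨⟨(hI3.setW (by omega)).setW (by norm_num), ?_, fv⟩, Or.inl ⟨k, hk, ?_, hmed⟩⟩
    · simpa [show 25 ≠ res by omega] using f25
    · simp [show res ≠ 26 by omega]
  · rename_i hmed
    rw [hiff] at hmed
    refine ⟨⟨hI3.setW (by norm_num), by simpa using f25, fv⟩, ?_⟩
    rcases hor with ⟨i, hi, hi', hmed'⟩ | hor
    · exact Or.inl ⟨i, hi, by simp [show res ≠ 26 by omega, fres, hi'], hmed'⟩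
    · refine Or.inr fun i hi => ?_
      rcases Nat.lt_succ_iff_lt_or_eq.1 hi with hi | rfl
      · exact hor i hi
      · exact hmed

/-- The medians of the two families have negative sum. -/
def Low (m : ℕ) (f g : ℕ → EReal) : Prop :=
  ∃ a c : ℝ, a + c < 0 ∧ IsMedian m f a ∧ IsMedian m g c

/-- The threshold `δ` lies between the medians of the two families. -/
def High (m : ℕ) (f g : ℕ → EReal) (δ : ℝ) : Prop :=
  ∃ a c : EReal, (δ : EReal) ≤ a ∧ ((-δ : ℝ) : EReal) ≤ c ∧ IsMedian m f a ∧ IsMedian m g c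

/-- Fix the threshold of the vertex in variable `25` as soon as the medians allow it. -/
def settle : SP :=
  .seq (median 7 30) (.seq (median 4 31) (.ite (.weq (.get 6 (.var 25)) (.lit 0))
    (.ite (.and (.and (.weq (.get 7 (cell 30 25)) (.lit 1)) (.weq (.get 4 (cell 31 25)) (.lit 1)))
        (.rlt (.add (.get 7 (cell 30 25)) (.get 4 (cell 31 25))) .zero))
      .skip
      (.seq (.putW 6 (.var 25) (.lit 1))
        (.ite (.weq (.get 7 (cell 30 25)) (.lit 1)) (.putR 1 (.var 25) (.get 7 (cell 30 25)))
          (.ite (.weq (.get 4 (cell 31 25)) (.lit 1))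
            (.putR 1 (.var 25) (.sub .zero (.get 4 (cell 31 25)))) .skip))))
    .skip))

/-- If the medians are not both finite with negative sum, a threshold exists: the first median if it
is finite, otherwise minus the second one if that is finite, otherwise any real. In the first case
with both finite, `a + c ≥ 0` is exactly `-a ≤ c`. -/
theorem settle_spec (hs : Inp w G h L m s) (hm0 : 0 < m) {r : ℕ} (hr : r < n)
    (h25 : s.wvar 25 = r) :
    (∀ p, p ≠ r → (settle.run w ω s).warr 6 p = s.warr 6 p ∧
      (settle.run w ω s).rarr 1 p = s.rarr 1 p) ∧
    (s.warr 6 r ≠ 0 → (settle.run w ω s).warr 6 r = s.warr 6 r ∧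
      (settle.run w ω s).rarr 1 r = s.rarr 1 r) ∧
    (s.warr 6 r = 0 →
      ((settle.run w ω s).warr 6 r = 0 ∧
        Low m (fun i => s.val 7 (i * n + r)) (fun i => s.val 4 (i * n + r))) ∨
      ((settle.run w ω s).warr 6 r ≠ 0 ∧
        High m (fun i => s.val 7 (i * n + r)) (fun i => s.val 4 (i * n + r))
          ((settle.run w ω s).rarr 1 r))) := by
  have h1 := hs.one_lt
  rw [settle, SP.run, SP.run]
  obtain ⟨i, hi, hx, hmi⟩ := median_spec (ω := ω) hs hm0 hr h25 (a := 7) (res := 30) le_rfl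
  have hI1 : Inp w G h L m ((median 7 30).run w ω s) := hs.run rfl rfl rfl
  have f25 : ((median 7 30).run w ω s).wvar 25 = r := by rw [SP.run_wvar rfl, h25]
  have f6 : ((median 7 30).run w ω s).warr = s.warr := by ext; rw [SP.run_warr rfl]
  have f1 : ((median 7 30).run w ω s).rarr = s.rarr := by ext; rw [SP.run_rarr rfl]
  generalize (median 7 30).run w ω s = s1 at *
  obtain ⟨i', hi', hx', hmi'⟩ := median_spec (ω := ω) hI1 hm0 hr f25 (a := 4) (res := 31)
    (by norm_num)
  have hI2 : Inp w G h L m ((median 4 31).run w ω s1) := hI1.run rfl rfl rfl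
  have g30 : ((median 4 31).run w ω s1).wvar 30 = i := by rw [SP.run_wvar rfl, hx]
  have g25 : ((median 4 31).run w ω s1).wvar 25 = r := by rw [SP.run_wvar rfl, f25]
  have g6 : ((median 4 31).run w ω s1).warr = s.warr := by ext; rw [SP.run_warr rfl, f6]
  have g1 : ((median 4 31).run w ω s1).rarr = s.rarr := by ext; rw [SP.run_rarr rfl, f1]
  generalize (median 4 31).run w ω s1 = s2 at *
  have hv4 : ∀ p, s1.val 4 p = s.val 4 p := State.val_congr (by rw [f6]) (by rw [f1])
  simp only [hv4] at hmi'
  have e1 := cell_eval hI2 g30 g25 hi hr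
  have e2 := cell_eval hI2 hx' g25 hi' hr
  have hI3 : Inp w G h L m (s2.putW 6 r 1) := hI2.congr (fun _ _ => rfl) (by ext; simp) rfl
  have e3 := cell_eval hI3 (X := 30) (Y := 25) g30 g25 hi hr
  have e4 := cell_eval hI3 (X := 31) (Y := 25) hx' g25 hi' hr
  by_cases h6 : s.warr 6 r = 0
  swap
  · simp [SP.run, BExp.Holds, WExp.eval, g25, g6, g1, h6]
  simp only [SP.run, BExp.Holds, WExp.eval, RExp.eval, g25, e1, e2, e3, e4, g6, g1, h6,
    Nat.mod_eq_of_lt h1, Nat.zero_mod, State.putW_warr, State.putW_rarr, State.putW_wvar]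
  simp only [if_true, ne_eq, not_true_eq_false, false_imp_iff, true_and, true_imp_iff,
    show ¬ (7 = 6) by norm_num, show ¬ (4 = 6) by norm_num, false_and, if_false]
  by_cases hA : s.warr 7 (i * n + r) = 1 <;> by_cases hC : s.warr 4 (i' * n + r) = 1
  · have vA : s.val 7 (i * n + r) = (s.rarr 7 (i * n + r) : ℝ) := by simp [State.val, hA]
    have vC : s.val 4 (i' * n + r) = (s.rarr 4 (i' * n + r) : ℝ) := by simp [State.val, hC]
    by_cases hlt : s.rarr 7 (i * n + r) + s.rarr 4 (i' * n + r) < 0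
    · simp only [hA, hC, hlt, and_self, if_true, g6, g1, h6, implies_true, true_and]
      exact Or.inl ⟨_, _, hlt, vA ▸ hmi, vC ▸ hmi'⟩
    · simp only [hA, hC, hlt, and_false, if_false, if_true]
      refine ⟨fun p hp => by simp [hp, g6, g1], Or.inr ⟨by simp, _, _, ?_, ?_, hmi, hmi'⟩⟩
      · rw [vA]; simp
      · rw [vC, EReal.coe_le_coe_iff]; simp; linarith
  · have vA : s.val 7 (i * n + r) = (s.rarr 7 (i * n + r) : ℝ) := by simp [State.val, hA]
    have vC : s.val 4 (i' * n + r) = ⊤ := by simp [State.val, hC]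
    simp only [hA, hC, and_false, false_and, if_false, if_true]
    refine ⟨fun p hp => by simp [hp, g6, g1], Or.inr ⟨by simp, _, _, ?_, ?_, hmi, hmi'⟩⟩
    · rw [vA]; simp
    · rw [vC]; exact le_top
  · have vA : s.val 7 (i * n + r) = ⊤ := by simp [State.val, hA]
    have vC : s.val 4 (i' * n + r) = (s.rarr 4 (i' * n + r) : ℝ) := by simp [State.val, hC]
    simp only [hA, hC, false_and, if_false, if_true]
    refine ⟨fun p hp => by simp [hp, g6, g1], Or.inr ⟨by simp, _, _, ?_, ?_, hmi, hmi'⟩⟩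
    · rw [vA]; exact le_top
    · rw [vC]; simp
  -- Both medians are infinite: the threshold cell keeps its old content, and every real satisfies
  -- the two bounds.
  · have vA : s.val 7 (i * n + r) = ⊤ := by simp [State.val, hA]
    have vC : s.val 4 (i' * n + r) = ⊤ := by simp [State.val, hC]
    simp only [hA, hC, false_and, if_false]
    refine ⟨fun p hp => by simp [hp, g6, g1], Or.inr ⟨by simp, _, _, ?_, ?_, hmi, hmi'⟩⟩
    · rw [vA]; exact le_top
    · rw [vC]; exact le_top

/-- Settle all vertices. -/
def settleAll : SP := .count 25 0 settle

theorem settleAll_spec (hs : Inp w G h L m s) (hm0 : 0 < m) (r : ℕ) (hr : r < n) :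
    (s.warr 6 r ≠ 0 → (settleAll.run w ω s).warr 6 r ≠ 0 ∧
      (settleAll.run w ω s).rarr 1 r = s.rarr 1 r) ∧
    (s.warr 6 r = 0 →
      ((settleAll.run w ω s).warr 6 r = 0 ∧
        Low m (fun i => s.val 7 (i * n + r)) (fun i => s.val 4 (i * n + r))) ∨
      ((settleAll.run w ω s).warr 6 r ≠ 0 ∧
        High m (fun i => s.val 7 (i * n + r)) (fun i => s.val 4 (i * n + r))
          ((settleAll.run w ω s).rarr 1 r))) := by
  have key := SP.run_count (w := w) (ω := ω) (fun k s' => (Inp w G h L m s' ∧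
    (∀ p, s'.val 7 p = s.val 7 p) ∧ ∀ p, s'.val 4 p = s.val 4 p) ∧
    (∀ r, k ≤ r → s'.warr 6 r = s.warr 6 r ∧ s'.rarr 1 r = s.rarr 1 r) ∧
    ∀ r < k, (s.warr 6 r ≠ 0 → s'.warr 6 r ≠ 0 ∧ s'.rarr 1 r = s.rarr 1 r) ∧
    (s.warr 6 r = 0 →
      (s'.warr 6 r = 0 ∧
        Low m (fun i => s.val 7 (i * n + r)) (fun i => s.val 4 (i * n + r))) ∨
      (s'.warr 6 r ≠ 0 ∧
        High m (fun i => s.val 7 (i * n + r)) (fun i => s.val 4 (i * n + r))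
          (s'.rarr 1 r))))
    (x := 25) (b := 0) (p := settle) (s := s) hs.n_eq
    ⟨⟨hs.setW (by norm_num), by simp, by simp⟩, by simp, by simp⟩ ?_
  · exact key.2.2 r hr
  rintro k hk s1 hks ⟨⟨hI, i7, i4⟩, hge, hlt⟩
  obtain ⟨hne, hdone, hnew⟩ := settle_spec (ω := ω) hI hm0 hk hks
  simp only [i7, i4] at hnew
  refine ⟨⟨(hI.run rfl rfl rfl).setW (by norm_num), fun p => ?_, fun p => ?_⟩,
    fun r hr => ?_, fun r hr => ?_⟩
  · rw [State.setW_val, SP.run_val rfl rfl, i7]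
  · rw [State.setW_val, SP.run_val rfl rfl, i4]
  · simp only [State.setW_warr, State.setW_rarr]
    rw [(hne r (by omega)).1, (hne r (by omega)).2]
    exact hge r (by omega)
  · simp only [State.setW_warr, State.setW_rarr]
    rcases Nat.lt_succ_iff_lt_or_eq.1 hr with hr | rfl
    · rw [(hne r (by omega)).1, (hne r (by omega)).2]
      exact hlt r hr
    · obtain ⟨hg1, hg2⟩ := hge r le_rfl
      rw [hg1, hg2] at hdone
      rw [hg1] at hnew
      exact ⟨fun h0 => by rw [(hdone h0).1, (hdone h0).2]; exact ⟨h0, rfl⟩, hnew⟩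

/-- The set sampled in trial `i` of level `j`. -/
def levelSet (n : ℕ) (ω : ℕ → Bool) (L m j i : ℕ) : Finset (Fin n) :=
  sampleSet n ω ((j * m + i) * (n * L)) L j

/-- All levels. -/
def levels : SP := .count 18 2 (.seq trials settleAll)

/-- A threshold is frozen once it is set, so a settled vertex was settled at its first level that is
not low. All earlier levels are therefore low, which the size estimate needs. -/
theorem levels_spec (hG : G.WellBehaved) (hs : Inp w G h L m s) (hm0 : 0 < m)
    (hc : s.coins = 0) (h6 : ∀ r, s.warr 6 r = 0) (r : Fin n) :
    (∀ j < L, Low m (fun i => G.setDist (levelSet n ω L m j i) h r)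
      (fun i => G.rev.setDist (levelSet n ω L m j i) h r)) ∨
    ∃ j < L, High m (fun i => G.setDist (levelSet n ω L m j i) h r)
      (fun i => G.rev.setDist (levelSet n ω L m j i) h r) ((levels.run w ω s).rarr 1 r) ∧
      ∀ j' < j, Low m (fun i => G.setDist (levelSet n ω L m j' i) h r)
      (fun i => G.rev.setDist (levelSet n ω L m j' i) h r) := by
  have key := (SP.run_count (w := w) (ω := ω) (fun k s' => (Inp w G h L m s' ∧
    s'.coins = k * (m * (n * L))) ∧ ∀ r : Fin n,
    (s'.warr 6 r = 0 ∧ ∀ j < k, Low m (fun i => G.setDist (levelSet n ω L m j i) h r)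
      (fun i => G.rev.setDist (levelSet n ω L m j i) h r)) ∨
    s'.warr 6 r ≠ 0 ∧ ∃ j < k, High m (fun i => G.setDist (levelSet n ω L m j i) h r)
      (fun i => G.rev.setDist (levelSet n ω L m j i) h r) (s'.rarr 1 r) ∧
      ∀ j' < j, Low m (fun i => G.setDist (levelSet n ω L m j' i) h r)
      (fun i => G.rev.setDist (levelSet n ω L m j' i) h r))
    (x := 18) (b := 2) (p := .seq trials settleAll) (s := s) hs.l_eq
    ⟨⟨hs.setW (by norm_num), by simp [hc]⟩, by simp [h6]⟩ ?_).2 r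
  · rcases key with ⟨-, h⟩ | ⟨-, h⟩
    · exact Or.inl h
    · exact Or.inr h
  rintro k hk s1 hks ⟨⟨hI, ic⟩, hinv⟩
  obtain ⟨tc, t7, t4⟩ := trials_spec (ω := ω) hG hI
  have hI1 : Inp w G h L m (trials.run w ω s1) := hI.run rfl rfl rfl
  have f6 : (trials.run w ω s1).warr 6 = s1.warr 6 := SP.run_warr rfl s1
  have f1 : (trials.run w ω s1).rarr 1 = s1.rarr 1 := SP.run_rarr rfl s1
  rw [SP.run]
  generalize trials.run w ω s1 = s2 at *
  have hset : ∀ i, sampleSet n ω (s1.coins + i * (n * L)) L (s1.wvar 18) =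
      levelSet n ω L m k i := fun i => by rw [levelSet, ic, hks]; congr 1; ring
  simp only [hset] at t7 t4
  refine ⟨⟨(hI1.run rfl rfl rfl).setW (by norm_num), ?_⟩, fun r => ?_⟩
  · rw [State.setW_coins, SP.run_coins rfl, tc, ic]; ring
  simp only [State.setW_warr, State.setW_rarr]
  obtain ⟨hold, hnew⟩ := settleAll_spec (ω := ω) hI1 hm0 r r.2
  rw [f6, f1] at hold
  rw [f6] at hnew
  -- The tables agree with the true distances only in the rows below `m`; medians look at no other
  -- rows.
  have hmed : ∀ {f g : ℕ → EReal} {x : EReal}, (∀ i < m, f i = g i) →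
      IsMedian m f x → IsMedian m g x := by
    intro f g x hfg hf
    have h1 : (Finset.range m).filter (fun i => g i < x) =
        (Finset.range m).filter fun i => f i < x :=
      Finset.filter_congr fun i hi => by rw [hfg i (Finset.mem_range.1 hi)]
    have h2 : (Finset.range m).filter (fun i => g i ≤ x) =
        (Finset.range m).filter fun i => f i ≤ x :=
      Finset.filter_congr fun i hi => by rw [hfg i (Finset.mem_range.1 hi)]
    rw [IsMedian, h1, h2]
    exact hf
  rcases hinv r with ⟨h6r, hlow⟩ | ⟨h6r, j, hj, hhigh, hlow⟩
  · rcases hnew h6r with ⟨h0, a, c, hac, ha, hc'⟩ | ⟨h0, a, c, ha1, hc1, ha, hc'⟩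
    · refine Or.inl ⟨h0, fun j hj => ?_⟩
      rcases Nat.lt_succ_iff_lt_or_eq.1 hj with hj | rfl
      · exact hlow j hj
      · exact ⟨a, c, hac, hmed (fun i hi => t7 i hi r) ha, hmed (fun i hi => t4 i hi r) hc'⟩
    · exact Or.inr ⟨h0, k, by omega, ⟨a, c, ha1, hc1, hmed (fun i hi => t7 i hi r) ha,
        hmed (fun i hi => t4 i hi r) hc'⟩, hlow⟩
  · exact Or.inr ⟨(hold h6r).1, j, by omega, by rw [(hold h6r).2]; exact hhigh, hlow⟩

end RealRAM

/-! ### The whole program: word size and running time. -/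

namespace RealRAM

open NegGraph

variable {n h L m : ℕ} {w : ℕ} {ω : ℕ → Bool}

/-- Compute the binary logarithm of `n`, rounded up, in the variable `33`. -/
def logLoop : SP :=
  .seq (.setW 32 (.lit 1)) (.count 34 0 (.ite (.wlt (.var 32) (.var 0))
    (.seq (.setW 32 (.add (.var 32) (.var 32))) (.setW 33 (.add (.var 33) (.lit 1)))) .skip))

/-- Variable `32` doubles until it reaches `n`; since `Nat.clog 2 n ≤ n`, a loop of `n` iterations
is long enough. The bound on `2 * n` rules out overflow in the doubling. -/
theorem logLoop_spec {s : State} (hn : s.wvar 0 = n) (h33 : s.wvar 33 = 0)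
    (h1 : 1 < 2 ^ w) (hw : 2 * n < 2 ^ w) :
    (logLoop.run w ω s).wvar 33 = Nat.clog 2 n := by
  have hclog : Nat.clog 2 n ≤ n := Nat.clog_le_of_le_pow (Nat.lt_two_pow_self).le
  have key : (logLoop.run w ω s).wvar 33 = min n (Nat.clog 2 n) := by
    rw [logLoop, SP.run]
    refine (SP.run_count (fun k s' => s'.wvar 0 = n ∧ s'.wvar 32 = 2 ^ min k (Nat.clog 2 n) ∧
      s'.wvar 33 = min k (Nat.clog 2 n)) (by simpa [SP.run] using hn) ?_ ?_).2.2
    · simp [SP.run, WExp.eval, hn, h33, Nat.mod_eq_of_lt h1]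
    · rintro k hk s1 - ⟨i0, i32, i33⟩
      simp only [SP.run, BExp.Holds, WExp.eval, i0, i32, Nat.mod_eq_of_lt h1]
      by_cases hlt : k < Nat.clog 2 n
      · have hp := (Nat.lt_clog_iff_pow_lt (by norm_num : 1 < 2)).1 hlt
        have hk2 := Nat.lt_two_pow_self (n := k)
        rw [min_eq_left hlt.le, min_eq_left (by omega : k + 1 ≤ Nat.clog 2 n), if_pos hp]
        simp only [State.setW_wvar, i33]
        norm_num
        refine ⟨i0, ?_, ?_⟩
        · rw [Nat.mod_eq_of_lt (by omega)]; ring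
        · rw [min_eq_left hlt.le, Nat.mod_eq_of_lt (by omega)]
      · have hp := mt (Nat.lt_clog_iff_pow_lt (by norm_num : 1 < 2)).2 (lt_irrefl (Nat.clog 2 n))
        push Not at hlt
        rw [min_eq_right hlt, min_eq_right (by omega : Nat.clog 2 n ≤ k + 1), if_neg hp]
        simp [i0, i32, i33, hlt]
  rw [key, min_eq_right hclog]

/-- The whole program, with `a` times as many trials as levels on each level. -/
def program (a : ℕ) : Prog :=
  .seq logLoop.compile (.seq (.setW 2 (.add (.var 33) (.lit 1)))
    (.seq (.setW 3 (.mul (.lit a) (.var 2))) levels.compile))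

/-- The values of the constants. -/
def constEnv (n h L m : ℕ) : ℕ → ℕ := fun b =>
  if b = 0 then n else if b = 1 then h else if b = 2 then L else if b = 3 then m else 0

theorem dijkstra_cost (hn : 1 ≤ n) (h L m : ℕ) :
    SP.cost (constEnv n h L m) dijkstra ≤ 500 * n ^ 2 := by
  simp [dijkstra, dijkstraStep, findMin, relaxFrom, relax, SP.cost, constEnv, BExp.cost,
    RExp.cost, WExp.cost, entryExp]
  nlinarith

theorem hopPass_cost (hn : 1 ≤ n) (h L m : ℕ) :
    SP.cost (constEnv n h L m) hopPass ≤ 500 * n ^ 2 := by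
  simp [hopPass, relax, SP.cost, constEnv, BExp.cost, RExp.cost, WExp.cost, entryExp]
  nlinarith

theorem hopDijkstra_cost (hn : 1 ≤ n) (hh : 1 ≤ h) (L m : ℕ) :
    SP.cost (constEnv n h L m) hopDijkstra ≤ 2000 * (h * n ^ 2) := by
  have h1 := dijkstra_cost hn h L m
  have h2 := hopPass_cost hn h L m
  have e : SP.cost (constEnv n h L m) hopDijkstra = n * 15 + 6 +
      (SP.cost (constEnv n h L m) dijkstra + (h * (SP.cost (constEnv n h L m) hopPass +
      SP.cost (constEnv n h L m) dijkstra + 8) + 6)) := by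
    simp [hopDijkstra, SP.cost, constEnv, WExp.cost, RExp.cost]
  rw [e]
  have h3 : n ≤ n ^ 2 := Nat.le_self_pow (by norm_num) n
  have h4 : n ^ 2 ≤ h * n ^ 2 := Nat.le_mul_of_pos_left _ hh
  have h5 : h ≤ h * n ^ 2 := Nat.le_mul_of_pos_right _ (by positivity)
  have h6 := Nat.mul_le_mul_left h (Nat.add_le_add_right (Nat.add_le_add h2 h1) 8)
  have h7 : h * (500 * n ^ 2 + 500 * n ^ 2 + 8) = 1000 * (h * n ^ 2) + 8 * h := by ring
  omega

theorem trial_cost (hn : 1 ≤ n) (hh : 1 ≤ h) (hL : 1 ≤ L) (m : ℕ) :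
    SP.cost (constEnv n h L m) trial ≤ 10000 * (h * n ^ 2 * L) := by
  have h1 := hopDijkstra_cost hn hh L m
  have e : SP.cost (constEnv n h L m) trial = n * (L * 20 + 19) + 2 * (n * 24) +
      2 * SP.cost (constEnv n h L m) hopDijkstra + 26 := by
    simp [trial, sample, copyTo, SP.cost, constEnv, WExp.cost, RExp.cost, BExp.cost, cell]
    ring
  have h3 : n ≤ n ^ 2 := Nat.le_self_pow (by norm_num) n
  have h4 : n ^ 2 ≤ h * n ^ 2 := Nat.le_mul_of_pos_left _ hh
  have h5 : h * n ^ 2 ≤ h * n ^ 2 * L := Nat.le_mul_of_pos_right _ hL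
  have h6 : n * L ≤ h * n ^ 2 * L := Nat.mul_le_mul_right L (h3.trans h4)
  have h7 : n * (L * 20 + 19) = 20 * (n * L) + 19 * n := by ring
  rw [e, h7]
  omega

theorem settle_cost (hm : 1 ≤ m) (n h L : ℕ) :
    SP.cost (constEnv n h L m) settle ≤ 1000 * m ^ 2 := by
  simp [settle, median, countLess, lessB, cell, SP.cost, constEnv, BExp.cost, RExp.cost,
    WExp.cost]
  nlinarith

/-- Each of the `L` levels runs `m` trials of cost `O(h * n ^ 2 * L)` and computes medians for `n`
vertices at cost `O(m ^ 2)` each. The bound is generous in the logarithmic factors. -/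
theorem levels_cost (hn : 1 ≤ n) (hh : 1 ≤ h) (hL : 1 ≤ L) (hm : 1 ≤ m) :
    SP.cost (constEnv n h L m) levels ≤ 20000 * (h * n ^ 2 * L ^ 2 * m ^ 2) := by
  have h1 := trial_cost hn hh hL m
  have h2 := settle_cost hm n h L
  have e : SP.cost (constEnv n h L m) levels =
      L * (m * (SP.cost (constEnv n h L m) trial + 8) + 6 +
        (n * (SP.cost (constEnv n h L m) settle + 8) + 6) + 8) + 6 := by
    simp [levels, trials, settleAll, SP.cost, constEnv]
  have h3 : n ≤ n ^ 2 := Nat.le_self_pow (by norm_num) n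
  have h4 : n ^ 2 ≤ h * n ^ 2 := Nat.le_mul_of_pos_left _ hh
  set Z := h * n ^ 2 with hZ
  have hZ1 : 1 ≤ Z := by omega
  have hLm : 1 ≤ L * m ^ 2 := Nat.mul_pos hL (by positivity)
  have hX : 1 ≤ Z * L * m ^ 2 := Nat.mul_pos (Nat.mul_pos hZ1 hL) (by positivity)
  have h5 : m * (SP.cost (constEnv n h L m) trial + 8) ≤ 10008 * (Z * L * m ^ 2) := by
    calc m * (SP.cost (constEnv n h L m) trial + 8) ≤ m * (10000 * (Z * L) + 8) := by gcongr
      _ ≤ m * (10000 * (Z * L) + 8 * (Z * L)) := by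
          gcongr; exact Nat.le_mul_of_pos_right _ (Nat.mul_pos hZ1 hL)
      _ = 10008 * (Z * L * m) := by ring
      _ ≤ 10008 * (Z * L * m ^ 2) := by gcongr; exact Nat.le_self_pow (by norm_num) m
  have h6 : n * (SP.cost (constEnv n h L m) settle + 8) ≤ 1008 * (Z * L * m ^ 2) := by
    calc n * (SP.cost (constEnv n h L m) settle + 8) ≤ Z * (1000 * m ^ 2 + 8) := by
          gcongr; omega
      _ ≤ Z * (1000 * m ^ 2 + 8 * m ^ 2) := by
          gcongr; exact Nat.le_mul_of_pos_right _ (by positivity)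
      _ = 1008 * (Z * 1 * m ^ 2) := by ring
      _ ≤ 1008 * (Z * L * m ^ 2) := by gcongr
  rw [e]
  calc _ ≤ L * (10008 * (Z * L * m ^ 2) + 6 + (1008 * (Z * L * m ^ 2) + 6) + 8) + 6 := by gcongr
    _ ≤ L * (19000 * (Z * L * m ^ 2)) + L * 6 := by
        have : L * (10008 * (Z * L * m ^ 2) + 6 + (1008 * (Z * L * m ^ 2) + 6) + 8) ≤
          L * (19000 * (Z * L * m ^ 2)) := by gcongr; omega
        omega
    _ ≤ L * (19000 * (Z * L * m ^ 2)) + L * (6 * (Z * L * m ^ 2)) := by gcongr; omega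
    _ = 19006 * (Z * L ^ 2 * m ^ 2) := by ring
    _ ≤ _ := by gcongr; norm_num

theorem logLoop_cost (hn : 1 ≤ n) (h L m : ℕ) :
    SP.cost (constEnv n h L m) logLoop ≤ 100 * n := by
  simp [logLoop, SP.cost, constEnv, BExp.cost, WExp.cost]
  omega

theorem clog_le_log_add_one (n : ℕ) : Nat.clog 2 n ≤ Nat.log 2 n + 1 :=
  Nat.clog_le_of_le_pow (Nat.lt_pow_succ_log_self (by norm_num) n).le

/-- With `N = n + h ≥ 2`, the constant `a + 1` is at most `2 ^ a ≤ N ^ a`, so words of `(a + 4) *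
O(log N)` bits hold everything of size `(a + 1) * N ^ 4`. -/
theorem word_bound {a n h : ℕ} (hn : 1 ≤ n) (hh : 1 ≤ h) :
    (a + 1) * (n + h) ^ 4 < 2 ^ ((a + 4) * (Nat.log 2 (n + h) + 1)) := by
  calc (a + 1) * (n + h) ^ 4 ≤ (n + h) ^ a * (n + h) ^ 4 := by
        refine Nat.mul_le_mul_right _ (le_trans (Nat.lt_two_pow_self (n := a)) ?_)
        exact Nat.pow_le_pow_left (by omega) a
    _ = (n + h) ^ (a + 4) := by rw [pow_add]
    _ < (2 ^ (Nat.log 2 (n + h) + 1)) ^ (a + 4) :=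
        Nat.pow_lt_pow_left (Nat.lt_pow_succ_log_self (by norm_num) _) (by omega)
    _ = _ := by rw [← pow_mul, mul_comm]

/-- The program halts in time, and the thresholds it outputs are governed by the medians. -/
theorem program_spec {a : ℕ} (ha : 0 < a) (hn : 1 ≤ n) (hh : 1 ≤ h) {G : NegGraph n}
    (hG : G.WellBehaved) (hL : L = Nat.clog 2 n + 1) (hm : m = a * L) :
    ∃ Δ : (ℕ → Bool) → Fin n → ℝ,
      (∀ ω : ℕ → Bool, ∃ (s : State) (t : ℕ),
        Exec ((a + 4) * (Nat.log 2 (n + h) + 1)) ω (program a) (input G h) s t ∧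
        (∀ r : Fin n, s.rarr 1 r = Δ ω r) ∧
        t ≤ 2000000 * a ^ 2 * h * n ^ 2 * (Nat.log 2 n + 1) ^ 4) ∧
      ∀ (ω : ℕ → Bool) (r : Fin n),
        (∀ j < L, Low m (fun i => G.setDist (levelSet n ω L m j i) h r)
          (fun i => G.rev.setDist (levelSet n ω L m j i) h r)) ∨
        ∃ j < L, High m (fun i => G.setDist (levelSet n ω L m j i) h r)
          (fun i => G.rev.setDist (levelSet n ω L m j i) h r) (Δ ω r) ∧
          ∀ j' < j, Low m (fun i => G.setDist (levelSet n ω L m j' i) h r)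
          (fun i => G.rev.setDist (levelSet n ω L m j' i) h r) := by
  set w := (a + 4) * (Nat.log 2 (n + h) + 1) with hw
  have hclog : Nat.clog 2 n ≤ n := Nat.clog_le_of_le_pow (Nat.lt_two_pow_self).le
  have hL1 : 1 ≤ L := by omega
  have hm1 : 1 ≤ m := by rw [hm]; exact Nat.mul_pos ha hL1
  set N := n + h with hN
  have hpow : (a + 1) * N ^ 4 < 2 ^ w := word_bound hn hh
  have hN2 : 2 ≤ N := by omega
  have hN4 : N ^ 2 * 4 ≤ N ^ 4 := by
    calc N ^ 2 * 4 ≤ N ^ 2 * N ^ 2 := by gcongr; nlinarith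
      _ = N ^ 4 := by ring
  have hNN : N * 2 ≤ N ^ 2 := by rw [pow_two]; gcongr
  have hmN : m ≤ a * N := by rw [hm]; gcongr; omega
  -- All size conditions on words follow from this: `n * n ≤ N ^ 2`, and both `m * n` and `2 * m`
  -- are at most `a * N ^ 2`.
  have hA : 4 * (a * N ^ 2) + 4 * N ^ 2 < 2 ^ w := by
    calc 4 * (a * N ^ 2) + 4 * N ^ 2 = (a + 1) * (N ^ 2 * 4) := by ring
      _ ≤ (a + 1) * N ^ 4 := by gcongr
      _ < _ := hpow
  have haN : a * N * 2 ≤ a * N ^ 2 := by rw [mul_assoc]; gcongr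
  have hmn : m * n ≤ a * N ^ 2 := by
    calc m * n ≤ (a * N) * N := by gcongr; omega
      _ = a * N ^ 2 := by ring
  have hnn : n * n ≤ N ^ 2 := by rw [pow_two]; gcongr <;> omega
  have haN' : a ≤ a * N := Nat.le_mul_of_pos_right _ (by omega)
  have b1 : 1 < 2 ^ w := by omega
  have hw1 : 1 ≤ w := by
    rcases Nat.eq_zero_or_pos w with h0 | h0
    · rw [h0] at b1; simp at b1
    · exact h0
  -- While the logarithm is computed the variables `2` and `3` still hold zero. They count as
  -- constants only in the second structured part, and are assigned by plain instructions in
  -- between.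
  have env1 : ∀ b < 8, constEnv n h 0 0 b < 2 ^ w := fun b _ => by
    simp only [constEnv]; split_ifs <;> omega
  have env2 : ∀ b < 8, constEnv n h L m b < 2 ^ w := fun b _ => by
    simp only [constEnv]; split_ifs <;> omega
  set S1 : (ℕ → Bool) → State := fun ω => logLoop.run w ω (input G h) with hS1
  set S2 : (ℕ → Bool) → State := fun ω => ((S1 ω).setW 2 L).setW 3 m with hS2
  have i33 : ∀ ω, (S1 ω).wvar 33 = Nat.clog 2 n := fun ω =>
    logLoop_spec (by simp [input]) (by simp [input]) b1 (by omega)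
  have iw : ∀ ω, ∀ x < 8, (S1 ω).wvar x = (input G h).wvar x := fun ω x hx =>
    SP.run_wvar (SP.writesW_of_wf rfl hx) _
  have ia : ∀ ω y, (S1 ω).warr y = (input G h).warr y := fun ω y => SP.run_warr rfl _
  have ir : ∀ ω y, (S1 ω).rarr y = (input G h).rarr y := fun ω y => SP.run_rarr rfl _
  have hI : ∀ ω, Inp w G h L m (S2 ω) := fun ω => by
    refine ⟨?_, ?_, ?_, ?_, ?_, ?_, ?_, ?_, ?_, ?_, ?_⟩
    · simp [S2, iw, input]
    · simp [S2, iw, input]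
    · simp [S2]
    · simp [S2]
    · simp [S2, ia]
    · simp [S2, ir]
    all_goals omega
  refine ⟨fun ω r => (levels.run w ω (S2 ω)).rarr 1 r, fun ω => ?_, fun ω r => ?_⟩
  · obtain ⟨t1, ht1, e1⟩ := SP.exec_compile (w := w) (ω := ω) hw1 env1 (p := logLoop) rfl
      (input G h) (fun b _ => by simp [input, constEnv])
    obtain ⟨t2, ht2, e2⟩ := SP.exec_compile (w := w) (ω := ω) hw1 env2 (p := levels) rfl
      (S2 ω) (fun b hb => by
        simp only [S2, State.setW_wvar, iw ω b hb, constEnv, input]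
        split_ifs <;> omega)
    refine ⟨_, _, .seq e1 (.seq (.setW 2 _ _) (.seq (t₂ := t2) (.setW 3 _ _) ?_)), fun r => rfl, ?_⟩
    · convert e2 using 1
      have hw2 : WExp.eval w (S1 ω) (.add (.var 33) (.lit 1)) = L := by
        simp only [WExp.eval, i33, Nat.mod_eq_of_lt b1]
        rw [Nat.mod_eq_of_lt (by omega), hL]
      have hw3 : WExp.eval w ((S1 ω).setW 2 L) (.mul (.lit a) (.var 2)) = m := by
        simp only [WExp.eval, State.setW_wvar, if_true]
        rw [Nat.mod_eq_of_lt (a := a) (by omega), ← hm, Nat.mod_eq_of_lt (by omega)]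
      change ((S1 ω).setW 2 (WExp.eval w (S1 ω) (.add (.var 33) (.lit 1)))).setW 3
        (WExp.eval w ((S1 ω).setW 2 (WExp.eval w (S1 ω) (.add (.var 33) (.lit 1))))
          (.mul (.lit a) (.var 2))) = S2 ω
      rw [hw2, hw3]
    · have c1 := logLoop_cost hn h 0 0
      have c2 := levels_cost hn hh hL1 hm1
      set ℓ := Nat.log 2 n + 1 with hℓ
      have hLℓ : L ≤ 2 * ℓ := by have := clog_le_log_add_one n; omega
      have c3 : 20000 * (h * n ^ 2 * L ^ 2 * m ^ 2) ≤ 320000 * (a ^ 2 * h * n ^ 2 * ℓ ^ 4) := by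
        calc 20000 * (h * n ^ 2 * L ^ 2 * m ^ 2) = 20000 * (a ^ 2 * h * n ^ 2 * L ^ 4) := by
              rw [hm]; ring
          _ ≤ 20000 * (a ^ 2 * h * n ^ 2 * (2 * ℓ) ^ 4) := by gcongr
          _ = 320000 * (a ^ 2 * h * n ^ 2 * ℓ ^ 4) := by ring
      have c4 : n ≤ a ^ 2 * h * n ^ 2 * ℓ ^ 4 := by
        calc n ≤ n ^ 2 := Nat.le_self_pow (by norm_num) n
          _ = 1 ^ 2 * 1 * n ^ 2 * 1 ^ 4 := by ring
          _ ≤ _ := by gcongr <;> omega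
      have c5 : 2000000 * a ^ 2 * h * n ^ 2 * ℓ ^ 4 = 2000000 * (a ^ 2 * h * n ^ 2 * ℓ ^ 4) := by
        ring
      rw [c5]
      simp only [WExp.cost]
      omega
  · exact levels_spec hG (hI ω) hm1 (by
      simp only [S2, State.setW_coins, S1]; rw [SP.run_coins rfl]; rfl)
      (fun r => by simp [S2, ia, input]) r

end RealRAM

/-! ### Probability: how samples hit and miss fixed sets. -/

namespace RealRAM

open MeasureTheory ProbabilityTheory

variable {n L m j : ℕ}

instance : IsProbabilityMeasure coinMeasure := by
  unfold coinMeasure; infer_instance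

theorem coinMeasure_forall_true (F : Finset ℕ) :
    coinMeasure {ω | ∀ x ∈ F, ω x = true} = (2⁻¹ : ENNReal) ^ F.card := by
  have h : {ω : ℕ → Bool | ∀ x ∈ F, ω x = true} = (F : Set ℕ).pi fun _ => {true} := by
    ext; simp [Set.pi]
  rw [h, coinMeasure, Measure.infinitePi_pi _ (fun _ _ => MeasurableSet.of_discrete)]
  simp [PMF.toMeasure_apply_fintype]

/-- The event that vertex `p.2` is sampled in trial `p.1` of level `j`. -/
def keep (n L m j : ℕ) (p : ℕ × Fin n) : Set (ℕ → Bool) := {ω | p.2 ∈ levelSet n ω L m j p.1}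

/-- The coins that decide `keep`. -/
def keepCoins (n L m j : ℕ) (p : ℕ × Fin n) : Finset ℕ :=
  (Finset.range j).image fun q => (j * m + p.1) * (n * L) + p.2 * L + q

theorem keep_eq (hj : j ≤ L) (p : ℕ × Fin n) :
    keep n L m j p = {ω | ∀ x ∈ keepCoins n L m j p, ω x = true} := by
  ext ω
  simp only [keep, levelSet, sampleSet, keepCoins, Finset.mem_filter, Finset.mem_univ, true_and,
    Set.mem_ofPred_eq, Finset.mem_image, Finset.mem_range, forall_exists_index, and_imp,
    forall_apply_eq_imp_iff₂]
  exact ⟨fun h q hq => h q (by omega) hq, fun h q _ hq => h q hq⟩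

theorem card_keepCoins (p : ℕ × Fin n) : (keepCoins n L m j p).card = j := by
  rw [keepCoins, Finset.card_image_of_injective _ (fun a b h => by simpa using h),
    Finset.card_range]

theorem eq_of_mul_add_eq {b x y x' y' : ℕ} (hy : y < b) (hy' : y' < b)
    (h : x * b + y = x' * b + y') : x = x' ∧ y = y' := by
  have hb : 0 < b := by omega
  have h1 : (x * b + y) / b = x := by
    rw [mul_comm, Nat.mul_add_div hb, Nat.div_eq_of_lt hy, add_zero]
  have h2 : (x' * b + y') / b = x' := by
    rw [mul_comm, Nat.mul_add_div hb, Nat.div_eq_of_lt hy', add_zero]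
  have hx : x = x' := by rw [← h1, h, h2]
  subst hx
  exact ⟨rfl, by omega⟩

/-- At a fixed level a coin index is a mixed-radix number with digits trial, vertex and position in
the block; its digits recover the pair. -/
theorem disjoint_keepCoins (hj : j ≤ L) {p p' : ℕ × Fin n} (hp : p ≠ p') :
    Disjoint (keepCoins n L m j p) (keepCoins n L m j p') := by
  rw [Finset.disjoint_left]
  intro x hx hx'
  simp only [keepCoins, Finset.mem_image, Finset.mem_range] at hx hx'
  obtain ⟨q, hq, rfl⟩ := hx
  obtain ⟨q', hq', h⟩ := hx'
  have h' : ((j * m + p'.1) * n + p'.2) * L + q' = ((j * m + p.1) * n + p.2) * L + q := by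
    rw [← mul_assoc, ← mul_assoc, ← add_mul, ← add_mul] at h; exact h
  obtain ⟨h1, -⟩ := eq_of_mul_add_eq (by omega) (by omega) h'
  obtain ⟨h2, h3⟩ := eq_of_mul_add_eq p'.2.2 p.2.2 h1
  exact hp (Prod.ext (by omega) (Fin.ext h3.symm))

theorem measurableSet_forall_true (F : Finset ℕ) :
    MeasurableSet {ω : ℕ → Bool | ∀ x ∈ F, ω x = true} := by
  have h : {ω : ℕ → Bool | ∀ x ∈ F, ω x = true} = (F : Set ℕ).pi fun _ => {true} := by
    ext; simp [Set.pi]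
  rw [h]
  exact MeasurableSet.pi F.countable_toSet fun _ _ => MeasurableSet.of_discrete

theorem coinMeasure_biInter_keep (hj : j ≤ L) (s : Finset (ℕ × Fin n)) :
    coinMeasure (⋂ p ∈ s, keep n L m j p) = ((2⁻¹ : ENNReal) ^ j) ^ s.card := by
  have h : (⋂ p ∈ s, keep n L m j p) =
      {ω | ∀ x ∈ s.biUnion (keepCoins n L m j), ω x = true} := by
    ext ω
    simp only [keep_eq hj, Set.mem_iInter, Set.mem_ofPred_eq, Finset.mem_biUnion]
    exact ⟨fun h x ⟨p, hp, hx⟩ => h p hp x hx, fun h p hp x hx => h x ⟨p, hp, hx⟩⟩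
  rw [h, coinMeasure_forall_true, Finset.card_biUnion fun p _ p' _ hp => disjoint_keepCoins hj hp]
  simp only [card_keepCoins, Finset.sum_const, smul_eq_mul]
  rw [mul_comm, pow_mul]

theorem coinMeasure_keep (hj : j ≤ L) (p : ℕ × Fin n) :
    coinMeasure (keep n L m j p) = (2⁻¹ : ENNReal) ^ j := by
  rw [keep_eq hj, coinMeasure_forall_true, card_keepCoins]

theorem measurableSet_keep (hj : j ≤ L) (p : ℕ × Fin n) : MeasurableSet (keep n L m j p) := by
  rw [keep_eq hj]; exact measurableSet_forall_true _

theorem iIndepSet_keep (hj : j ≤ L) : iIndepSet (keep n L m j) coinMeasure := by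
  rw [iIndepSet_iff_meas_biInter (measurableSet_keep hj)]
  intro s
  rw [coinMeasure_biInter_keep hj, Finset.prod_congr rfl fun p _ => coinMeasure_keep hj p,
    Finset.prod_const]

/-- By independence the probability is `(1 - 2 ^ (-j)) ^ s.card`, and `1 - x ≤ exp (-x)`. -/
theorem coinMeasure_biInter_keep_compl (hj : j ≤ L) (s : Finset (ℕ × Fin n)) :
    coinMeasure (⋂ p ∈ s, (keep n L m j p)ᶜ) ≤
      ENNReal.ofReal (Real.exp (-(2⁻¹ ^ j * s.card))) := by
  have h := (iIndepSet_keep (n := n) (m := m) hj)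
  rw [iIndepSet, Kernel.iIndepSet] at h
  have h2 := iIndep.meas_biInter (S := s) (s := fun p => (keep n L m j p)ᶜ) h fun p _ =>
    (MeasurableSpace.measurableSet_generateFrom (Set.mem_singleton _)).compl
  rw [h2]
  have h3 : ∀ p ∈ s, coinMeasure (keep n L m j p)ᶜ ≤ ENNReal.ofReal (Real.exp (-2⁻¹ ^ j)) := by
    intro p _
    rw [prob_compl_eq_one_sub (measurableSet_keep hj p), coinMeasure_keep hj]
    have h4 : (2⁻¹ : ENNReal) ^ j = ENNReal.ofReal (2⁻¹ ^ j) := by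
      rw [ENNReal.ofReal_pow (by norm_num), ENNReal.ofReal_inv_of_pos (by norm_num)]
      simp
    rw [h4, ← ENNReal.ofReal_one, ← ENNReal.ofReal_sub _ (by positivity)]
    refine ENNReal.ofReal_le_ofReal ?_
    have := Real.add_one_le_exp (-(2⁻¹ : ℝ) ^ j)
    linarith
  refine (Finset.prod_le_prod' h3).trans ?_
  rw [Finset.prod_const, ← ENNReal.ofReal_pow (Real.exp_nonneg _), ← Real.exp_nat_mul]
  refine ENNReal.ofReal_le_ofReal (Real.exp_le_exp.2 (le_of_eq ?_))
  ring

/-- The event that trial `i` of level `j` samples no vertex of `X`. -/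
def missEvent (n L m j : ℕ) (X : Finset (Fin n)) (i : ℕ) : Set (ℕ → Bool) :=
  {ω | Disjoint X (levelSet n ω L m j i)}

/-- All `I.card * X.card` pairs of a trial and a vertex are rejected, so the exponent is at least
`64 * I.card`, and `exp (-64) ≤ 1 / 64`. -/
theorem coinMeasure_miss_le (hj : j ≤ L) {X : Finset (Fin n)} (hX : 64 * 2 ^ j ≤ X.card)
    (I : Finset ℕ) :
    coinMeasure (⋂ i ∈ I, missEvent n L m j X i) ≤ (64⁻¹ : ENNReal) ^ I.card := by
  have h1 : (⋂ i ∈ I, missEvent n L m j X i) ⊆ ⋂ p ∈ I ×ˢ X, (keep n L m j p)ᶜ := by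
    intro ω hω
    simp only [Set.mem_iInter, missEvent, Set.mem_ofPred_eq, Finset.disjoint_left, keep,
      Set.mem_compl_iff] at hω ⊢
    exact fun p hp => hω p.1 (Finset.mem_product.1 hp).1 (Finset.mem_product.1 hp).2
  refine (measure_mono h1).trans ((coinMeasure_biInter_keep_compl hj _).trans ?_)
  have h2 : (64⁻¹ : ENNReal) ^ I.card = ENNReal.ofReal (64⁻¹ ^ I.card) := by
    rw [ENNReal.ofReal_pow (by norm_num), ENNReal.ofReal_inv_of_pos (by norm_num)]
    simp
  rw [h2]
  refine ENNReal.ofReal_le_ofReal ?_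
  have h3 : (64 : ℝ) ≤ 2⁻¹ ^ j * X.card := by
    have : (64 : ℝ) * 2 ^ j ≤ X.card := by exact_mod_cast hX
    rw [inv_pow, inv_mul_eq_div, le_div_iff₀ (by positivity)]
    exact this
  have h4 : Real.exp (-64) ≤ 64⁻¹ := by
    rw [Real.exp_neg]
    refine inv_anti₀ (by norm_num) ?_
    have := Real.add_one_le_exp (64 : ℝ)
    linarith
  calc Real.exp (-(2⁻¹ ^ j * ((I ×ˢ X).card : ℝ)))
      ≤ Real.exp (I.card * (-64)) := by
        refine Real.exp_le_exp.2 ?_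
        rw [Finset.card_product]
        push_cast
        have : (0 : ℝ) ≤ I.card := by positivity
        nlinarith
    _ = Real.exp (-64) ^ I.card := Real.exp_nat_mul _ _
    _ ≤ _ := pow_le_pow_left₀ (Real.exp_nonneg _) h4 _

/-- The event that trial `i` of level `j` samples a vertex of `X`. -/
def hitEvent (n L m j : ℕ) (X : Finset (Fin n)) (i : ℕ) : Set (ℕ → Bool) :=
  {ω | ¬ Disjoint X (levelSet n ω L m j i)}

/-- Choose a hit vertex for every trial. There are `X.card ^ I.card` choices, and each has
probability `2 ^ (-j * I.card)`, because its pairs are distinct. -/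
theorem coinMeasure_hit_le (hj : j ≤ L) {X : Finset (Fin n)} (hX : 64 * X.card ≤ 2 ^ j)
    (I : Finset ℕ) :
    coinMeasure (⋂ i ∈ I, hitEvent n L m j X i) ≤ (64⁻¹ : ENNReal) ^ I.card := by
  classical
  let s : (I → Fin n) → Finset (ℕ × Fin n) := fun f =>
    Finset.univ.image fun i : I => ((i : ℕ), f i)
  have hs : ∀ f, (s f).card = I.card := fun f => by
    rw [Finset.card_image_of_injective _ (fun a b h => Subtype.ext (Prod.ext_iff.1 h).1)]
    simp
  have h1 : (⋂ i ∈ I, hitEvent n L m j X i) ⊆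
      ⋃ f ∈ Fintype.piFinset (fun _ : I => X), ⋂ p ∈ s f, keep n L m j p := by
    intro ω hω
    simp only [Set.mem_iInter, hitEvent, Set.mem_ofPred_eq, Finset.not_disjoint_iff] at hω
    choose f hf1 hf2 using hω
    simp only [Set.mem_iUnion, Set.mem_iInter]
    refine ⟨fun i => f i i.2, Fintype.mem_piFinset.2 fun i => hf1 i i.2, fun p hp => ?_⟩
    obtain ⟨i, -, rfl⟩ := Finset.mem_image.1 hp
    exact hf2 i i.2
  refine (measure_mono h1).trans ((measure_biUnion_finset_le _ _).trans ?_)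
  rw [Finset.sum_congr rfl fun f _ => by rw [coinMeasure_biInter_keep hj, hs], Finset.sum_const,
    Fintype.card_piFinset, Finset.prod_const, Finset.card_univ, Fintype.card_coe, nsmul_eq_mul]
  push_cast
  rw [← mul_pow]
  refine pow_le_pow_left₀ zero_le ?_ _
  rw [← ENNReal.inv_pow, ← div_eq_mul_inv, ENNReal.div_le_iff (by simp) (by simp), mul_comm,
    ← div_eq_mul_inv, ENNReal.le_div_iff_mul_le (by simp) (by simp), mul_comm]
  exact_mod_cast hX

/-- Union bound over at most `2 ^ m` index sets, each of probability at most `64 ^ (-m / 2) = 8 ^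
(-m)`. Only the bounds on intersections are needed, not independence of the events. -/
theorem majority_le {Ω : Type*} [MeasurableSpace Ω] (μ : Measure Ω) (E : ℕ → Set Ω) (m : ℕ)
    (hE : ∀ I : Finset ℕ, μ (⋂ i ∈ I, E i) ≤ (64⁻¹ : ENNReal) ^ I.card) :
    μ {ω | ∃ I ⊆ Finset.range m, m ≤ 2 * I.card ∧ ∀ i ∈ I, ω ∈ E i} ≤ (4⁻¹ : ENNReal) ^ m := by
  have h1 : {ω | ∃ I ⊆ Finset.range m, m ≤ 2 * I.card ∧ ∀ i ∈ I, ω ∈ E i} ⊆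
      ⋃ I ∈ (Finset.range m).powerset.filter fun I => m ≤ 2 * I.card, ⋂ i ∈ I, E i := by
    rintro ω ⟨I, hI, hc, h⟩
    simp only [Set.mem_iUnion, Set.mem_iInter]
    exact ⟨I, Finset.mem_filter.2 ⟨Finset.mem_powerset.2 hI, hc⟩, h⟩
  refine (measure_mono h1).trans ((measure_biUnion_finset_le _ _).trans ?_)
  have h8 : (64⁻¹ : ENNReal) = (8⁻¹) ^ 2 := by
    rw [← ENNReal.inv_pow]; norm_num
  have h2 : ∀ I ∈ (Finset.range m).powerset.filter (fun I => m ≤ 2 * I.card),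
      μ (⋂ i ∈ I, E i) ≤ (8⁻¹ : ENNReal) ^ m := by
    intro I hI
    refine (hE I).trans ?_
    rw [h8, ← pow_mul]
    exact pow_le_pow_of_le_one zero_le (by simp) (Finset.mem_filter.1 hI).2
  refine (Finset.sum_le_sum h2).trans ?_
  rw [Finset.sum_const, nsmul_eq_mul]
  calc _ ≤ (2 : ENNReal) ^ m * 8⁻¹ ^ m := by
        gcongr
        have := Finset.card_filter_le (Finset.range m).powerset fun I => m ≤ 2 * I.card
        rw [Finset.card_powerset, Finset.card_range] at this
        exact_mod_cast this
    _ = _ := by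
        rw [← mul_pow]
        congr 1
        rw [show (8 : ENNReal) = 2 * 4 by norm_num, ENNReal.mul_inv (by simp) (by simp),
          ← mul_assoc, ENNReal.mul_inv_cancel (by simp) (by simp), one_mul]

/-- Samples of level `j` hit or miss a set of the family `F` contrary to its size. -/
def badEvent (n L m : ℕ) (F : Finset (Finset (Fin n))) : Set (ℕ → Bool) :=
  {ω | ∃ j < L, ∃ X ∈ F,
    (64 * 2 ^ j ≤ X.card ∧ ∃ I ⊆ Finset.range m, m ≤ 2 * I.card ∧
      ∀ i ∈ I, ω ∈ missEvent n L m j X i) ∨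
    (64 * X.card ≤ 2 ^ j ∧ ∃ I ⊆ Finset.range m, m ≤ 2 * I.card ∧
      ∀ i ∈ I, ω ∈ hitEvent n L m j X i)}

theorem coinMeasure_badEvent_le (n L m : ℕ) (F : Finset (Finset (Fin n))) :
    coinMeasure (badEvent n L m F) ≤ (L * (F.card * 2) : ℕ) * (4⁻¹ : ENNReal) ^ m := by
  have h1 : badEvent n L m F ⊆ ⋃ j ∈ Finset.range L, ⋃ X ∈ F,
      ({ω | 64 * 2 ^ j ≤ X.card ∧ ∃ I ⊆ Finset.range m, m ≤ 2 * I.card ∧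
        ∀ i ∈ I, ω ∈ missEvent n L m j X i} ∪
      {ω | 64 * X.card ≤ 2 ^ j ∧ ∃ I ⊆ Finset.range m, m ≤ 2 * I.card ∧
        ∀ i ∈ I, ω ∈ hitEvent n L m j X i}) := by
    rintro ω ⟨j, hj, X, hX, h⟩
    simp only [Set.mem_iUnion]
    exact ⟨j, Finset.mem_range.2 hj, X, hX, h⟩
  have h2 : ∀ j ∈ Finset.range L, ∀ X ∈ F, coinMeasure
      ({ω | 64 * 2 ^ j ≤ X.card ∧ ∃ I ⊆ Finset.range m, m ≤ 2 * I.card ∧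
        ∀ i ∈ I, ω ∈ missEvent n L m j X i} ∪
      {ω | 64 * X.card ≤ 2 ^ j ∧ ∃ I ⊆ Finset.range m, m ≤ 2 * I.card ∧
        ∀ i ∈ I, ω ∈ hitEvent n L m j X i}) ≤ 2 * (4⁻¹ : ENNReal) ^ m := by
    intro j hj X _
    have hj' := (Finset.mem_range.1 hj).le
    refine (measure_union_le _ _).trans ?_
    rw [two_mul]
    refine add_le_add ?_ ?_
    · by_cases hX : 64 * 2 ^ j ≤ X.card
      · simpa [hX] using majority_le coinMeasure _ m (coinMeasure_miss_le (m := m) hj' hX)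
      · simp [hX]
    · by_cases hX : 64 * X.card ≤ 2 ^ j
      · simpa [hX] using majority_le coinMeasure _ m (coinMeasure_hit_le (m := m) hj' hX)
      · simp [hX]
  refine (measure_mono h1).trans ((measure_biUnion_finset_le _ _).trans ?_)
  refine (Finset.sum_le_sum fun j hj => (measure_biUnion_finset_le _ _).trans
    (Finset.sum_le_sum (h2 j hj))).trans (le_of_eq ?_)
  simp only [Finset.sum_const, nsmul_eq_mul, Finset.card_range]
  push_cast
  ring

end RealRAM

/-! ### From good samples to small balls. -/

open RealRAM NegGraph

namespace RealRAM

variable {n L m j : ℕ} {ω : ℕ → Bool}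

open Classical in
/-- All sets of the form `{v | f v < x}` or `{v | f v ≤ x}`. -/
noncomputable def sublevels (f : Fin n → EReal) : Finset (Finset (Fin n)) :=
  insert Finset.univ (insert ∅
    (Finset.univ.image (fun u => Finset.univ.filter fun v => f v < f u) ∪
      Finset.univ.image (fun u => Finset.univ.filter fun v => f v ≤ f u)))

theorem card_sublevels_le (f : Fin n → EReal) : (sublevels f).card ≤ 2 * n + 2 := by
  classical
  refine (Finset.card_insert_le _ _).trans ?_
  have h1 := Finset.card_insert_le (∅ : Finset (Fin n))
    (Finset.univ.image (fun u => Finset.univ.filter fun v => f v < f u) ∪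
      Finset.univ.image (fun u => Finset.univ.filter fun v => f v ≤ f u))
  have h2 := Finset.card_union_le
    (Finset.univ.image (fun u => Finset.univ.filter fun v => f v < f u))
    (Finset.univ.image (fun u => Finset.univ.filter fun v => f v ≤ f u))
  have h3 := Finset.card_image_le (s := (Finset.univ : Finset (Fin n)))
    (f := fun u => Finset.univ.filter fun v => f v < f u)
  have h4 := Finset.card_image_le (s := (Finset.univ : Finset (Fin n)))
    (f := fun u => Finset.univ.filter fun v => f v ≤ f u)
  rw [Finset.card_univ, Fintype.card_fin] at h3 h4
  omega

-- The threshold will be a random median. Replacing it by the least value of `f` at or above it does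
-- not change the set, so the set lies in a family fixed before any coin is tossed.
open Classical in
theorem filter_lt_mem_sublevels (f : Fin n → EReal) (x : EReal) :
    (Finset.univ.filter fun v => f v < x) ∈ sublevels f := by
  by_cases h : ∃ u, x ≤ f u
  · obtain ⟨u, hu, hmin⟩ := Finset.exists_min_image (Finset.univ.filter fun u => x ≤ f u) f
      (by obtain ⟨u, hu⟩ := h; exact ⟨u, by simpa⟩)
    simp only [Finset.mem_filter, Finset.mem_univ, true_and] at hu hmin
    refine Finset.mem_insert_of_mem (Finset.mem_insert_of_mem (Finset.mem_union_left _
      (Finset.mem_image.2 ⟨u, Finset.mem_univ u, Finset.filter_congr fun v _ => ?_⟩)))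
    exact ⟨fun hv => lt_of_not_ge fun hx => absurd (hmin v hx) (not_le.2 hv),
      fun hv => hv.trans_le hu⟩
  · push Not at h
    rw [Finset.filter_true_of_mem fun v _ => h v]
    exact Finset.mem_insert_self _ _

open Classical in
theorem filter_le_mem_sublevels (f : Fin n → EReal) (x : EReal) :
    (Finset.univ.filter fun v => f v ≤ x) ∈ sublevels f := by
  by_cases h : ∃ u, f u ≤ x
  · obtain ⟨u, hu, hmax⟩ := Finset.exists_max_image (Finset.univ.filter fun u => f u ≤ x) f
      (by obtain ⟨u, hu⟩ := h; exact ⟨u, by simpa⟩)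
    simp only [Finset.mem_filter, Finset.mem_univ, true_and] at hu hmax
    refine Finset.mem_insert_of_mem (Finset.mem_insert_of_mem (Finset.mem_union_right _
      (Finset.mem_image.2 ⟨u, Finset.mem_univ u, Finset.filter_congr fun v _ => ?_⟩)))
    exact ⟨fun hv => hv.trans hu, fun hv => hmax v hv⟩
  · push Not at h
    rw [Finset.filter_false_of_mem fun v _ => not_le.2 (h v)]
    exact Finset.mem_insert_of_mem (Finset.mem_insert_self _ _)

variable {F : Finset (Finset (Fin n))} {f : Fin n → EReal}

-- At least half of the samples have distance at most `a`, hence contain a vertex of the closed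
-- ball; if the ball were small, this would be a bad event. Since `a` is real, such a sample is
-- nonempty and its infimum is attained.
open Classical in
theorem lt_card_of_isMedian (hω : ω ∉ badEvent n L m F) (hF : sublevels f ⊆ F) (hj : j < L)
    {a : ℝ} (ha : IsMedian m (fun i => (levelSet n ω L m j i).inf f) a) :
    2 ^ j < 64 * (Finset.univ.filter fun v => f v ≤ a).card := by
  by_contra! hle
  refine hω ⟨j, hj, _, hF (filter_le_mem_sublevels f a), Or.inr ⟨hle, _, Finset.filter_subset _ _,
    ha.2, fun i hi => ?_⟩⟩
  have hi : (levelSet n ω L m j i).inf f ≤ a := (Finset.mem_filter.1 hi).2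
  have hne : (levelSet n ω L m j i).Nonempty := by
    by_contra hne
    rw [Finset.not_nonempty_iff_eq_empty.1 hne, Finset.inf_empty, top_le_iff] at hi
    exact EReal.coe_ne_top a hi
  obtain ⟨v, hv, hfv⟩ := Finset.exists_mem_eq_inf _ hne f
  rw [hfv] at hi
  exact Finset.not_disjoint_iff.2 ⟨v, by simpa using hi, hv⟩

-- At least half of the samples have distance at least `a`, hence miss the open ball. At level `0`
-- every sample is the full vertex set, so the ball is empty with certainty.
open Classical in
theorem card_lt_of_isMedian (hω : ω ∉ badEvent n L m F) (hF : sublevels f ⊆ F) (hj : j < L)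
    (hm : 0 < m) {a : EReal} (ha : IsMedian m (fun i => (levelSet n ω L m j i).inf f) a) :
    (Finset.univ.filter fun v => f v < a).card < 64 * 2 ^ j ∧
      (j = 0 → (Finset.univ.filter fun v => f v < a).card = 0) := by
  set I := (Finset.range m).filter fun i => ¬ (levelSet n ω L m j i).inf f < a with hI
  have hcard : m ≤ 2 * I.card := by
    have h1 := Finset.card_filter_add_card_filter_not (s := Finset.range m)
      (fun i => (levelSet n ω L m j i).inf f < a)
    have h2 : 2 * ((Finset.range m).filter fun i => (levelSet n ω L m j i).inf f < a).card ≤ m :=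
      ha.1
    rw [Finset.card_range, ← hI] at h1
    omega
  have hmiss : ∀ i ∈ I, ω ∈ missEvent n L m j (Finset.univ.filter fun v => f v < a) i := by
    intro i hi
    have hi := (Finset.mem_filter.1 hi).2
    refine Finset.disjoint_left.2 fun v hv hv' => hi ?_
    exact (Finset.inf_le hv').trans_lt (by simpa using hv)
  refine ⟨?_, ?_⟩
  · by_contra! hle
    exact hω ⟨j, hj, _, hF (filter_lt_mem_sublevels f a), Or.inl ⟨hle, I, Finset.filter_subset _ _,
      hcard, hmiss⟩⟩
  · rintro rfl
    obtain ⟨i, hi⟩ : I.Nonempty := Finset.card_pos.1 (by omega)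
    have h := hmiss i hi
    have huniv : levelSet n ω L m 0 i = Finset.univ := by simp [levelSet, sampleSet]
    rw [missEvent, Set.mem_ofPred_eq, huniv] at h
    rw [Finset.card_eq_zero]
    exact disjoint_top.1 h

open Classical in
/-- The pairs of vertices that `r` lies between. -/
noncomputable def betweenPairs (G : NegGraph n) (h : ℕ) (r : Fin n) : Finset (Fin n × Fin n) :=
  Finset.univ.filter fun p => G.hopDist h p.1 r + G.hopDist h r p.2 < 0

open Classical in
theorem card_mul_card_le_betweenPairs (G : NegGraph n) (h : ℕ) (r : Fin n) {a c : ℝ}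
    (hac : a + c < 0) :
    (Finset.univ.filter fun v => G.hopDist h v r ≤ a).card *
      (Finset.univ.filter fun v => G.hopDist h r v ≤ c).card ≤ (betweenPairs G h r).card := by
  rw [← Finset.card_product]
  refine Finset.card_le_card fun p hp => ?_
  simp only [Finset.mem_product, Finset.mem_filter, Finset.mem_univ, true_and] at hp
  refine Finset.mem_filter.2 ⟨Finset.mem_univ _, (add_le_add hp.1 hp.2).trans_lt ?_⟩
  rw [← EReal.coe_add]
  exact_mod_cast hac

theorem sum_betweenPairs (G : NegGraph n) (h : ℕ) :
    ∑ r ∈ G.negVerts, (betweenPairs G h r).card =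
      ∑ p : Fin n × Fin n, G.betweenness h p.1 p.2 := by
  classical
  simp only [betweenPairs, NegGraph.betweenness, Finset.card_filter]
  exact Finset.sum_comm

open Classical in
/-- The sets whose samples determine the quality of the thresholds. -/
noncomputable def distanceSublevels (G : NegGraph n) (h : ℕ) : Finset (Finset (Fin n)) :=
  Finset.univ.biUnion fun r =>
    sublevels (fun v => G.hopDist h v r) ∪ sublevels (fun v => G.hopDist h r v)

theorem card_distanceSublevels_le (G : NegGraph n) (h : ℕ) :
    (distanceSublevels G h).card ≤ n * (4 * n + 4) := by
  classical
  refine (Finset.card_biUnion_le_card_mul _ _ (4 * n + 4) fun r _ => ?_).trans (by simp)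
  refine (Finset.card_union_le _ _).trans ?_
  have h1 := card_sublevels_le fun v => G.hopDist h v r
  have h2 := card_sublevels_le fun v => G.hopDist h r v
  omega

/-- If `r` is settled at level `k + 1`, its two balls have together at most `2 * 64 * 2 ^ (k + 1) =
2 ^ 8 * 2 ^ k` elements, while level `k` being low gives `4 ^ k ≤ 2 ^ 12` times the number of pairs.
Squaring yields `2 ^ 16 * 2 ^ 12 = 2 ^ 28`. -/
theorem ballSize_sq_le {G : NegGraph n} {h : ℕ} (hω : ω ∉ badEvent n L m (distanceSublevels G h))
    (hn : n ≤ 2 ^ (L - 1)) (hL : 1 ≤ L) (hm : 0 < m) {Δ : Fin n → ℝ} {r : Fin n}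
    (H : (∀ j < L, Low m (fun i => G.setDist (levelSet n ω L m j i) h r)
        (fun i => G.rev.setDist (levelSet n ω L m j i) h r)) ∨
      ∃ j < L, High m (fun i => G.setDist (levelSet n ω L m j i) h r)
        (fun i => G.rev.setDist (levelSet n ω L m j i) h r) (Δ r) ∧
        ∀ j' < j, Low m (fun i => G.setDist (levelSet n ω L m j' i) h r)
        (fun i => G.rev.setDist (levelSet n ω L m j' i) h r)) :
    (G.ballSize h Δ r) ^ 2 ≤ 2 ^ 28 * (betweenPairs G h r).card := by
  classical
  have hF1 : sublevels (fun v => G.hopDist h v r) ⊆ distanceSublevels G h := fun X hX =>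
    Finset.mem_biUnion.2 ⟨r, Finset.mem_univ r, Finset.mem_union_left _ hX⟩
  have hF2 : sublevels (fun v => G.hopDist h r v) ⊆ distanceSublevels G h := fun X hX =>
    Finset.mem_biUnion.2 ⟨r, Finset.mem_univ r, Finset.mem_union_right _ hX⟩
  simp only [setDist, hopDist_rev] at H
  have hlow : ∀ j < L, Low m (fun i => (levelSet n ω L m j i).inf fun s => G.hopDist h s r)
      (fun i => (levelSet n ω L m j i).inf fun s => G.hopDist h r s) →
      2 ^ j * 2 ^ j ≤ 2 ^ 12 * (betweenPairs G h r).card := by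
    rintro j hj ⟨a, c, hac, ha, hc⟩
    have h1 := lt_card_of_isMedian hω hF1 hj ha
    have h2 := lt_card_of_isMedian hω hF2 hj hc
    have h3 := card_mul_card_le_betweenPairs G h r hac
    calc 2 ^ j * 2 ^ j ≤ _ := Nat.mul_le_mul h1.le h2.le
      _ = 2 ^ 12 * ((Finset.univ.filter fun v => G.hopDist h v r ≤ a).card *
          (Finset.univ.filter fun v => G.hopDist h r v ≤ c).card) := by ring
      _ ≤ _ := Nat.mul_le_mul_left _ h3
  rcases H with H | ⟨j, hj, ⟨a, c, hδ, hδ', ha, hc⟩, H⟩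
  -- All levels are low: the top one has `2 ^ (L - 1) ≥ n`, so the trivial bound `2 * n` on the ball
  -- sizes is good enough whatever the threshold.
  · have h1 := hlow (L - 1) (by omega) (H _ (by omega))
    have h2 : G.ballSize h Δ r ≤ 2 * n := by
      have h3 := Finset.card_le_univ (G.inBall h r (Δ r))
      have h4 := Finset.card_le_univ (G.outBall h r (-Δ r))
      rw [Fintype.card_fin] at h3 h4
      rw [ballSize]; omega
    calc (G.ballSize h Δ r) ^ 2 ≤ (2 * 2 ^ (L - 1)) ^ 2 := by gcongr; omega
      _ = 4 * (2 ^ (L - 1) * 2 ^ (L - 1)) := by ring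
      _ ≤ 4 * (2 ^ 12 * (betweenPairs G h r).card) := by gcongr
      _ ≤ _ := by omega
  · obtain ⟨a1, a0⟩ := card_lt_of_isMedian hω hF1 hj hm ha
    obtain ⟨c1, c0⟩ := card_lt_of_isMedian hω hF2 hj hm hc
    have h3 : (G.inBall h r (Δ r)).card ≤
        (Finset.univ.filter fun v => G.hopDist h v r < a).card :=
      Finset.card_le_card fun v hv => by
        simp only [inBall, Finset.mem_filter, Finset.mem_univ, true_and] at hv ⊢
        exact hv.trans_le hδ
    have h4 : (G.outBall h r (-Δ r)).card ≤
        (Finset.univ.filter fun v => G.hopDist h r v < c).card :=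
      Finset.card_le_card fun v hv => by
        simp only [outBall, Finset.mem_filter, Finset.mem_univ, true_and] at hv ⊢
        exact hv.trans_le hδ'
    -- At level `0` there is no previous low level to compare with, but both balls are empty.
    rcases Nat.eq_zero_or_pos j with h0 | h0
    · have : G.ballSize h Δ r = 0 := by
        rw [ballSize]
        have := a0 h0
        have := c0 h0
        omega
      rw [this]; simp
    · obtain ⟨k, rfl⟩ : ∃ k, j = k + 1 := ⟨j - 1, by omega⟩
      have h1 := hlow k (by omega) (H k (by omega))
      have h2 : G.ballSize h Δ r ≤ 2 ^ 8 * 2 ^ k := by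
        rw [pow_succ] at a1 c1
        rw [ballSize]; omega
      calc (G.ballSize h Δ r) ^ 2 ≤ (2 ^ 8 * 2 ^ k) ^ 2 := by gcongr
        _ = 2 ^ 16 * (2 ^ k * 2 ^ k) := by ring
        _ ≤ 2 ^ 16 * (2 ^ 12 * (betweenPairs G h r).card) := by gcongr
        _ = _ := by ring

/-- If the thresholds are good at every vertex and the betweenness is small, then so are the sums
of the ball sizes. -/
theorem sum_ballSize_le {G : NegGraph n} {h : ℕ} {Δ : Fin n → ℝ} {b : ℝ} (hb : 1 ≤ b)
    (hG : ∀ u v : Fin n, (G.betweenness h u v : ℝ) ≤ (G.negVerts.card : ℝ) / b)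
    (H : ∀ r, (G.ballSize h Δ r) ^ 2 ≤ 2 ^ 28 * (betweenPairs G h r).card) :
    (∑ r ∈ G.negVerts, (G.ballSize h Δ r : ℝ) ^ 2 ≤
      2 ^ 28 * ((G.negVerts.card : ℝ) * (n : ℝ) ^ 2 / b)) ∧
    (∑ r ∈ G.negVerts, (G.ballSize h Δ r : ℝ) ≤
      2 ^ 28 * ((G.negVerts.card : ℝ) * (n : ℝ) / √b)) := by
  have h1 : ∑ r ∈ G.negVerts, (G.ballSize h Δ r : ℝ) ^ 2 ≤
      2 ^ 28 * ((G.negVerts.card : ℝ) * (n : ℝ) ^ 2 / b) := by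
    calc ∑ r ∈ G.negVerts, (G.ballSize h Δ r : ℝ) ^ 2
        ≤ ∑ r ∈ G.negVerts, 2 ^ 28 * ((betweenPairs G h r).card : ℝ) :=
          Finset.sum_le_sum fun r _ => by exact_mod_cast H r
      _ = 2 ^ 28 * ((∑ r ∈ G.negVerts, (betweenPairs G h r).card : ℕ) : ℝ) := by
          rw [← Finset.mul_sum]; push_cast; rfl
      _ = 2 ^ 28 * ∑ p : Fin n × Fin n, (G.betweenness h p.1 p.2 : ℝ) := by
          rw [sum_betweenPairs]; push_cast; rfl
      _ ≤ 2 ^ 28 * ∑ _p : Fin n × Fin n, (G.negVerts.card : ℝ) / b := by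
          gcongr; exact hG _ _
      _ = _ := by
          simp only [Finset.sum_const, Finset.card_univ, Fintype.card_prod, Fintype.card_fin,
            nsmul_eq_mul]
          push_cast
          ring
  refine ⟨h1, ?_⟩
  have hb0 : 0 < b := by linarith
  -- Cauchy–Schwarz turns the bound on squares into the bound on the sum.
  refine le_of_sq_le_sq ?_ (by positivity)
  calc (∑ r ∈ G.negVerts, (G.ballSize h Δ r : ℝ)) ^ 2
      ≤ G.negVerts.card * ∑ r ∈ G.negVerts, (G.ballSize h Δ r : ℝ) ^ 2 :=
        sq_sum_le_card_mul_sum_sq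
    _ ≤ G.negVerts.card * (2 ^ 28 * ((G.negVerts.card : ℝ) * (n : ℝ) ^ 2 / b)) := by gcongr
    _ = 2 ^ 28 * ((G.negVerts.card : ℝ) ^ 2 * (n : ℝ) ^ 2 / b) := by ring
    _ ≤ (2 ^ 28) ^ 2 * ((G.negVerts.card : ℝ) ^ 2 * (n : ℝ) ^ 2 / b) := by gcongr; norm_num
    _ = (2 ^ 28 * ((G.negVerts.card : ℝ) * (n : ℝ) / √b)) ^ 2 := by
        rw [mul_pow, div_pow, Real.sq_sqrt hb0.le, mul_pow (_ : ℝ) (n : ℝ)]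

theorem badEvent_small {c h : ℕ} (hn : 1 ≤ n) (G : NegGraph n) (hL : L = Nat.clog 2 n + 1)
    (hm : m = (c + 8) * L) :
    coinMeasure (badEvent n L m (distanceSublevels G h)) ≤ ((n : ENNReal) ^ c)⁻¹ := by
  -- For `n = 1` the claimed bound equals `1`; below, `2 ≤ n` lets `n ^ 5` absorb the constant `2 ^
  -- 5`.
  rcases hn.eq_or_lt with rfl | hn
  · simpa using MeasureTheory.prob_le_one
  refine (coinMeasure_badEvent_le n L m _).trans ?_
  have hpow : n ≤ 2 ^ L := (Nat.le_pow_clog (by norm_num) n).trans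
    (Nat.pow_le_pow_right (by norm_num) (by omega))
  have hLn : L ≤ 2 * n := by
    have : Nat.clog 2 n ≤ n := Nat.clog_le_of_le_pow (Nat.lt_two_pow_self).le
    omega
  have key : L * ((distanceSublevels G h).card * 2) * n ^ c ≤ 4 ^ m := by
    calc L * ((distanceSublevels G h).card * 2) * n ^ c
        ≤ (2 * n) * ((n * (8 * n)) * 2) * n ^ c := by
          gcongr
          refine (card_distanceSublevels_le G h).trans ?_
          gcongr; omega
      _ = 2 ^ 5 * (n ^ 3 * n ^ c) := by ring
      _ ≤ n ^ 5 * (n ^ 3 * n ^ c) := by gcongr; omega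
      _ = n ^ (c + 8) := by ring
      _ ≤ (2 ^ L) ^ (c + 8) := by gcongr
      _ = 2 ^ m := by rw [← pow_mul, hm, mul_comm]
      _ ≤ 4 ^ m := by gcongr; norm_num
  rw [ENNReal.le_inv_iff_mul_le, ← ENNReal.inv_pow, mul_right_comm, ← div_eq_mul_inv]
  refine ENNReal.div_le_of_le_mul ?_
  rw [one_mul]
  exact_mod_cast key

end RealRAM

theorem mainTheorem4 :
    ∃ C : ℝ, ∀ c : ℕ, ∃ (P : RealRAM.Prog) (κ K k : ℕ),
      ∀ (n h : ℕ), 1 ≤ n → 1 ≤ h → ∀ G : NegGraph n, G.WellBehaved →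
        ∃ Δ : (ℕ → Bool) → Fin n → ℝ,
          (∀ ω : ℕ → Bool, ∃ (s : RealRAM.State) (t : ℕ),
            RealRAM.Exec (κ * (Nat.log 2 (n + h) + 1)) ω P (RealRAM.input G h) s t ∧
            (∀ r ∈ G.negVerts, s.rarr 1 r = Δ ω r) ∧
            t ≤ K * h * n ^ 2 * (Nat.log 2 n + 1) ^ k) ∧
          ∀ b : ℝ, 1 ≤ b →
            (∀ u v : Fin n, (G.betweenness h u v : ℝ) ≤ (G.negVerts.card : ℝ) / b) →
            RealRAM.coinMeasure
                {ω | ¬ ((∑ r ∈ G.negVerts, (G.ballSize h (Δ ω) r : ℝ) ^ 2 ≤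
                          C * ((G.negVerts.card : ℝ) * (n : ℝ) ^ 2 / b)) ∧
                        (∑ r ∈ G.negVerts, (G.ballSize h (Δ ω) r : ℝ) ≤
                          C * ((G.negVerts.card : ℝ) * (n : ℝ) / √b)))} ≤
              ((n : ENNReal) ^ c)⁻¹ := by
  -- `(c + 8) * L` trials per level make `4 ^ m` at least `n ^ (c + 8)`, enough for the union bound.
  -- The exponent `4` of the logarithm comes from `L ^ 2 * m ^ 2`.
  refine ⟨2 ^ 28, fun c => ⟨program (c + 8), c + 8 + 4, 2000000 * (c + 8) ^ 2, 4,
    fun n h hn hh G hG => ?_⟩⟩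
  obtain ⟨Δ, hrun, hΔ⟩ := program_spec (a := c + 8) (by omega) hn hh hG rfl rfl
  refine ⟨Δ, fun ω => ?_, fun b hb hbet => ?_⟩
  · obtain ⟨s, t, he, hs, ht⟩ := hrun ω
    exact ⟨s, t, he, fun r _ => hs r, ht⟩
  -- Failure for any admissible `b` lies in the same event `badEvent`.
  · refine (MeasureTheory.measure_mono fun ω hω => ?_).trans (badEvent_small (h := h) hn G rfl rfl)
    by_contra hgood
    refine hω (sum_ballSize_le hb hbet fun r => ballSize_sq_le hgood ?_ (by omega) (by positivity)
      (hΔ ω r))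
    exact Nat.le_pow_clog (by norm_num) n
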